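/- Let $n\ge 0$, write $\bar a=-a$, and let $[h,l]=\{h,\dots,l\}\setminus\{0\}$ for $h\le l$; all intervals below are such subintervals $[a,b]$ of $[\bar n,n]$ with nonzero endpoints $a\le b$. Let $\mathfrak S_{[\bar n,n]}$ be the group of permutations $w=w_{\bar n}\cdots w_{\bar 1}w_1\cdots w_n$ of $[\bar n,n]$, and let $\mathfrak B_n=\{w : w_{\bar i}=\overline{w_i}\text{ for all }i\}$ be the hyperoctahedral group. **Networks.** A network has sources and sinks labelled by $[\bar n,n]$, and directed edges carrying positive integer multiplicities; networks are considered up to isomorphism of directed graphs preserving multiplicities and the labels of sources and sinks. The trivial network $F_\emptyset$ has one edge from source $i$ to sink $i$ for each $i$. For $a<b$ the simple star network $F_{[a,b]}$ has one interior vertex, an edge from source $i$ to it and an edge from it to sink $i$ for each $i\in[a,b]$, and an edge from source $i$ to sink $i$ for each $i\notin[a,b]$; $F_{[a,a]}=F_\emptyset$. The condensed concatenation $E\bullet F$ is obtained by removing sink $i$ of $E$ and source $i$ of $F$ for each $i$, merging each edge $(x,\text{sink }i)$ of $E$ with each edge $(\text{source }i,y)$ of $F$ into an edge $(x,y)$,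 and replacing all $m$ edges so obtained between the same $x$ and $y$ by a single edge of multiplicity $m$. **Zig-zag conditions.** A sequence of intervals $[c_1,d_1],\dots,[c_t,d_t]$ ($t\ge 0$) satisfies the zig-zag conditions if (1) the intervals are distinct and none contains another; (2) for all $i<j<k$ with $[c_i,d_i]\cap[c_j,d_j]\ne\emptyset$ and $[c_j,d_j]\cap[c_k,d_k]\neq\emptyset$ we have $c_i<c_j<c_k$ and $d_i<d_j<d_k$, or $c_i>c_j>c_k$ and $d_i>d_j>d_k$. A type-$\mathsf A$ zig-zag network is a network $F_{[c_1,d_1]}\bullet\cdots\bullet F_{[c_t,d_t]}$ (meaning $F_\emptyset$ if $t=0$) for such a sequence; let $\mathcal Z^{\mathsf A}_{[\bar n,n]}$ be the set of these. A type-$\mathsf{BC}$ zig-zag network is a network $F'_{[c_1,d_1]}\bullet\cdots\bullet F'_{[c_t,d_t]}$ for such a sequence in which each $[c_i,d_i]$ has $1\le c_i$ or $c_i=\overline{d_i}<0$, where $F'_{[a,b]}=F_{[a,b]}\bullet F_{[\bar b,\bar a]}$ for $1\le a\le b\le n$ and $F'_{[\bar a,a]}=F_{[\bar a,a]}$; let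 $\mathcal Z^{\mathsf{BC}}_{[\bar n,n]}$ be the set of these. **The permutation of a zig-zag network.** Let $s_{[a,b]}$ be the permutation which reverses $[a,b]$ and fixes all other letters. Given $F=F_{[c_1,d_1]}\bullet\cdots\bullet F_{[c_t,d_t]}$ with the zig-zag conditions, start with the sequence $(s_{[c_1,d_1]},\dots,s_{[c_t,d_t]})$ and, for all $i<j$ such that $[c_i,d_i]\cap[c_j,d_j]\not\subseteq[c_{i+1},d_{i+1}]\cup\cdots\cup[c_{j-1},d_{j-1}]$ and $|[c_i,d_i]\cap[c_j,d_j]|>1$, insert $s_{[c_i,d_i]\cap[c_j,d_j]}$ immediately after $s_{[c_i,d_i]}$. Let $w(F)$ be the product of the resulting sequence from left to right, where in products reversals act on words by permuting positions, the last factor first (so $w(F)_x$ is obtained from $x$ by applying the reversals of the sequence as functions, successively from left to right). For $w\in\mathfrak S_{[\bar n,n]}$, $F_w$ denotes the type-$\mathsf A$ zig-zag network $F$ with $w(F)=w$, if there is one. **Theorem.** We have $$\mathcal Z^{\mathsf{BC}}_{[\bar n,n]}=\{F_w\in\mathcal Z^{\mathsf A}_{[\bar n,n]} : w\in\mathfrak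 B_n\}.$$ Moreover the maps $F\mapsto w(F)$ and $w\mapsto F_w$ (which are well defined here) are mutually inverse bijections between $\mathcal Z^{\mathsf{BC}}_{[\bar n,n]}$ and the set of those $w\in\mathfrak B_n$ whose word $w_{\bar n}\cdots w_{\bar1}w_1\cdots w_n$ avoids the patterns $3412$ and $4231$. -/

import Mathlib

namespace ZigZag

/-! ### Intervals, reversals, pattern avoidance -/

section Permutations

variable {α : Type} [LinearOrder α] [Fintype α]

/-- The set of elements of the interval `[a, b]`; an interval is given by its endpoints `a ≤ b`. -/
def pts (I : NonemptyInterval α) : Finset α :=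
  Finset.univ.filter fun x => I.fst ≤ x ∧ x ≤ I.snd

/-- The permutation which reverses the order of the elements of `s` and fixes all other letters.
For `s = [a, b]` this is the reversal `s_{[a,b]}`. -/
def reversal (s : Finset α) : Equiv.Perm α :=
  Equiv.Perm.ofSubtype ((s.orderIsoOfFin rfl).toEquiv.permCongr Fin.revPerm)

/-- The permutation `w`, read as the word of its values in increasing order of positions, has no
subword whose letters are in the same relative order as those of the word `u`. -/
def Avoids {k : ℕ} (w : Equiv.Perm α) (u : Fin k → ℕ) : Prop :=
  ¬ ∃ p : Fin k → α, StrictMono p ∧ ∀ i j, u i < u j ↔ w (p i) < w (p j)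

end Permutations

/-! ### Condensed networks -/

/-- A condensed network whose sources and whose sinks are indexed by `α`: a directed graph with
vertices the sources (left copy of `α`), the interior vertices `V`, and the sinks (right copy of
`α`), having at most one marked edge between two vertices. `mult x y` is the multiplicity of the
edge from `x` to `y`, and is `0` if there is no such edge. -/
structure Network (α : Type) where
  V : Type
  mult : α ⊕ V → V ⊕ α → ℕ

/-- Isomorphism of directed graphs with edge multiplicities, preserving the labels of all
sources and sinks. -/
def Network.Iso {α : Type} (E F : Network α) : Prop :=
  ∃ e : E.V ≃ F.V, ∀ x y, F.mult (Sum.map id e x) (Sum.map e id y) = E.mult x y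

instance Network.setoid (α : Type) : Setoid (Network α) where
  r := Network.Iso
  iseqv :=
    { refl := fun E => ⟨Equiv.refl _, fun x y => by simp⟩
      symm := by
        rintro E F ⟨e, he⟩
        refine ⟨e.symm, fun x y => ?_⟩
        rw [← he]
        simp [Sum.map_map]
      trans := by
        rintro E F G ⟨e, he⟩ ⟨f, hf⟩
        refine ⟨e.trans f, fun x y => ?_⟩
        rw [← he, ← hf]
        simp [Sum.map_map] }

/-- Condensed networks up to isomorphism. -/
abbrev NetworkClass (α : Type) : Type 1 := Quotient (Network.setoid α)

section Networks

variable {α : Type} [LinearOrder α] [Fintype α]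

/-- The trivial network `F_∅`: an edge from source `i` to sink `i` for every `i`. -/
def trivialNetwork (α : Type) [DecidableEq α] : Network α where
  V := Empty
  mult
    | .inl i, .inr j => if i = j then 1 else 0
    | .inr v, _ => v.elim
    | _, .inl v => v.elim

/-- The simple star network `F_{[a,b]}`: for `a < b` it has one interior vertex, which receives an
edge from each source in `[a, b]` and sends one to each sink in `[a, b]`; every other source is
joined to the sink with the same label. For `a = b` it is the trivial network. -/
def simpleStar (I : NonemptyInterval α) : Network α :=
  if I.fst < I.snd then
    { V := Unit
      mult := fun
        | .inl i, .inl _ => if i ∈ pts I then 1 else 0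
        | .inl i, .inr j => if i = j ∧ i ∉ pts I then 1 else 0
        | .inr _, .inl _ => 0
        | .inr _, .inr j => if j ∈ pts I then 1 else 0 }
  else trivialNetwork α

/-- The condensed concatenation `E • F`: for every `i`, sink `i` of `E` and source `i` of `F` are
removed and each edge `(x, sink i)` of `E` is merged with each edge `(source i, y)` of `F` into
an edge `(x, y)`; all the edges so obtained between the same `x` and `y` are replaced by one edge,
marked with their number. -/
def Network.bullet (E F : Network α) : Network α where
  V := E.V ⊕ F.V
  mult
    -- from a source, or an interior vertex of `E`
    | .inl i, .inl (.inl v) => E.mult (.inl i) (.inl v)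
    | .inl i, .inl (.inr v) => ∑ k, E.mult (.inl i) (.inr k) * F.mult (.inl k) (.inl v)
    | .inl i, .inr j => ∑ k, E.mult (.inl i) (.inr k) * F.mult (.inl k) (.inr j)
    | .inr (.inl u), .inl (.inl v) => E.mult (.inr u) (.inl v)
    | .inr (.inl u), .inl (.inr v) => ∑ k, E.mult (.inr u) (.inr k) * F.mult (.inl k) (.inl v)
    | .inr (.inl u), .inr j => ∑ k, E.mult (.inr u) (.inr k) * F.mult (.inl k) (.inr j)
    -- from an interior vertex of `F`
    | .inr (.inr _), .inl (.inl _) => 0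
    | .inr (.inr u), .inl (.inr v) => F.mult (.inr u) (.inl v)
    | .inr (.inr u), .inr j => F.mult (.inr u) (.inr j)

/-- The condensed star network `F_{[c₁,d₁]} • ⋯ • F_{[c_t,d_t]}`. -/
def starNetwork : List (NonemptyInterval α) → Network α
  | [] => trivialNetwork α
  | I :: L => (simpleStar I).bullet (starNetwork L)

/-! ### Zig-zag networks of type A and their permutations -/

/-- The zig-zag conditions on a sequence of intervals `[c₁,d₁], …, [c_t,d_t]`. -/
def IsZigzag (L : List (NonemptyInterval α)) : Prop :=
  (∀ i j : Fin L.length, i ≠ j →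
    L[i] ≠ L[j] ∧ ¬ pts L[i] ⊆ pts L[j] ∧ ¬ pts L[j] ⊆ pts L[i]) ∧
  (∀ i j k : Fin L.length, i < j → j < k →
    (pts L[i] ∩ pts L[j]).Nonempty → (pts L[j] ∩ pts L[k]).Nonempty →
    (L[i].fst < L[j].fst ∧ L[j].fst < L[k].fst ∧ L[i].snd < L[j].snd ∧ L[j].snd < L[k].snd) ∨
    (L[i].fst > L[j].fst ∧ L[j].fst > L[k].fst ∧ L[i].snd > L[j].snd ∧ L[j].snd > L[k].snd))

/-- The set of type-A zig-zag networks with boundary vertices indexed by `α`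
(the trivial network is given by the empty sequence of intervals). -/
def znetA (α : Type) [LinearOrder α] [Fintype α] : Set (NetworkClass α) :=
  {F | ∃ L : List (NonemptyInterval α), IsZigzag L ∧ F = ⟦starNetwork L⟧}

/-- The relation `[cᵢ,dᵢ] ⋖ [cⱼ,dⱼ]`: `i < j`, and `[cᵢ,dᵢ] ∩ [cⱼ,dⱼ]` is not covered by the
intervals with index strictly between `i` and `j`. -/
abbrev Precdot (L : List (NonemptyInterval α)) (i j : Fin L.length) : Prop :=
  i < j ∧ ((pts L[i] ∩ pts L[j]) \ (Finset.Ioo i j).biUnion fun k => pts L[k]).Nonempty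

/-- The zig-zag factorization: the sequence `[c₁,d₁], …, [c_t,d_t]`, in which `[cᵢ,dᵢ]` is followed
by the intersections `[cᵢ,dᵢ] ∩ [cⱼ,dⱼ]` with more than one element, for all `j` with
`[cᵢ,dᵢ] ⋖ [cⱼ,dⱼ]`. -/
def zigzagFactorization (L : List (NonemptyInterval α)) : List (Finset α) :=
  (List.finRange L.length).flatMap fun i =>
    pts L[i] ::
      ((List.finRange L.length).filter fun j =>
        Precdot L i j ∧ 1 < (pts L[i] ∩ pts L[j]).card).map fun j => pts L[i] ∩ pts L[j]

/-- The product of the reversals in the zig-zag factorization, from left to right. In a product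
`s_{i₁} ⋯ s_{i_r}` of generators, generators act on words by swapping positions, the last factor
first, so that the word of the product sends position `x` to the letter `s_{i_r}(⋯(s_{i₁}(x)))`;
as a product of functions it is therefore taken in reverse order. -/
def zigzagPerm (L : List (NonemptyInterval α)) : Equiv.Perm α :=
  ((zigzagFactorization L).map reversal).reverse.prod

/-- `F` is a type-A zig-zag network with `w(F) = w`, that is, `F` is the network `F_w`. -/
def IsZigzagNetworkOf (F : NetworkClass α) (w : Equiv.Perm α) : Prop :=
  ∃ L : List (NonemptyInterval α), IsZigzag L ∧ F = ⟦starNetwork L⟧ ∧ w = zigzagPerm L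

end Networks

/-! ### Type BC -/

/-- The set `{-n, …, -1, 1, …, n}`. -/
abbrev Letter (n : ℕ) : Type := {i : ℤ // i ∈ (Finset.Icc (-n : ℤ) n).erase 0}

/-- The letter `-a`. -/
def bar {n : ℕ} (a : Letter n) : Letter n :=
  ⟨-a.1, by
    have h := a.2
    simp only [Finset.mem_erase, Finset.mem_Icc] at h ⊢
    omega⟩

/-- The interval `[-b, -a]`. -/
def barInterval {n : ℕ} (I : NonemptyInterval (Letter n)) : NonemptyInterval (Letter n) where
  fst := bar I.snd
  snd := bar I.fst
  fst_le_snd := Subtype.mk_le_mk.mpr (neg_le_neg (Subtype.coe_le_coe.mpr I.fst_le_snd))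

/-- The hyperoctahedral group, as the set of permutations `w` with `w(-i) = -w(i)`. -/
def hyperoctahedral (n : ℕ) : Set (Equiv.Perm (Letter n)) :=
  {w | ∀ i, w (bar i) = bar (w i)}

/-- The intervals which index type-BC simple star networks: `[a, b]` with `1 ≤ a ≤ b ≤ n`, and
`[-a, a]` with `1 ≤ a ≤ n`. -/
def IsIntervalBC {n : ℕ} (I : NonemptyInterval (Letter n)) : Prop :=
  0 < I.fst.1 ∨ I.fst = bar I.snd

/-- The type-BC simple star network: `F'_{[a,b]} = F_{[a,b]} • F_{[-b,-a]}` for `1 ≤ a ≤ b ≤ n`,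
and `F'_{[-a,a]} = F_{[-a,a]}`. -/
noncomputable def simpleStarBC {n : ℕ} (I : NonemptyInterval (Letter n)) : Network (Letter n) :=
  if 0 < I.fst.1 then (simpleStar I).bullet (simpleStar (barInterval I)) else simpleStar I

/-- The type-BC condensed star network `F'_{[c₁,d₁]} • ⋯ • F'_{[c_t,d_t]}`. -/
noncomputable def starNetworkBC {n : ℕ} : List (NonemptyInterval (Letter n)) → Network (Letter n)
  | [] => trivialNetwork (Letter n)
  | I :: L => (simpleStarBC I).bullet (starNetworkBC L)

/-- The set of type-BC zig-zag networks with boundary vertices indexed by `{-n, …, n} \ {0}`. -/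
def znetBC (n : ℕ) : Set (NetworkClass (Letter n)) :=
  {F | ∃ L : List (NonemptyInterval (Letter n)),
    (∀ I ∈ L, IsIntervalBC I) ∧ IsZigzag L ∧ F = ⟦starNetworkBC L⟧}

/-- The elements of the hyperoctahedral group which avoid the patterns 3412 and 4231. -/
def avoidingBC (n : ℕ) : Set (Equiv.Perm (Letter n)) :=
  {w | w ∈ hyperoctahedral n ∧ Avoids w ![3, 4, 1, 2] ∧ Avoids w ![4, 2, 3, 1]}

end ZigZag

/-!
# Zig-zag networks of type BC and pattern-avoiding elements of the hyperoctahedral group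

The proof compares three kinds of objects with sequences of intervals, taken up to interchanging
adjacent disjoint intervals (`TraceEquiv`) and up to one-element intervals (`nontrivialPart`):
one-element intervals contribute trivial networks and trivial reversals, and disjoint intervals
commute both as networks and as words.

*Networks.* The network of a zig-zag sequence is best viewed as a collection of wires, the wire `x`
passing through the vertices of all intervals that contain `x` (`wireNetwork`). The second zig-zag
condition implies that the wire of an endpoint of an interval either starts or ends at the vertex
of this interval, so the sources and sinks adjacent to a vertex determine its interval; and the
edges determine the order of any two intersecting intervals. Hence a network determines its
sequence up to trace equivalence (`traceEquiv_of_starNetwork_equiv`).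

*Words.* By the zig-zag conditions the rightmost interval `J = [q, N]` of a sequence can be moved to
the end or to the beginning, and reversing the sequence inverts the word (`zigzagPerm_reverse`), so
let it come last. Then the word arises from that of the remaining sequence by one explicit
permutation of letters (`zigzagPerm_concat`), which puts the letters of `J` into decreasing order.
The letter `N` is the largest one that the word `w` moves, `q = max (w N) (w⁻¹ N)`, the position of
`J` is last if `w N = q` and first if `w⁻¹ N = q`, and the part of `J` that the remaining sequence
covers can also be read off (`IsProper.wordFacts`, `mem_lowerPart_iff`). So the word determines the
sequence (`traceEquiv_of_zigzagPerm_eq`), by induction.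

*Patterns.* Adding `J` neither creates nor destroys occurrences of 3412 and 4231
(`IsPeeling.avoids_extend_iff`): as the letters of `J` decrease, such an occurrence cannot end at a
position that the new interval alone affects. Therefore words of zig-zag sequences avoid both
patterns. Conversely, if `w` avoids both patterns and, after inverting it if necessary,
`w⁻¹ N ≤ w N`, then the letters from `w N` to `N` decrease (`inv_lt_inv_of_avoids`), the interval
`[w N, N]` can be peeled off (`exists_isPeeling`), and the sequence found for the rest remains
zig-zag when this interval is appended to it (`IsProper.concat_of_isPeeling`).

*Type BC.* Replacing each `[a, b]` with `1 ≤ a` by `[a, b], [-b, -a]` turns a zig-zag sequence of type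
BC into a zig-zag sequence with the same network that is trace equivalent to its negative. Negating
all intervals conjugates the word with `a ↦ -a`, so its word lies in the hyperoctahedral group.
Conversely, a sequence whose word lies in this group is trace equivalent to its negative because
the word determines the sequence, and this forces every interval to be either symmetric or disjoint
from its negative; keeping the symmetric and the positive ones gives a sequence of type BC with the
same network (`IsProper.exists_symmetrize`).
-/

set_option linter.unusedSectionVars false

namespace ZigZag

/-! ### Reversals -/

section Reversal

variable {α : Type} [LinearOrder α] [Fintype α]

theorem mem_pts {I : NonemptyInterval α} {x : α} : x ∈ pts I ↔ I.fst ≤ x ∧ x ≤ I.snd := by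
  simp [pts]

theorem reversal_apply_of_notMem {s : Finset α} {x : α} (h : x ∉ s) : reversal s x = x :=
  Equiv.Perm.ofSubtype_apply_of_not_mem _ h

theorem reversal_apply_coe {s : Finset α} (x : s) :
    reversal s x = (s.orderIsoOfFin rfl (Fin.rev ((s.orderIsoOfFin rfl).symm x)) : α) := by
  rw [reversal, Equiv.Perm.ofSubtype_apply_coe]
  simp

theorem reversal_mem {s : Finset α} {x : α} (h : x ∈ s) : reversal s x ∈ s := by
  rw [reversal_apply_coe ⟨x, h⟩]
  exact Subtype.coe_prop _

theorem reversal_lt {s : Finset α} {x y : α} (hx : x ∈ s) (hy : y ∈ s) (h : x < y) :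
    reversal s y < reversal s x := by
  rw [reversal_apply_coe ⟨x, hx⟩, reversal_apply_coe ⟨y, hy⟩]
  simpa using h

@[simp]
theorem reversal_reversal (s : Finset α) (x : α) : reversal s (reversal s x) = x := by
  by_cases h : x ∈ s
  · rw [reversal_apply_coe ⟨x, h⟩, reversal_apply_coe]
    simp
  · rw [reversal_apply_of_notMem h, reversal_apply_of_notMem h]

theorem reversal_inv (s : Finset α) : (reversal s)⁻¹ = reversal s := by
  rw [inv_eq_iff_mul_eq_one]
  ext x
  simp

/-- A permutation which preserves the finite set `s`, reverses its order and fixes every other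
letter is the reversal of `s`: composed with the reversal it is an automorphism of a finite
linear order. -/
theorem eq_reversal {s : Finset α} {f : Equiv.Perm α} (hfix : ∀ x, x ∉ s → f x = x)
    (hmem : ∀ x ∈ s, f x ∈ s) (hlt : ∀ x ∈ s, ∀ y ∈ s, x < y → f y < f x) : f = reversal s := by
  ext x
  by_cases hx : x ∈ s
  · let g : s → s := fun x => ⟨reversal s (f x), reversal_mem (hmem x x.2)⟩
    have hg : StrictMono g := fun a b hab =>
      reversal_lt (hmem b b.2) (hmem a a.2) (hlt a a.2 b b.2 hab)
    have hs : Function.Surjective g := Finite.surjective_of_injective hg.injective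
    have := Subsingleton.elim (hg.orderIsoOfSurjective g hs) (OrderIso.refl s)
    have h2 : g ⟨x, hx⟩ = ⟨x, hx⟩ := by
      simpa using DFunLike.congr_fun this ⟨x, hx⟩
    have h3 : reversal s (f x) = x := congrArg Subtype.val h2
    calc f x = reversal s (reversal s (f x)) := (reversal_reversal s _).symm
      _ = reversal s x := by rw [h3]
  · rw [hfix x hx, reversal_apply_of_notMem hx]

theorem reversal_eq_one {s : Finset α} (h : s.card ≤ 1) : reversal s = 1 := by
  symm
  refine eq_reversal (by simp) (by simp) fun x hx y hy hxy => ?_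
  exact absurd (Finset.card_le_one.1 h x hx y hy) hxy.ne

theorem reversal_commute {s t : Finset α} (h : Disjoint s t) :
    Commute (reversal s) (reversal t) := by
  ext x
  simp only [Equiv.Perm.mul_apply]
  by_cases hs : x ∈ s
  · have h1 : x ∉ t := Finset.disjoint_left.1 h hs
    have h2 : reversal s x ∉ t := Finset.disjoint_left.1 h (reversal_mem hs)
    rw [reversal_apply_of_notMem h1, reversal_apply_of_notMem h2]
  · by_cases ht : x ∈ t
    · have h2 : reversal t x ∉ s := Finset.disjoint_right.1 h (reversal_mem ht)
      rw [reversal_apply_of_notMem hs, reversal_apply_of_notMem h2]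
    · simp [reversal_apply_of_notMem hs, reversal_apply_of_notMem ht]

end Reversal

/-! ### The zig-zag factorization -/

section Factorization

variable {α : Type} [LinearOrder α] [Fintype α]

/-- The intersections with `s` which follow `s` in the zig-zag factorization: `L` runs through the
intervals after `s`, and `u` is the part of `s` that no earlier member of `L` covers. -/
def insertions (s : Finset α) : Finset α → List (NonemptyInterval α) → List (Finset α)
  | _, [] => []
  | u, J :: L =>
    (if (u ∩ pts J).Nonempty ∧ 1 < (s ∩ pts J).card then [s ∩ pts J] else []) ++
      insertions s (u \ pts J) L

theorem map_filter_finRange_eq_insertions (s u : Finset α) (L : List (NonemptyInterval α)) :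
    ((List.finRange L.length).filter fun j =>
      ((u ∩ pts L[j]) \ (Finset.Iio j).biUnion fun k => pts L[k]).Nonempty ∧
        1 < (s ∩ pts L[j]).card).map (fun j => s ∩ pts L[j]) = insertions s u L := by
  induction L generalizing u with
  | nil => rfl
  | cons J L ih =>
    rw [insertions, ← ih]
    simp only [List.length_cons, List.finRange_succ, List.filter_cons, List.filter_map]
    have h0 : (Finset.Iio (0 : Fin (L.length + 1))) = ∅ := by
      ext k; simp
    have h1 : ∀ j : Fin L.length,
        ((u ∩ pts (J :: L)[j.succ]) \ (Finset.Iio j.succ).biUnion fun k => pts (J :: L)[k]) =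
        (((u \ pts J) ∩ pts L[j]) \ (Finset.Iio j).biUnion fun k => pts L[k]) := by
      intro j
      ext x
      simp only [Finset.mem_sdiff, Finset.mem_inter, Finset.mem_biUnion, Finset.mem_Iio,
        Fin.exists_fin_succ]
      simp
      tauto
    have h2 : (fun j : Fin L.length => decide
        (((u ∩ pts (J :: L)[j.succ]) \
          (Finset.Iio j.succ).biUnion fun k => pts (J :: L)[k]).Nonempty ∧
          1 < (s ∩ pts (J :: L)[j.succ]).card)) =
        fun j : Fin L.length => decide
          ((((u \ pts J) ∩ pts L[j]) \ (Finset.Iio j).biUnion fun k => pts L[k]).Nonempty ∧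
          1 < (s ∩ pts L[j]).card) := by
      funext j
      rw [h1]
      rfl
    have h3 : ((fun j : Fin (L.length + 1) => decide
        (((u ∩ pts (J :: L)[j]) \
          (Finset.Iio j).biUnion fun k => pts (J :: L)[k]).Nonempty ∧
          1 < (s ∩ pts (J :: L)[j]).card)) ∘ Fin.succ) =
        fun j : Fin L.length => decide
          ((((u \ pts J) ∩ pts L[j]) \ (Finset.Iio j).biUnion fun k => pts L[k]).Nonempty ∧
          1 < (s ∩ pts L[j]).card) := h2
    rw [h3]
    by_cases hc : (u ∩ pts J).Nonempty ∧ 1 < (s ∩ pts J).card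
    · rw [if_pos hc, if_pos, List.map_cons, List.map_map]
      · rfl
      · simpa [h0] using hc
    · rw [if_neg hc, if_neg, List.map_map]
      · rfl
      · simpa [h0] using hc

theorem zigzagFactorization_nil :
    zigzagFactorization ([] : List (NonemptyInterval α)) = [] := rfl

theorem zigzagFactorization_cons (I : NonemptyInterval α) (L : List (NonemptyInterval α)) :
    zigzagFactorization (I :: L) =
      pts I :: (insertions (pts I) (pts I) L ++ zigzagFactorization L) := by
  rw [zigzagFactorization, zigzagFactorization]
  simp only [List.length_cons, List.finRange_succ, List.flatMap_cons, List.flatMap_map,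
    List.filter_cons, List.filter_map]
  have h0 : ∀ i : Fin (L.length + 1), ¬ (Precdot (I :: L) i 0 ∧
      1 < (pts (I :: L)[i] ∩ pts (I :: L)[(0 : Fin (L.length + 1))]).card) := fun i h =>
    absurd h.1.1 (by simp)
  have h1 : ∀ j : Fin L.length, Precdot (I :: L) 0 j.succ ↔
      ((pts I ∩ pts L[j]) \ (Finset.Iio j).biUnion fun k => pts L[k]).Nonempty := by
    intro j
    simp only [Precdot, Finset.Nonempty, Finset.mem_sdiff, Finset.mem_inter, Finset.mem_biUnion,
      Finset.mem_Iio, Finset.mem_Ioo]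
    simp [Fin.forall_fin_succ]
  have h2 : ∀ i j : Fin L.length, Precdot (I :: L) i.succ j.succ ↔ Precdot L i j := by
    intro i j
    simp only [Precdot, Finset.Nonempty, Finset.mem_sdiff, Finset.mem_inter, Finset.mem_biUnion,
      Finset.mem_Ioo]
    simp [Fin.forall_fin_succ]
  rw [if_neg (fun h => h0 0 (of_decide_eq_true h))]
  have h3 : ((fun j : Fin (L.length + 1) => decide (Precdot (I :: L) 0 j ∧
      1 < (pts (I :: L)[(0 : Fin (L.length + 1))] ∩ pts (I :: L)[j]).card)) ∘ Fin.succ) =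
      fun j : Fin L.length => decide
        (((pts I ∩ pts L[j]) \ (Finset.Iio j).biUnion fun k => pts L[k]).Nonempty ∧
          1 < (pts I ∩ pts L[j]).card) := by
    funext j
    simp only [Function.comp, decide_eq_decide, h1]
    rfl
  have h4 : ∀ i : Fin L.length, ((fun j : Fin (L.length + 1) => decide
      (Precdot (I :: L) i.succ j ∧
      1 < (pts (I :: L)[i.succ] ∩ pts (I :: L)[j]).card)) ∘ Fin.succ) =
      fun j : Fin L.length => decide (Precdot L i j ∧ 1 < (pts L[i] ∩ pts L[j]).card) := by
    intro i
    funext j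
    simp only [Function.comp, decide_eq_decide, h2]
    rfl
  rw [← map_filter_finRange_eq_insertions]
  simp only [List.cons_append]
  rw [h3, List.map_map]
  refine congrArg₂ _ rfl (congrArg₂ _ rfl ?_)
  refine congrArg (fun f => List.flatMap f (List.finRange L.length)) (funext fun i => ?_)
  rw [h4, if_neg (fun h => h0 i.succ (of_decide_eq_true h)), List.map_map]
  rfl

/-- The product of the reversals of a list of sets, the first acting first. -/
def revProd (l : List (Finset α)) : Equiv.Perm α := (l.map reversal).reverse.prod

@[simp] theorem revProd_nil : revProd ([] : List (Finset α)) = 1 := rfl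

@[simp] theorem revProd_cons (s : Finset α) (l : List (Finset α)) :
    revProd (s :: l) = revProd l * reversal s := by
  simp [revProd]

@[simp] theorem revProd_append (l l' : List (Finset α)) :
    revProd (l ++ l') = revProd l' * revProd l := by
  simp [revProd]

theorem revProd_commute {l l' : List (Finset α)} (h : ∀ s ∈ l, ∀ t ∈ l', Disjoint s t) :
    Commute (revProd l) (revProd l') := by
  have key : ∀ (s : Finset α) (l' : List (Finset α)), (∀ t ∈ l', Disjoint s t) →
      Commute (reversal s) (revProd l') := by
    intro s l' h
    induction l' with
    | nil => simp
    | cons t l' ih =>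
      rw [revProd_cons]
      exact (ih fun t ht => h t (by simp [ht])).mul_right (reversal_commute (h t (by simp)))
  induction l with
  | nil => simp
  | cons s l ih =>
    rw [revProd_cons]
    exact (ih fun t ht => h t (by simp [ht])).mul_left (key s l' (h s (by simp)))

@[simp] theorem zigzagPerm_nil : zigzagPerm ([] : List (NonemptyInterval α)) = 1 := rfl

theorem zigzagPerm_cons (I : NonemptyInterval α) (L : List (NonemptyInterval α)) :
    zigzagPerm (I :: L) =
      zigzagPerm L * revProd (insertions (pts I) (pts I) L) * reversal (pts I) := by
  change revProd _ = revProd _ * _ * _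
  rw [zigzagFactorization_cons, revProd_cons, revProd_append]

theorem insertions_subset {s u : Finset α} {L : List (NonemptyInterval α)} {t : Finset α}
    (h : t ∈ insertions s u L) : t ⊆ s := by
  induction L generalizing u with
  | nil => simp [insertions] at h
  | cons J L ih =>
    rw [insertions, List.mem_append] at h
    rcases h with h | h
    · split_ifs at h
      · rw [List.mem_singleton] at h
        exact h ▸ Finset.inter_subset_left
      · simp at h
    · exact ih h

theorem zigzagFactorization_subset {L : List (NonemptyInterval α)} {t : Finset α}
    (h : t ∈ zigzagFactorization L) : ∃ I ∈ L, t ⊆ pts I := by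
  induction L with
  | nil => simp [zigzagFactorization_nil] at h
  | cons J L ih =>
    rw [zigzagFactorization_cons, List.mem_cons, List.mem_append] at h
    rcases h with h | h | h
    · exact ⟨J, by simp, h.le⟩
    · exact ⟨J, by simp, insertions_subset h⟩
    · obtain ⟨I, hI, h⟩ := ih h
      exact ⟨I, by simp [hI], h⟩

theorem insertions_cons_of_disjoint {s u : Finset α} {J : NonemptyInterval α}
    {L : List (NonemptyInterval α)} (h : Disjoint u (pts J)) :
    insertions s u (J :: L) = insertions s u L := by
  rw [insertions, if_neg, Finset.sdiff_eq_self_of_disjoint h, List.nil_append]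
  rw [Finset.disjoint_iff_inter_eq_empty.1 h]
  simp

theorem insertions_append_left {s u : Finset α} {L L' : List (NonemptyInterval α)}
    (h : ∀ I ∈ L, Disjoint u (pts I)) : insertions s u (L ++ L') = insertions s u L' := by
  induction L with
  | nil => rfl
  | cons J L ih =>
    rw [List.cons_append, insertions_cons_of_disjoint (h J (by simp)),
      ih fun I hI => h I (by simp [hI])]

theorem insertions_eq_nil {s u : Finset α} {L : List (NonemptyInterval α)}
    (h : ∀ I ∈ L, Disjoint u (pts I)) : insertions s u L = [] := by
  simpa [insertions] using insertions_append_left (s := s) (L' := []) h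

theorem insertions_concat_of_covered {s u : Finset α} {J : NonemptyInterval α}
    {L : List (NonemptyInterval α)} (h : ∀ x ∈ u, x ∈ pts J → ∃ K ∈ L, x ∈ pts K) :
    insertions s u (L ++ [J]) = insertions s u L := by
  induction L generalizing u with
  | nil =>
    exact insertions_cons_of_disjoint (Finset.disjoint_left.2 fun x hx hJ => by simpa using h x hx hJ)
  | cons K L ih =>
    rw [List.cons_append, insertions, insertions, ih]
    intro x hx hJ
    rw [Finset.mem_sdiff] at hx
    obtain ⟨K', hK, hxK⟩ := h x hx.1 hJ
    rcases List.mem_cons.1 hK with rfl | hK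
    · exact absurd hxK hx.2
    · exact ⟨K', hK, hxK⟩

theorem insertions_concat_of_disjoint {s u : Finset α} {J : NonemptyInterval α}
    {L : List (NonemptyInterval α)} (h : ∀ K ∈ L, Disjoint (pts K) (pts J)) :
    insertions s u (L ++ [J]) = insertions s u L ++ insertions s u [J] := by
  induction L generalizing u with
  | nil => rfl
  | cons K L ih =>
    rw [List.cons_append, insertions, ih fun I hI => h I (by simp [hI])]
    have : (u \ pts K) ∩ pts J = u ∩ pts J := by
      ext x
      have : x ∈ pts J → x ∉ pts K := fun hx => Finset.disjoint_right.1 (h K (by simp)) hx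
      simp only [Finset.mem_inter, Finset.mem_sdiff]
      tauto
    simp [insertions, this]

theorem revProd_insertions_singleton (s : Finset α) (J : NonemptyInterval α) :
    revProd (insertions s s [J]) = reversal (s ∩ pts J) := by
  rw [insertions, insertions]
  split_ifs with h
  · simp
  · rw [reversal_eq_one]
    · simp
    · by_contra hc
      exact h ⟨Finset.card_pos.1 (by omega), by omega⟩

/-- The insertions depend on the list of the following intervals only up to exchanging disjoint
neighbours. -/
theorem revProd_insertions_swap {s u : Finset α} {I J : NonemptyInterval α}
    {L : List (NonemptyInterval α)} (h : Disjoint (pts I) (pts J)) :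
    revProd (insertions s u (I :: J :: L)) = revProd (insertions s u (J :: I :: L)) := by
  have h1 : (u \ pts I) ∩ pts J = u ∩ pts J := by
    ext x
    have : x ∈ pts J → x ∉ pts I := fun hx => Finset.disjoint_right.1 h hx
    simp only [Finset.mem_inter, Finset.mem_sdiff]
    tauto
  have h2 : (u \ pts J) ∩ pts I = u ∩ pts I := by
    ext x
    have : x ∈ pts I → x ∉ pts J := fun hx => Finset.disjoint_left.1 h hx
    simp only [Finset.mem_inter, Finset.mem_sdiff]
    tauto
  rw [insertions, insertions, insertions, insertions, h1, h2, sdiff_sdiff_comm]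
  simp only [revProd_append, mul_assoc]
  congr 1
  refine revProd_commute ?_
  intro a ha b hb
  split_ifs at ha hb <;> simp only [List.mem_singleton, List.not_mem_nil] at ha hb
  subst ha hb
  exact (h.mono Finset.inter_subset_right Finset.inter_subset_right).symm

end Factorization

/-! ### Order of two terms in a list -/

section Sublists

variable {β : Type*} {I J K : β} {L L' A B : List β}

theorem pair_sublist_iff : [I, J].Sublist L ↔ ∃ i j : Fin L.length, i < j ∧ L[i] = I ∧ L[j] = J := by
  constructor
  · have : L.Pairwise fun a b => ∃ i j : Fin L.length, i < j ∧ L[i] = a ∧ L[j] = b := by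
      rw [List.pairwise_iff_getElem]
      intro i j hi hj hij
      exact ⟨⟨i, hi⟩, ⟨j, hj⟩, hij, rfl, rfl⟩
    exact fun h => List.pairwise_iff_forall_sublist.1 this h
  · have : L.Pairwise fun a b => [a, b].Sublist L :=
      List.pairwise_iff_forall_sublist.2 fun h => h
    rintro ⟨i, j, hij, rfl, rfl⟩
    exact List.pairwise_iff_getElem.1 this i j i.2 j.2 hij

theorem pair_sublist_cons : [I, J].Sublist (K :: L) ↔ I = K ∧ J ∈ L ∨ [I, J].Sublist L := by
  rw [List.sublist_cons_iff]
  constructor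
  · rintro (h | ⟨r, h, hr⟩)
    · exact Or.inr h
    · simp only [List.cons.injEq] at h
      obtain ⟨rfl, rfl⟩ := h
      exact Or.inl ⟨rfl, by simpa using hr⟩
  · rintro (⟨rfl, h⟩ | h)
    · exact Or.inr ⟨[J], rfl, by simpa using h⟩
    · exact Or.inl h

theorem pair_sublist_append :
    [I, J].Sublist (A ++ B) ↔ [I, J].Sublist A ∨ (I ∈ A ∧ J ∈ B) ∨ [I, J].Sublist B := by
  induction A with
  | nil => simp
  | cons K A ih =>
    rw [List.cons_append, pair_sublist_cons, ih, pair_sublist_cons, List.mem_append, List.mem_cons]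
    tauto

theorem pair_sublist_concat : [I, J].Sublist (A ++ [K]) ↔ [I, J].Sublist A ∨ (I ∈ A ∧ J = K) := by
  rw [pair_sublist_append, pair_sublist_cons]
  simp

theorem mem_of_pair_sublist (h : [I, J].Sublist L) : I ∈ L ∧ J ∈ L :=
  ⟨h.subset (by simp), h.subset (by simp)⟩

theorem pair_sublist_asymm (hL : L.Nodup) (h : [I, J].Sublist L) : ¬ [J, I].Sublist L := by
  rw [pair_sublist_iff] at h ⊢
  obtain ⟨i, j, hij, rfl, rfl⟩ := h
  rintro ⟨j', i', hij', hj, hi⟩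
  have h1 := (List.Nodup.getElem_inj_iff hL).1 hj
  have h2 := (List.Nodup.getElem_inj_iff hL).1 hi
  have h3 : i.1 < j.1 := hij
  have h4 : j'.1 < i'.1 := hij'
  omega

theorem pair_sublist_or (hI : I ∈ L) (hJ : J ∈ L) (h : I ≠ J) :
    [I, J].Sublist L ∨ [J, I].Sublist L := by
  simp only [pair_sublist_iff]
  obtain ⟨i, hi, rfl⟩ := List.getElem_of_mem hI
  obtain ⟨j, hj, rfl⟩ := List.getElem_of_mem hJ
  rcases lt_trichotomy i j with hij | rfl | hij
  · exact Or.inl ⟨⟨i, hi⟩, ⟨j, hj⟩, hij, rfl, rfl⟩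
  · exact absurd rfl h
  · exact Or.inr ⟨⟨j, hj⟩, ⟨i, hi⟩, hij, rfl, rfl⟩

theorem pair_sublist_reverse : [I, J].Sublist L.reverse ↔ [J, I].Sublist L := by
  rw [← List.reverse_sublist]
  simp

end Sublists

/-! ### Trace equivalence of sequences of intervals -/

section TraceEquivalence

variable {α : Type} [LinearOrder α] [Fintype α]
variable {I J K : NonemptyInterval α} {L L' A B : List (NonemptyInterval α)}

/-- Trace equivalence of sequences of intervals: the equivalence relation generated by
interchanging two adjacent disjoint intervals. -/
inductive TraceEquiv : List (NonemptyInterval α) → List (NonemptyInterval α) → Prop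
  | nil : TraceEquiv [] []
  | cons (I : NonemptyInterval α) {L L' : List (NonemptyInterval α)} :
      TraceEquiv L L' → TraceEquiv (I :: L) (I :: L')
  | swap {I J : NonemptyInterval α} (L : List (NonemptyInterval α)) :
      Disjoint (pts I) (pts J) → TraceEquiv (I :: J :: L) (J :: I :: L)
  | trans {L L' L'' : List (NonemptyInterval α)} :
      TraceEquiv L L' → TraceEquiv L' L'' → TraceEquiv L L''

namespace TraceEquiv

theorem refl : ∀ L : List (NonemptyInterval α), TraceEquiv L L
  | [] => nil
  | I :: L => cons I (refl L)

theorem symm (h : TraceEquiv L L') : TraceEquiv L' L := by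
  induction h with
  | nil => exact nil
  | cons I _ ih => exact cons I ih
  | swap L h => exact swap L h.symm
  | trans _ _ ih ih' => exact ih'.trans ih

theorem perm (h : TraceEquiv L L') : L.Perm L' := by
  induction h with
  | nil => exact List.Perm.nil
  | cons I _ ih => exact ih.cons I
  | swap L h => exact List.Perm.swap _ _ _
  | trans _ _ ih ih' => exact ih.trans ih'

theorem append_right (h : TraceEquiv L L') (B : List (NonemptyInterval α)) :
    TraceEquiv (L ++ B) (L' ++ B) := by
  induction h with
  | nil => exact refl B
  | cons I _ ih => exact ih.cons I
  | swap L h => exact swap _ h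
  | trans _ _ ih ih' => exact ih.trans ih'

theorem append_left (A : List (NonemptyInterval α)) (h : TraceEquiv L L') :
    TraceEquiv (A ++ L) (A ++ L') := by
  induction A with
  | nil => exact h
  | cons I A ih => exact ih.cons I

theorem reverse (h : TraceEquiv L L') : TraceEquiv L.reverse L'.reverse := by
  induction h with
  | nil => exact nil
  | cons I _ ih => simpa using ih.append_right [I]
  | swap L h =>
    simpa using append_left L.reverse (swap [] h.symm)
  | trans _ _ ih ih' => exact ih.trans ih'

theorem move_front (h : ∀ K ∈ A, Disjoint (pts K) (pts J)) :
    TraceEquiv (A ++ J :: B) (J :: (A ++ B)) := by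
  induction A with
  | nil => exact refl _
  | cons K A ih =>
    exact ((ih fun K hK => h K (by simp [hK])).cons K).trans (swap _ (h K (by simp)))

theorem move_back (h : ∀ K ∈ B, Disjoint (pts K) (pts J)) :
    TraceEquiv (A ++ J :: B) (A ++ B ++ [J]) := by
  rw [List.append_assoc]
  refine append_left A ?_
  simpa using (move_front (B := []) h).symm

/-- Trace equivalence preserves the relative order of intersecting intervals. -/
theorem pair_sublist (h : TraceEquiv L L') (hIJ : ¬ Disjoint (pts I) (pts J))
    (hs : [I, J].Sublist L) : [I, J].Sublist L' := by
  induction h with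
  | nil => exact hs
  | cons K h ih =>
    rw [pair_sublist_cons] at hs ⊢
    exact hs.imp (fun h' => ⟨h'.1, h.perm.subset h'.2⟩) ih
  | swap L h =>
    simp only [pair_sublist_cons, List.mem_cons] at hs ⊢
    rcases hs with ⟨rfl, rfl | h1⟩ | h1 | h1
    · exact absurd h hIJ
    · exact Or.inr (Or.inl ⟨rfl, h1⟩)
    · exact Or.inl ⟨h1.1, Or.inr h1.2⟩
    · exact Or.inr (Or.inr h1)
  | trans _ _ ih ih' => exact ih' (ih hs)

/-- Sequences of distinct intervals with the same terms are trace equivalent if intersecting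
intervals come in the same order in both. -/
theorem of_pair_sublist (hL : L.Nodup) (hp : L.Perm L')
    (h : ∀ I J, ¬ Disjoint (pts I) (pts J) → [I, J].Sublist L → [I, J].Sublist L') :
    TraceEquiv L L' := by
  induction L generalizing L' with
  | nil => rw [List.nil_perm.1 hp]; exact nil
  | cons I L ih =>
    have hL' : L'.Nodup := hp.nodup_iff.1 hL
    obtain ⟨A, B, rfl⟩ := List.append_of_mem (hp.subset (List.mem_cons_self))
    have hd : ∀ K ∈ A, Disjoint (pts K) (pts I) := by
      intro K hK
      by_contra hKI
      have h1 : [K, I].Sublist (A ++ I :: B) := pair_sublist_append.2 (by simp [hK])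
      have h2 : K ∈ I :: L := hp.symm.subset (by simp [hK])
      have h3 : K ≠ I := by
        rintro rfl
        exact pair_sublist_asymm hL' h1 h1
      have h4 : [I, K].Sublist (I :: L) :=
        pair_sublist_cons.2 (Or.inl ⟨rfl, (List.mem_cons.1 h2).resolve_left h3⟩)
      exact pair_sublist_asymm hL' h1 (h I K (fun hd => hKI hd.symm) h4)
    refine TraceEquiv.trans (cons I ?_) (move_front hd).symm
    refine ih (List.nodup_cons.1 hL).2 ((hp.trans List.perm_middle).cons_inv) fun J K hJK hs => ?_
    have h1 := h J K hJK (pair_sublist_cons.2 (Or.inr hs))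
    have h2 : J ≠ I := by
      rintro rfl
      exact (List.nodup_cons.1 hL).1 (mem_of_pair_sublist hs).1
    have h3 : K ≠ I := by
      rintro rfl
      exact (List.nodup_cons.1 hL).1 (mem_of_pair_sublist hs).2
    simp only [pair_sublist_append, pair_sublist_cons, List.mem_cons] at h1 ⊢
    tauto

theorem zigzagPerm_eq (h : TraceEquiv L L') : zigzagPerm L = zigzagPerm L' := by
  have key : ∀ {L L' : List (NonemptyInterval α)}, TraceEquiv L L' → ∀ s u,
      revProd (insertions s u L) = revProd (insertions s u L') := by
    intro L L' h
    induction h with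
    | nil => simp
    | cons I _ ih => intro s u; simp only [insertions, revProd_append, ih]
    | swap L h => exact fun s u => revProd_insertions_swap h
    | trans _ _ ih ih' => exact fun s u => (ih s u).trans (ih' s u)
  induction h with
  | nil => rfl
  | cons I h ih => rw [zigzagPerm_cons, zigzagPerm_cons, ih, key h]
  | @swap I J L h =>
    simp only [zigzagPerm_cons]
    rw [insertions_cons_of_disjoint h, insertions_cons_of_disjoint h.symm]
    have hc : Commute (revProd (insertions (pts J) (pts J) L) * reversal (pts J))
        (revProd (insertions (pts I) (pts I) L) * reversal (pts I)) := by
      rw [← revProd_cons, ← revProd_cons]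
      refine revProd_commute fun s hs t ht => ?_
      have hs' : s ⊆ pts J := by
        rcases List.mem_cons.1 hs with rfl | hs
        exacts [le_rfl, insertions_subset hs]
      have ht' : t ⊆ pts I := by
        rcases List.mem_cons.1 ht with rfl | ht
        exacts [le_rfl, insertions_subset ht]
      exact (h.mono ht' hs').symm
    have := hc.eq
    simp only [mul_assoc] at this ⊢
    rw [this]
  | trans _ _ ih ih' => exact ih.trans ih'

end TraceEquiv

end TraceEquivalence

/-! ### Zig-zag sequences and their rightmost interval -/

section Zigzag

variable {α : Type} [LinearOrder α] [Fintype α]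
variable {I J K : NonemptyInterval α} {L L' A B : List (NonemptyInterval α)}

theorem fst_mem_pts (I : NonemptyInterval α) : I.fst ∈ pts I := mem_pts.2 ⟨le_rfl, I.fst_le_snd⟩

theorem snd_mem_pts (I : NonemptyInterval α) : I.snd ∈ pts I := mem_pts.2 ⟨I.fst_le_snd, le_rfl⟩

theorem pts_subset_pts : pts I ⊆ pts J ↔ J.fst ≤ I.fst ∧ I.snd ≤ J.snd := by
  constructor
  · intro h
    exact ⟨(mem_pts.1 (h (fst_mem_pts I))).1, (mem_pts.1 (h (snd_mem_pts I))).2⟩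
  · intro h x hx
    rw [mem_pts] at hx ⊢
    exact ⟨h.1.trans hx.1, hx.2.trans h.2⟩

theorem not_disjoint_pts : ¬ Disjoint (pts I) (pts J) ↔ I.fst ≤ J.snd ∧ J.fst ≤ I.snd := by
  rw [Finset.not_disjoint_iff]
  constructor
  · rintro ⟨x, hI, hJ⟩
    rw [mem_pts] at hI hJ
    exact ⟨hI.1.trans hJ.2, hJ.1.trans hI.2⟩
  · intro h
    rcases le_total I.fst J.fst with h1 | h1
    · exact ⟨J.fst, mem_pts.2 ⟨h1, h.2⟩, fst_mem_pts J⟩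
    · exact ⟨I.fst, fst_mem_pts I, mem_pts.2 ⟨h1, h.1⟩⟩

theorem not_disjoint_pts_comm : ¬ Disjoint (pts I) (pts J) ↔ ¬ Disjoint (pts J) (pts I) := by
  rw [disjoint_comm]

/-- The zig-zag conditions in terms of pairs of terms. -/
theorem isZigzag_iff : IsZigzag L ↔ L.Nodup ∧
    (∀ I ∈ L, ∀ J ∈ L, I ≠ J → ¬ pts I ⊆ pts J) ∧
    ∀ I J K, [I, J].Sublist L → [J, K].Sublist L →
      ¬ Disjoint (pts I) (pts J) → ¬ Disjoint (pts J) (pts K) →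
      (I.fst < J.fst ∧ J.fst < K.fst ∧ I.snd < J.snd ∧ J.snd < K.snd) ∨
      (I.fst > J.fst ∧ J.fst > K.fst ∧ I.snd > J.snd ∧ J.snd > K.snd) := by
  constructor
  · rintro ⟨h1, h2⟩
    have hL : L.Nodup := by
      rw [List.nodup_iff_injective_get]
      intro i j hij
      by_contra hne
      exact (h1 i j hne).1 hij
    refine ⟨hL, ?_, ?_⟩
    · intro I hI J hJ hIJ
      obtain ⟨i, hi, rfl⟩ := List.getElem_of_mem hI
      obtain ⟨j, hj, rfl⟩ := List.getElem_of_mem hJ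
      exact (h1 ⟨i, hi⟩ ⟨j, hj⟩ (by rintro h; simp at h; subst h; exact hIJ rfl)).2.1
    · intro I J K hIJ hJK
      rw [pair_sublist_iff] at hIJ hJK
      obtain ⟨i, j, hij, rfl, rfl⟩ := hIJ
      obtain ⟨j', k, hjk, hj, rfl⟩ := hJK
      have h3 := (List.Nodup.getElem_inj_iff hL).1 hj
      have h4 : j' = j := Fin.ext h3
      subst h4
      intro ha hb
      rw [Finset.disjoint_iff_inter_eq_empty, ← ne_eq, ← Finset.nonempty_iff_ne_empty] at ha hb
      exact h2 i j' k hij hjk ha hb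
  · rintro ⟨hL, h1, h2⟩
    have hne : ∀ i j : Fin L.length, i ≠ j → L[i] ≠ L[j] := fun i j hij h =>
      hij (Fin.ext ((List.Nodup.getElem_inj_iff hL).1 h))
    refine ⟨fun i j hij => ⟨hne i j hij, h1 _ (by simp) _ (by simp) (hne i j hij),
      h1 _ (by simp) _ (by simp) (hne i j hij).symm⟩, fun i j k hij hjk ha hb => ?_⟩
    rw [Finset.nonempty_iff_ne_empty, ne_eq, ← Finset.disjoint_iff_inter_eq_empty] at ha hb
    exact h2 _ _ _ (pair_sublist_iff.2 ⟨i, j, hij, rfl, rfl⟩)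
      (pair_sublist_iff.2 ⟨j, k, hjk, rfl, rfl⟩) ha hb

theorem IsZigzag.nodup (h : IsZigzag L) : L.Nodup := (isZigzag_iff.1 h).1

theorem IsZigzag.sublist (h : IsZigzag L) (hs : L'.Sublist L) : IsZigzag L' := by
  rw [isZigzag_iff] at h ⊢
  exact ⟨h.1.sublist hs, fun I hI J hJ => h.2.1 I (hs.subset hI) J (hs.subset hJ),
    fun I J K h1 h2 => h.2.2 I J K (h1.trans hs) (h2.trans hs)⟩

theorem IsZigzag.traceEquiv (h : IsZigzag L) (ht : TraceEquiv L L') : IsZigzag L' := by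
  rw [isZigzag_iff] at h ⊢
  refine ⟨ht.perm.nodup_iff.1 h.1, fun I hI J hJ => h.2.1 I (ht.perm.symm.subset hI) J
    (ht.perm.symm.subset hJ), fun I J K h1 h2 ha hb => ?_⟩
  exact h.2.2 I J K (ht.symm.pair_sublist ha h1) (ht.symm.pair_sublist hb h2) ha hb

theorem IsZigzag.reverse (h : IsZigzag L) : IsZigzag L.reverse := by
  rw [isZigzag_iff] at h ⊢
  refine ⟨List.nodup_reverse.2 h.1, fun I hI J hJ => h.2.1 I (by simpa using hI) J
    (by simpa using hJ), fun I J K h1 h2 ha hb => ?_⟩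
  rw [pair_sublist_reverse] at h1 h2
  have := h.2.2 K J I h2 h1 (not_disjoint_pts_comm.1 hb) (not_disjoint_pts_comm.1 ha)
  tauto

/-- In an antichain of intervals the left and right endpoints are in the same order. -/
theorem IsZigzag.snd_lt (h : IsZigzag L) (hI : I ∈ L) (hJ : J ∈ L) (hlt : I.fst < J.fst) :
    I.snd < J.snd := by
  by_contra hc
  have hne : J ≠ I := by rintro rfl; exact lt_irrefl _ hlt
  exact (isZigzag_iff.1 h).2.1 J hJ I hI hne (pts_subset_pts.2 ⟨hlt.le, not_lt.1 hc⟩)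

theorem IsZigzag.fst_ne (h : IsZigzag L) (hI : I ∈ L) (hJ : J ∈ L) (hne : I ≠ J) :
    I.fst ≠ J.fst := by
  intro he
  rcases le_total I.snd J.snd with h1 | h1
  · exact (isZigzag_iff.1 h).2.1 I hI J hJ hne (pts_subset_pts.2 ⟨he.ge, h1⟩)
  · exact (isZigzag_iff.1 h).2.1 J hJ I hI hne.symm (pts_subset_pts.2 ⟨he.le, h1⟩)

/-- The interval `J` lies strictly to the right of all members of `L`. -/
def IsTop (J : NonemptyInterval α) (L : List (NonemptyInterval α)) : Prop :=
  ∀ I ∈ L, I.fst < J.fst ∧ I.snd < J.snd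

theorem exists_isTop (h : IsZigzag L) (hne : L ≠ []) :
    ∃ A J B, L = A ++ J :: B ∧ IsTop J (A ++ B) := by
  obtain ⟨J, hJ, hmax⟩ := Finset.exists_max_image (L.toFinset) (fun I => I.fst) (by simpa using hne)
  rw [List.mem_toFinset] at hJ
  obtain ⟨A, B, rfl⟩ := List.append_of_mem hJ
  refine ⟨A, J, B, rfl, fun I hI => ?_⟩
  have hIL : I ∈ A ++ J :: B := by
    simp only [List.mem_append, List.mem_cons] at hI ⊢; tauto
  have hIJ : I ≠ J := by
    rintro rfl
    have := h.nodup
    rw [List.nodup_middle] at this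
    exact (List.nodup_cons.1 this).1 hI
  have h1 : I.fst < J.fst := lt_of_le_of_ne (hmax I (List.mem_toFinset.2 hIL)) (h.fst_ne hIL hJ hIJ)
  exact ⟨h1, h.snd_lt hIL hJ h1⟩

/-- Up to trace equivalence, the rightmost interval comes first or last. -/
theorem IsZigzag.exists_top (h : IsZigzag L) (hne : L ≠ []) :
    ∃ J L₁, IsTop J L₁ ∧ (TraceEquiv L (L₁ ++ [J]) ∨ TraceEquiv L (J :: L₁)) := by
  obtain ⟨A, J, B, rfl, ht⟩ := exists_isTop h hne
  refine ⟨J, A ++ B, ht, ?_⟩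
  by_cases hA : ∀ K ∈ A, Disjoint (pts K) (pts J)
  · exact Or.inr (TraceEquiv.move_front hA)
  · refine Or.inl (TraceEquiv.move_back fun K hK => ?_)
    push Not at hA
    obtain ⟨I, hI, hIJ⟩ := hA
    by_contra hKJ
    have h1 : [I, J].Sublist (A ++ J :: B) := pair_sublist_append.2 (by simp [hI])
    have h2 : [J, K].Sublist (A ++ J :: B) :=
      pair_sublist_append.2 (by simp [hK])
    have h3 := ht I (by simp [hI])
    have h4 := ht K (by simp [hK])
    rcases (isZigzag_iff.1 h).2.2 I J K h1 h2 hIJ (not_disjoint_pts_comm.1 hKJ) with h5 | h5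
    · exact lt_asymm h4.1 h5.2.1
    · exact lt_asymm h3.1 h5.1

/-- The lower set formed by the letters to the left of `J` and those not to the right of all
members of `L`. -/
def lowerPart (L : List (NonemptyInterval α)) (J : NonemptyInterval α) : Finset α :=
  Finset.univ.filter fun x => x < J.fst ∨ ∃ I ∈ L, x ≤ I.snd

theorem mem_lowerPart {x : α} : x ∈ lowerPart L J ↔ x < J.fst ∨ ∃ I ∈ L, x ≤ I.snd := by
  simp [lowerPart]

theorem pts_inter_lowerPart_of_isTop {J' : NonemptyInterval α} (hJ : IsTop J (A ++ J' :: B))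
    (hJ' : IsTop J' (A ++ B)) : pts J ∩ lowerPart (A ++ J' :: B) J = pts J ∩ pts J' := by
  ext x
  have h1 := hJ J' (by simp)
  simp only [Finset.mem_inter, mem_pts, mem_lowerPart]
  constructor
  · rintro ⟨hx, hlt | ⟨I, hI, hxI⟩⟩
    · exact absurd hx.1 (not_le.2 hlt)
    · refine ⟨hx, h1.1.le.trans hx.1, ?_⟩
      by_cases hI' : I = J'
      · exact hI' ▸ hxI
      · have : I ∈ A ++ B := by
          simp only [List.mem_append, List.mem_cons] at hI ⊢; tauto
        exact hxI.trans (hJ' I this).2.le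
  · rintro ⟨hx, hx'⟩
    exact ⟨hx, Or.inr ⟨J', by simp, hx'.2⟩⟩

/-- The word of a zig-zag network whose rightmost interval comes last. Among its intersections with
the earlier intervals only the one with the second interval from the right is inserted. -/
theorem zigzagPerm_concat (h : IsZigzag (L ++ [J])) (ht : IsTop J L) :
    zigzagPerm (L ++ [J]) =
      reversal (pts J) * reversal (pts J ∩ lowerPart L J) * zigzagPerm L := by
  by_cases hne : L = []
  · subst hne
    have : pts J ∩ lowerPart [] J = ∅ := by
      ext x
      simp only [Finset.mem_inter, mem_pts, mem_lowerPart]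
      simp only [List.not_mem_nil, false_and, exists_false, or_false, Finset.notMem_empty,
        iff_false, not_and, not_lt]
      exact fun h => h.1
    rw [this, reversal_eq_one (s := ∅) (by simp)]
    simp [zigzagPerm_cons, insertions]
  have hL : IsZigzag L := h.sublist (List.sublist_append_left _ _)
  obtain ⟨A, J', B, rfl, ht'⟩ := exists_isTop hL hne
  rw [pts_inter_lowerPart_of_isTop ht ht']
  have hJJ' := ht J' (by simp)
  -- the intervals after `J'` do not meet `J`, as otherwise `J'`, such an interval
  -- and `J` would violate the second zig-zag condition
  have hB : ∀ K ∈ B, Disjoint (pts K) (pts J) := by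
    intro K hK
    by_contra hKJ
    have hKL := ht K (by simp [hK])
    have hKJ' := ht' K (by simp [hK])
    have h1 : [J', K].Sublist (A ++ J' :: B ++ [J]) := by
      simp [hK]
    have h2 : [K, J].Sublist (A ++ J' :: B ++ [J]) := by
      simp [pair_sublist_concat, hK]
    have hd : ¬ Disjoint (pts J') (pts K) := by
      rw [not_disjoint_pts] at hKJ ⊢
      exact ⟨hJJ'.1.le.trans hKJ.2, hKJ'.1.le.trans J'.fst_le_snd⟩
    rcases (isZigzag_iff.1 h).2.2 J' K J h1 h2 hd hKJ with h5 | h5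
    · exact lt_asymm hKJ'.1 h5.1
    · exact lt_asymm hKL.1 h5.2.1
  have hBP : zigzagPerm (B ++ [J]) = reversal (pts J) * zigzagPerm B := by
    have h1 : TraceEquiv (B ++ [J]) (J :: B) := by
      simpa using TraceEquiv.move_front (B := []) hB
    rw [h1.zigzagPerm_eq, zigzagPerm_cons, insertions_eq_nil fun K hK => (hB K hK).symm]
    have : Commute (zigzagPerm B) (reversal (pts J)) := by
      have h2 : reversal (pts J) = revProd [pts J] := by simp
      rw [h2]
      refine revProd_commute fun s hs t ht => ?_
      obtain ⟨K, hK, hsK⟩ := zigzagFactorization_subset hs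
      rw [List.mem_singleton.1 ht]
      exact (hB K hK).mono_left hsK
    rw [revProd_nil, mul_one, this.eq]
  have hcomm : Commute (zigzagPerm B) (reversal (pts J' ∩ pts J)) := by
    have h2 : reversal (pts J' ∩ pts J) = revProd [pts J' ∩ pts J] := by simp
    rw [h2]
    refine revProd_commute fun s hs t ht => ?_
    obtain ⟨K, hK, hsK⟩ := zigzagFactorization_subset hs
    rw [List.mem_singleton.1 ht]
    exact (hB K hK).mono hsK Finset.inter_subset_right
  have hJ'P : zigzagPerm (J' :: B ++ [J]) =
      reversal (pts J) * reversal (pts J ∩ pts J') * zigzagPerm (J' :: B) := by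
    rw [List.cons_append, zigzagPerm_cons, zigzagPerm_cons, hBP,
      insertions_concat_of_disjoint hB, revProd_append, revProd_insertions_singleton,
      Finset.inter_comm (pts J)]
    simp only [mul_assoc]
    rw [← mul_assoc (zigzagPerm B), hcomm.eq]
    simp only [mul_assoc]
  -- the intersections of `J` with the intervals before `J'` are covered by `J'`
  have hA : ∀ A' : List (NonemptyInterval α), (∀ K ∈ A', K ∈ A) →
      zigzagPerm (A' ++ (J' :: B ++ [J])) =
      reversal (pts J) * reversal (pts J ∩ pts J') * zigzagPerm (A' ++ J' :: B) := by
    intro A' hA'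
    induction A' with
    | nil => exact hJ'P
    | cons K A' ih =>
      rw [List.cons_append, List.cons_append (as := A') (bs := J' :: B), zigzagPerm_cons, zigzagPerm_cons,
        ih fun K hK => hA' K (by simp [hK]), ← List.append_assoc, insertions_concat_of_covered]
      · simp only [mul_assoc]
      · intro x hxK hxJ
        have hK := ht' K (by simp [hA' K (by simp)])
        rw [mem_pts] at hxK hxJ
        exact ⟨J', by simp, mem_pts.2 ⟨hJJ'.1.le.trans hxJ.1, hxK.2.trans hK.2.le⟩⟩
  simpa using hA A fun _ h => h

/-- The word of a zig-zag network whose rightmost interval comes first. Among its intersections with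
the later intervals only the one with the second interval from the right matters. -/
theorem zigzagPerm_cons_of_isTop (h : IsZigzag (J :: L)) (ht : IsTop J L) :
    zigzagPerm (J :: L) =
      zigzagPerm L * reversal (pts J ∩ lowerPart L J) * reversal (pts J) := by
  by_cases hne : L = []
  · subst hne
    have : pts J ∩ lowerPart [] J = ∅ := by
      ext x
      simp only [Finset.mem_inter, mem_pts, mem_lowerPart]
      simp only [List.not_mem_nil, false_and, exists_false, or_false, Finset.notMem_empty,
        iff_false, not_and, not_lt]
      exact fun h => h.1
    rw [this, reversal_eq_one (s := ∅) (by simp)]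
    simp [zigzagPerm_cons, insertions]
  have hL : IsZigzag L := h.sublist (List.sublist_cons_self _ _)
  obtain ⟨A, J', B, rfl, ht'⟩ := exists_isTop hL hne
  rw [pts_inter_lowerPart_of_isTop ht ht', zigzagPerm_cons]
  have hJJ' := ht J' (by simp)
  have hA : ∀ K ∈ A, Disjoint (pts J) (pts K) := by
    intro K hK
    by_contra hKJ
    have hKL := ht K (by simp [hK])
    have hKJ' := ht' K (by simp [hK])
    have h1 : [K, J'].Sublist (J :: (A ++ J' :: B)) := by
      simp [pair_sublist_append, pair_sublist_cons, hK]
    have h2 : [J, K].Sublist (J :: (A ++ J' :: B)) := by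
      simp [hK]
    have hd : ¬ Disjoint (pts K) (pts J') := by
      rw [not_disjoint_pts] at hKJ ⊢
      exact ⟨hKJ'.1.le.trans J'.fst_le_snd, hJJ'.1.le.trans hKJ.1⟩
    rcases (isZigzag_iff.1 h).2.2 J K J' h2 h1 hKJ hd with h5 | h5
    · exact lt_asymm hKL.1 h5.1
    · exact lt_asymm hKJ'.1 h5.2.1
  rw [insertions_append_left hA]
  have h1 : insertions (pts J) (pts J \ pts J') B = [] := by
    refine insertions_eq_nil fun K hK => ?_
    rw [Finset.disjoint_left]
    intro x hx hxK
    rw [Finset.mem_sdiff, mem_pts, mem_pts] at hx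
    rw [mem_pts] at hxK
    have hKJ' := ht' K (by simp [hK])
    exact hx.2 ⟨hJJ'.1.le.trans hx.1.1, hxK.2.trans hKJ'.2.le⟩
  have h2 : revProd (insertions (pts J) (pts J) (J' :: B)) = reversal (pts J ∩ pts J') := by
    rw [← revProd_insertions_singleton, insertions, h1, insertions]
    simp [insertions]
  rw [h2]

/-- Reversing the sequence of intervals inverts the word. -/
theorem zigzagPerm_reverse (h : IsZigzag L) : zigzagPerm L.reverse = (zigzagPerm L)⁻¹ := by
  induction hn : L.length generalizing L with
  | zero => rw [List.length_eq_zero_iff.1 hn]; simp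
  | succ n ih =>
    have hne : L ≠ [] := by rintro rfl; simp at hn
    obtain ⟨J, L₁, ht, hJ | hJ⟩ := h.exists_top hne
    · have h1 := h.traceEquiv hJ
      have h2 : IsZigzag L₁ := h1.sublist (List.sublist_append_left _ _)
      have h3 : L₁.length = n := by
        have := hJ.perm.length_eq
        simp at this; omega
      have h4 := h1.reverse
      rw [List.reverse_append, List.reverse_singleton, List.singleton_append] at h4
      have h5 : lowerPart L₁.reverse J = lowerPart L₁ J := by
        ext x; simp [mem_lowerPart]
      rw [hJ.reverse.zigzagPerm_eq, hJ.zigzagPerm_eq, zigzagPerm_concat h1 ht, List.reverse_append,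
        List.reverse_singleton, List.singleton_append,
        zigzagPerm_cons_of_isTop h4 fun I hI => ht I (by simpa using hI), ih h2 h3, h5]
      simp only [mul_inv_rev, reversal_inv, mul_assoc]
    · have h1 := h.traceEquiv hJ
      have h2 : IsZigzag L₁ := h1.sublist (List.sublist_cons_self _ _)
      have h3 : L₁.length = n := by
        have := hJ.perm.length_eq
        simp at this; omega
      have h4 := h1.reverse
      rw [List.reverse_cons] at h4
      have h5 : lowerPart L₁.reverse J = lowerPart L₁ J := by
        ext x; simp [mem_lowerPart]
      rw [hJ.reverse.zigzagPerm_eq, hJ.zigzagPerm_eq, zigzagPerm_cons_of_isTop h1 ht,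
        List.reverse_cons,
        zigzagPerm_concat h4 fun I hI => ht I (by simpa using hI), ih h2 h3, h5]
      simp only [mul_inv_rev, reversal_inv, mul_assoc]

end Zigzag

/-! ### Adding a rightmost and last interval to a word -/

section Peeling

variable {α : Type} [LinearOrder α] [Fintype α]
variable {J : NonemptyInterval α} {U : Finset α} {v : Equiv.Perm α} {x y e : α}

theorem perm_apply_inv (w : Equiv.Perm α) (x : α) : w (w⁻¹ x) = x := w.apply_symm_apply x

theorem perm_inv_apply (w : Equiv.Perm α) (x : α) : w⁻¹ (w x) = x := w.symm_apply_apply x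

theorem reversal_pts_snd (J : NonemptyInterval α) : reversal (pts J) J.snd = J.fst := by
  have h := reversal_mem (snd_mem_pts J)
  by_contra hne
  have h1 := reversal_lt (fst_mem_pts J) h (lt_of_le_of_ne (mem_pts.1 h).1 (Ne.symm hne))
  rw [reversal_reversal] at h1
  exact absurd (mem_pts.1 (reversal_mem (fst_mem_pts J))).2 (not_le.2 h1)

/-- The situation in which the word `v` of a zig-zag network is extended by a rightmost and last
interval `J`, where `U` is the lower set consisting of the letters to the left of `J` and of
those which are not to the right of the support of `v`. The letters in `J ∩ U` occur in `v` in
decreasing order. -/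
structure IsPeeling (J : NonemptyInterval α) (U : Finset α) (v : Equiv.Perm α) : Prop where
  lower : ∀ x ∈ U, ∀ y ≤ x, y ∈ U
  below : ∀ x < J.fst, x ∈ U
  snd_notMem : J.snd ∉ U
  fix : ∀ x, x ∉ U → v x = x
  anti : ∀ x ∈ pts J ∩ U, ∀ y ∈ pts J ∩ U, x < y → v⁻¹ y < v⁻¹ x

namespace IsPeeling

/-- The permutation of letters by which the extension differs from `v`: it moves the letters in
`J ∩ U` to the end of `J`, keeping their order, and reverses the other letters of `J`. -/
abbrev shift (J : NonemptyInterval α) (U : Finset α) : Equiv.Perm α :=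
  reversal (pts J) * reversal (pts J ∩ U)

/-- The word obtained from `v` by adding the interval `J`. -/
abbrev extend (J : NonemptyInterval α) (U : Finset α) (v : Equiv.Perm α) : Equiv.Perm α :=
  reversal (pts J) * reversal (pts J ∩ U) * v

theorem shift_of_notMem (h : x ∉ pts J) : shift J U x = x := by
  have h1 : x ∉ pts J ∩ U := fun h' => h (Finset.mem_inter.1 h').1
  rw [Equiv.Perm.mul_apply, reversal_apply_of_notMem h1, reversal_apply_of_notMem h]

theorem reversal_inter_mem (h : x ∈ pts J) : reversal (pts J ∩ U) x ∈ pts J := by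
  by_cases hx : x ∈ pts J ∩ U
  · exact (Finset.mem_inter.1 (reversal_mem hx)).1
  · rwa [reversal_apply_of_notMem hx]

theorem shift_mem (h : x ∈ pts J) : shift J U x ∈ pts J :=
  reversal_mem (reversal_inter_mem h)

theorem shift_of_mem_of_notMem (h : x ∉ U) : shift J U x = reversal (pts J) x := by
  rw [Equiv.Perm.mul_apply,
    reversal_apply_of_notMem (s := pts J ∩ U) fun h' => h (Finset.mem_inter.1 h').2]

variable (h : IsPeeling J U v)
include h

theorem lt_of_mem (hx : x ∈ U) (hy : y ∉ U) : x < y := by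
  by_contra hc
  exact hy (h.lower x hx y (not_lt.1 hc))

theorem shift_lt (hy : y ∈ U) (hxy : x < y) : shift J U x < shift J U y := by
  have hx := h.lower y hy x hxy.le
  have hyd := h.lt_of_mem hy h.snd_notMem
  by_cases hxJ : x ∈ pts J
  · have hyJ : y ∈ pts J := mem_pts.2 ⟨(mem_pts.1 hxJ).1.trans hxy.le, hyd.le⟩
    have h1 : x ∈ pts J ∩ U := Finset.mem_inter.2 ⟨hxJ, hx⟩
    have h2 : y ∈ pts J ∩ U := Finset.mem_inter.2 ⟨hyJ, hy⟩
    exact reversal_lt (Finset.mem_inter.1 (reversal_mem h2)).1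
      (Finset.mem_inter.1 (reversal_mem h1)).1 (reversal_lt h1 h2 hxy)
  · have hxc : x < J.fst := by
      by_contra hc
      exact hxJ (mem_pts.2 ⟨not_lt.1 hc, (hxy.trans hyd).le⟩)
    rw [shift_of_notMem hxJ]
    by_cases hyJ : y ∈ pts J
    · exact hxc.trans_le (mem_pts.1 (shift_mem hyJ)).1
    · rwa [shift_of_notMem hyJ]

theorem shift_gt (hx : x ∈ pts J) (hy : y ∈ pts J) (hyU : y ∉ U) (hxy : x < y) :
    shift J U y < shift J U x := by
  rw [shift_of_mem_of_notMem hyU, Equiv.Perm.mul_apply]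
  refine reversal_lt (reversal_inter_mem hx) hy ?_
  by_cases hxU : x ∈ pts J ∩ U
  · exact h.lt_of_mem (Finset.mem_inter.1 (reversal_mem hxU)).2 hyU
  · rwa [reversal_apply_of_notMem hxU]

theorem mem_iff : v x ∈ U ↔ x ∈ U := by
  constructor
  · intro hx
    by_contra hc
    rw [h.fix x hc] at hx
    exact hc hx
  · intro hx
    by_contra hc
    have := v.injective (h.fix _ hc)
    rw [this] at hc
    exact hc hx

theorem extend_lt_iff (hx : x ∈ U) (hy : y ∈ U) :
    extend J U v x < extend J U v y ↔ v x < v y := by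
  have key : ∀ {x y}, x ∈ U → y ∈ U → v x < v y → extend J U v x < extend J U v y :=
    fun _ hy hlt => h.shift_lt (h.mem_iff.2 hy) hlt
  refine ⟨fun hlt => ?_, key hx hy⟩
  rcases lt_trichotomy (v x) (v y) with h1 | h1 | h1
  · exact h1
  · rw [v.injective h1] at hlt
    exact absurd hlt (lt_irrefl _)
  · exact absurd hlt (lt_asymm (key hy hx h1))

theorem extend_of_gt (hx : J.snd < x) : extend J U v x = x := by
  have h1 : x ∉ U := fun hU => h.snd_notMem (h.lower x hU _ hx.le)
  have h2 : x ∉ pts J := fun hJ => absurd (mem_pts.1 hJ).2 (not_le.2 hx)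
  rw [Equiv.Perm.mul_apply, h.fix x h1]
  exact shift_of_notMem h2

theorem extend_of_notMem (hU : x ∉ U) : extend J U v x = reversal (pts J) x := by
  rw [Equiv.Perm.mul_apply, h.fix x hU]
  exact shift_of_mem_of_notMem hU

theorem extend_of_lt (hx : v x < J.fst) : extend J U v x = v x := by
  rw [Equiv.Perm.mul_apply]
  exact shift_of_notMem fun hJ => absurd (mem_pts.1 hJ).1 (not_le.2 hx)

theorem extend_snd : extend J U v J.snd = J.fst := by
  rw [h.extend_of_notMem h.snd_notMem, reversal_pts_snd]

theorem extend_anti (hx : x ∈ pts J) (hy : y ∈ pts J) (hxy : x < y) :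
    (extend J U v)⁻¹ y < (extend J U v)⁻¹ x := by
  have key : ∀ a ∈ pts J, ∀ b ∈ pts J, a < b →
      v⁻¹ (reversal (pts J ∩ U) a) < v⁻¹ (reversal (pts J ∩ U) b) := by
    intro a ha b hb hab
    have hinv : ∀ z, z ∉ U → v⁻¹ z = z := fun z hz => by
      rw [Equiv.Perm.inv_eq_iff_eq, h.fix z hz]
    by_cases hbU : b ∈ U
    · have h1 : a ∈ pts J ∩ U := Finset.mem_inter.2 ⟨ha, h.lower b hbU a hab.le⟩
      have h2 : b ∈ pts J ∩ U := Finset.mem_inter.2 ⟨hb, hbU⟩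
      exact h.anti _ (reversal_mem h2) _ (reversal_mem h1) (reversal_lt h1 h2 hab)
    · rw [reversal_apply_of_notMem (x := b) fun h' => hbU (Finset.mem_inter.1 h').2, hinv b hbU]
      by_cases haU : a ∈ U
      · have h1 : a ∈ pts J ∩ U := Finset.mem_inter.2 ⟨ha, haU⟩
        refine h.lt_of_mem (h.mem_iff.1 ?_) hbU
        rw [perm_apply_inv]
        exact (Finset.mem_inter.1 (reversal_mem h1)).2
      · rwa [reversal_apply_of_notMem (x := a) fun h' => haU (Finset.mem_inter.1 h').2, hinv a haU]
  have := key _ (reversal_mem hy) _ (reversal_mem hx) (reversal_lt hx hy hxy)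
  simpa [extend, mul_inv_rev, reversal_inv] using this

/-- To the left of a position `e` in `J` outside of `U`, the values exceeding the value at `e`
decrease. -/
theorem extend_decreasing (hxy : x < y) (hye : y < e) (he : e ∈ pts J) (heU : e ∉ U)
    (hex : extend J U v e < extend J U v x) (hey : extend J U v e < extend J U v y) :
    extend J U v y < extend J U v x := by
  have hec : J.fst ≤ extend J U v e := by
    rw [h.extend_of_notMem heU]
    exact (mem_pts.1 (reversal_mem he)).1
  have hge : ∀ z, extend J U v e < extend J U v z → J.fst ≤ v z := by
    intro z hz
    by_contra hc
    rw [h.extend_of_lt (not_le.1 hc)] at hz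
    exact absurd (hec.trans hz.le) hc
  have hvmem : ∀ z ∈ U, J.fst ≤ v z → v z ∈ pts J ∩ U := fun z hz hcz =>
    Finset.mem_inter.2 ⟨mem_pts.2 ⟨hcz, (h.lt_of_mem (h.mem_iff.2 hz) h.snd_notMem).le⟩,
      h.mem_iff.2 hz⟩
  have hed := (mem_pts.1 he).2
  by_cases hyU : y ∈ U
  · have hxU := h.lower y hyU x hxy.le
    rw [h.extend_lt_iff hyU hxU]
    by_contra hc
    have h1 : v x < v y := lt_of_le_of_ne (not_lt.1 hc) fun h' => hxy.ne (v.injective h')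
    have h2 := h.anti _ (hvmem x hxU (hge x hex)) _ (hvmem y hyU (hge y hey)) h1
    rw [perm_inv_apply, perm_inv_apply] at h2
    exact lt_asymm hxy h2
  · have hyc := hge y hey
    have hyJ : y ∈ pts J := mem_pts.2 ⟨by rwa [h.fix y hyU] at hyc, (hye.trans_le hed).le⟩
    have hvy : v y = y := h.fix y hyU
    have hxc := hge x hex
    have hlt : v x < v y := by
      rw [hvy]
      by_cases hxU : x ∈ U
      · exact h.lt_of_mem (h.mem_iff.2 hxU) hyU
      · rwa [h.fix x hxU]
    have hyd := (mem_pts.1 hyJ).2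
    refine h.shift_gt (mem_pts.2 ⟨hxc, ?_⟩) (hvy.symm ▸ hyJ) (hvy.symm ▸ hyU) hlt
    rw [hvy] at hlt
    exact hlt.le.trans hyd

/-- The patterns covered are those whose last letter is exceeded by two earlier letters in
increasing order, such as 3412 and 4231. -/
theorem avoids_extend_iff {k : ℕ} {u : Fin (k + 1) → ℕ} {i j : Fin (k + 1)} (hij : i < j)
    (hj : j < Fin.last k) (hu : u i < u j) (hi : u (Fin.last k) < u i) :
    Avoids (extend J U v) u ↔ Avoids v u := by
  have hfix : ∀ (w : Equiv.Perm α) (x y : α), (∀ z, y ≤ z → w z = z) → x < y → w x < w y := by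
    intro w x y hw hxy
    rw [hw y le_rfl]
    by_contra hc
    have := w.injective (hw _ (not_lt.1 hc))
    rw [this] at hc
    exact hc hxy
  have hmem : ∀ p : Fin (k + 1) → α, StrictMono p → p (Fin.last k) ∈ U → ∀ i, p i ∈ U :=
    fun p hp hU i => h.lower _ hU _ (hp.monotone (Fin.le_last i))
  refine not_congr ⟨?_, ?_⟩
  · rintro ⟨p, hp, hpu⟩
    have hlast : p (Fin.last k) ∈ U := by
      by_contra hU
      have hlt := hp hij
      have hlt' := hp hj
      by_cases hJ : p (Fin.last k) ∈ pts J
      · exact lt_asymm ((hpu i j).1 hu) (h.extend_decreasing hlt hlt' hJ hU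
          ((hpu _ _).1 hi) ((hpu _ _).1 (hi.trans hu)))
      · have hd : J.snd < p (Fin.last k) := by
          by_contra hc
          refine hJ (mem_pts.2 ⟨?_, not_lt.1 hc⟩)
          by_contra hc'
          exact hU (h.below _ (not_le.1 hc'))
        exact lt_asymm ((hpu _ _).1 hi) (hfix _ _ _
          (fun z hz => h.extend_of_gt (hd.trans_le hz)) (hlt.trans hlt'))
    exact ⟨p, hp, fun a b => (hpu a b).trans
      (h.extend_lt_iff (hmem p hp hlast a) (hmem p hp hlast b))⟩
  · rintro ⟨p, hp, hpu⟩
    have hlast : p (Fin.last k) ∈ U := by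
      by_contra hU
      exact lt_asymm ((hpu _ _).1 hi) (hfix _ _ _
        (fun z hz => h.fix z fun hz' => hU (h.lower z hz' _ hz)) (hp (hij.trans hj)))
    exact ⟨p, hp, fun a b => (hpu a b).trans
      (h.extend_lt_iff (hmem p hp hlast a) (hmem p hp hlast b)).symm⟩

theorem avoids_3412_iff : Avoids (extend J U v) ![3, 4, 1, 2] ↔ Avoids v ![3, 4, 1, 2] :=
  h.avoids_extend_iff (i := 0) (j := 1) (by decide) (by decide) (by decide) (by decide)

theorem avoids_4231_iff : Avoids (extend J U v) ![4, 2, 3, 1] ↔ Avoids v ![4, 2, 3, 1] :=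
  h.avoids_extend_iff (i := 1) (j := 2) (by decide) (by decide) (by decide) (by decide)

end IsPeeling

/-- Avoidance of an involution is invariant under taking inverses. -/
theorem avoids_inv {k : ℕ} {u : Fin k → ℕ} (σ : Fin k → Fin k) (hσ : ∀ i, σ (σ i) = i)
    (hu : ∀ i, u i = σ i + 1) {w : Equiv.Perm α} (hw : Avoids w u) : Avoids w⁻¹ u := by
  rintro ⟨p, hp, hpu⟩
  refine hw ⟨fun i => w⁻¹ (p (σ i)), fun i j hij => ?_, fun i j => ?_⟩
  · rw [← hpu, hu, hu, hσ, hσ]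
    have : i.1 < j.1 := hij
    omega
  · simp only [perm_apply_inv, hp.lt_iff_lt]
    rw [hu, hu, Fin.lt_def, Nat.add_lt_add_iff_right]

theorem avoids_3412_inv {w : Equiv.Perm α} (hw : Avoids w ![3, 4, 1, 2]) :
    Avoids w⁻¹ ![3, 4, 1, 2] :=
  avoids_inv ![2, 3, 0, 1] (by decide) (by decide) hw

theorem avoids_4231_inv {w : Equiv.Perm α} (hw : Avoids w ![4, 2, 3, 1]) :
    Avoids w⁻¹ ![4, 2, 3, 1] :=
  avoids_inv ![3, 1, 2, 0] (by decide) (by decide) hw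

end Peeling

/-! ### The word determines the sequence -/

section Words

variable {α : Type} [LinearOrder α] [Fintype α]
variable {I J K : NonemptyInterval α} {L L' L₁ : List (NonemptyInterval α)} {w : Equiv.Perm α}
  {x y : α}

theorem avoids_one {k : ℕ} {u : Fin k → ℕ} {i j : Fin k} (hji : j < i) (hu : u i < u j) :
    Avoids (1 : Equiv.Perm α) u := by
  rintro ⟨p, hp, hpu⟩
  exact lt_asymm ((hpu i j).1 hu) (hp hji)

/-- A zig-zag sequence all of whose intervals have at least two elements. -/
def IsProper (L : List (NonemptyInterval α)) : Prop :=
  IsZigzag L ∧ ∀ I ∈ L, I.fst < I.snd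

theorem IsProper.sublist (h : IsProper L) (hs : L'.Sublist L) : IsProper L' :=
  ⟨h.1.sublist hs, fun I hI => h.2 I (hs.subset hI)⟩

theorem IsProper.traceEquiv (h : IsProper L) (ht : TraceEquiv L L') : IsProper L' :=
  ⟨h.1.traceEquiv ht, fun I hI => h.2 I (ht.perm.symm.subset hI)⟩

theorem IsProper.reverse (h : IsProper L) : IsProper L.reverse :=
  ⟨h.1.reverse, fun I hI => h.2 I (by simpa using hI)⟩

/-- `J` is the rightmost member of `L`. -/
def IsRightmost (J : NonemptyInterval α) (L : List (NonemptyInterval α)) : Prop :=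
  J ∈ L ∧ ∀ I ∈ L, I ≠ J → I.fst < J.fst ∧ I.snd < J.snd

theorem IsRightmost.perm (h : IsRightmost J L) (hp : L.Perm L') : IsRightmost J L' :=
  ⟨hp.subset h.1, fun I hI => h.2 I (hp.symm.subset hI)⟩

theorem IsRightmost.snd_le (h : IsRightmost J L) (hI : I ∈ L) : I.snd ≤ J.snd := by
  by_cases hne : I = J
  · rw [hne]
  · exact (h.2 I hI hne).2.le

theorem IsRightmost.eq (h : IsRightmost J L) (h' : IsRightmost K L) : J = K := by
  by_contra hne
  exact lt_asymm (h.2 K h'.1 (Ne.symm hne)).1 (h'.2 J h.1 hne).1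

theorem IsTop.isRightmost_concat (h : IsTop J L) : IsRightmost J (L ++ [J]) := by
  refine ⟨by simp, fun I hI hne => h I ?_⟩
  simpa [hne] using hI

theorem IsTop.isRightmost_cons (h : IsTop J L) : IsRightmost J (J :: L) := by
  refine ⟨by simp, fun I hI hne => h I ?_⟩
  simpa [hne] using hI

theorem IsZigzag.exists_isRightmost (h : IsZigzag L) (hne : L ≠ []) : ∃ J, IsRightmost J L := by
  obtain ⟨A, J, B, rfl, ht⟩ := exists_isTop h hne
  exact ⟨J, ht.isRightmost_cons.perm List.perm_middle.symm⟩

theorem IsTop.notMem (h : IsTop J L) : J ∉ L := fun hJ => lt_irrefl _ (h J hJ).1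

/-- Properties of the word `w` of a zig-zag sequence `L` with rightmost interval `J`: the right
end of `J` is the largest letter that `w` moves, the left end can be read off from the position
and the value of this letter, and the letters (the positions) in a right part of `J` occur in
(carry) decreasing order if all the other intervals meeting this part come before (after) `J`. -/
structure WordFacts (L : List (NonemptyInterval α)) (J : NonemptyInterval α)
    (w : Equiv.Perm α) : Prop where
  fix : ∀ x, J.snd < x → w x = x
  le : w J.snd ≤ J.fst
  inv_le : w⁻¹ J.snd ≤ J.fst
  eq_or_eq : w J.snd = J.fst ∨ w⁻¹ J.snd = J.fst
  anti_inv : ∀ q, J.fst < q → (∀ I ∈ L, I ≠ J → q ≤ I.snd → [I, J].Sublist L) →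
    ∀ x y, q ≤ x → x < y → y ≤ J.snd → w⁻¹ y < w⁻¹ x
  anti : ∀ q, J.fst < q → (∀ I ∈ L, I ≠ J → q ≤ I.snd → [J, I].Sublist L) →
    ∀ x y, q ≤ x → x < y → y ≤ J.snd → w y < w x
  avoids_3412 : Avoids w ![3, 4, 1, 2]
  avoids_4231 : Avoids w ![4, 2, 3, 1]

theorem WordFacts.reverse (h : WordFacts L J w) : WordFacts L.reverse J w⁻¹ where
  fix x hx := Equiv.Perm.inv_eq_iff_eq.2 (h.fix x hx).symm
  le := h.inv_le
  inv_le := by rw [inv_inv]; exact h.le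
  eq_or_eq := by rw [inv_inv]; exact h.eq_or_eq.symm
  anti_inv q hq hL := by
    rw [inv_inv]
    refine h.anti q hq fun I hI hne hle => ?_
    exact pair_sublist_reverse.1 (hL I (by simpa using hI) hne hle)
  anti q hq hL := by
    refine h.anti_inv q hq fun I hI hne hle => ?_
    exact pair_sublist_reverse.1 (hL I (by simpa using hI) hne hle)
  avoids_3412 := avoids_3412_inv h.avoids_3412
  avoids_4231 := avoids_4231_inv h.avoids_4231

theorem WordFacts.traceEquiv (h : WordFacts L J w) (ht : TraceEquiv L L')
    (hJ : IsRightmost J L) : WordFacts L' J w where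
  fix := h.fix
  le := h.le
  inv_le := h.inv_le
  eq_or_eq := h.eq_or_eq
  anti_inv q hq hL := by
    refine h.anti_inv q hq fun I hI hne hle => ?_
    refine ht.symm.pair_sublist ?_ (hL I (ht.perm.subset hI) hne hle)
    rw [not_disjoint_pts]
    exact ⟨(hJ.2 I hI hne).1.le.trans J.fst_le_snd, hq.le.trans hle⟩
  anti q hq hL := by
    refine h.anti q hq fun I hI hne hle => ?_
    refine ht.symm.pair_sublist ?_ (hL I (ht.perm.subset hI) hne hle)
    rw [not_disjoint_pts]
    exact ⟨hq.le.trans hle, (hJ.2 I hI hne).1.le.trans J.fst_le_snd⟩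
  avoids_3412 := h.avoids_3412
  avoids_4231 := h.avoids_4231

theorem snd_notMem_lowerPart (ht : IsTop J L) (hJ : J.fst ≤ J.snd) : J.snd ∉ lowerPart L J := by
  rw [mem_lowerPart]
  rintro (h | ⟨I, hI, h⟩)
  · exact absurd hJ (not_le.2 h)
  · exact absurd (ht I hI).2 (not_lt.2 h)

theorem isPeeling_of_wordFacts (h : IsZigzag (L ++ [J])) (ht : IsTop J L)
    (hf : ∀ J', IsRightmost J' L → WordFacts L J' (zigzagPerm L)) :
    IsPeeling J (lowerPart L J) (zigzagPerm L) where
  lower x hx y hy := by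
    rw [mem_lowerPart] at hx ⊢
    exact hx.imp hy.trans_lt fun ⟨I, hI, hxI⟩ => ⟨I, hI, hy.trans hxI⟩
  below x hx := mem_lowerPart.2 (Or.inl hx)
  snd_notMem := snd_notMem_lowerPart ht J.fst_le_snd
  fix x hx := by
    by_cases hne : L = []
    · subst hne; rfl
    · obtain ⟨J', hJ'⟩ := (h.sublist (List.sublist_append_left _ _)).exists_isRightmost hne
      refine (hf J' hJ').fix x ?_
      by_contra hc
      exact hx (mem_lowerPart.2 (Or.inr ⟨J', hJ'.1, not_lt.1 hc⟩))
  anti x hx y hy hxy := by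
    have hL : IsZigzag L := h.sublist (List.sublist_append_left _ _)
    rw [Finset.mem_inter, mem_pts, mem_lowerPart] at hx hy
    obtain ⟨I, hI, hyI⟩ := hy.2.resolve_left (not_lt.2 hy.1.1)
    obtain ⟨J', hJ'⟩ := hL.exists_isRightmost (List.ne_nil_of_mem hI)
    have hJJ' := ht J' hJ'.1
    refine (hf J' hJ').anti_inv J.fst hJJ'.1 (fun K hK hne hle => ?_) x y hx.1.1 hxy
      (hyI.trans (hJ'.snd_le hI))
    -- otherwise `J'`, `K`, `J` would violate the second zig-zag condition
    refine (pair_sublist_or hK hJ'.1 hne).resolve_right fun hs => ?_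
    have hKJ' := hJ'.2 K hK hne
    have hKJ := ht K hK
    have h1 : ¬ Disjoint (pts J') (pts K) := by
      rw [not_disjoint_pts]
      exact ⟨hJJ'.1.le.trans hle, hKJ'.1.le.trans J'.fst_le_snd⟩
    have h2 : ¬ Disjoint (pts K) (pts J) := by
      rw [not_disjoint_pts]
      exact ⟨hKJ.1.le.trans J.fst_le_snd, hle⟩
    rcases (isZigzag_iff.1 h).2.2 J' K J (pair_sublist_concat.2 (Or.inl hs))
      (pair_sublist_concat.2 (Or.inr ⟨hK, rfl⟩)) h1 h2 with h5 | h5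
    · exact lt_asymm hKJ'.1 h5.1
    · exact lt_asymm hKJ.1 h5.2.1

theorem exists_of_mem_lowerPart (hx : J.fst ≤ x) (hxL : x ∈ lowerPart L J) :
    ∃ I ∈ L, x ≤ I.snd :=
  (mem_lowerPart.1 hxL).resolve_left (not_lt.2 hx)

/-- The word of `L ++ [J]` determines where the intervals in `L` end. -/
theorem mem_lowerPart_iff (h : IsProper (L ++ [J])) (ht : IsTop J L)
    (hf : ∀ J', IsRightmost J' L → WordFacts L J' (zigzagPerm L)) (hx : J.fst ≤ x) :
    x ∈ lowerPart L J ↔ ∃ y, x ≤ y ∧ zigzagPerm (L ++ [J]) y < J.fst := by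
  have hp := isPeeling_of_wordFacts h.1 ht hf
  have hL := h.1.sublist (List.sublist_append_left _ _)
  rw [zigzagPerm_concat h.1 ht]
  constructor
  · intro hxL
    obtain ⟨I, hI, hxI⟩ := exists_of_mem_lowerPart hx hxL
    obtain ⟨J', hJ'⟩ := hL.exists_isRightmost (List.ne_nil_of_mem hI)
    have h1 := ((hf J' hJ').le.trans_lt (ht J' hJ'.1).1)
    refine ⟨J'.snd, hxI.trans (hJ'.snd_le hI), ?_⟩
    rw [hp.extend_of_lt h1]
    exact h1
  · rintro ⟨y, hxy, hy⟩
    by_contra hxU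
    have hyU : y ∉ lowerPart L J := fun hyU => hxU (hp.lower y hyU x hxy)
    by_cases hyJ : y ≤ J.snd
    · rw [hp.extend_of_notMem hyU] at hy
      exact absurd (mem_pts.1 (reversal_mem (mem_pts.2 ⟨hx.trans hxy, hyJ⟩))).1 (not_le.2 hy)
    · rw [hp.extend_of_gt (not_le.1 hyJ)] at hy
      exact absurd (hx.trans hxy) (not_le.2 hy)

theorem zigzagPerm_concat_inv_snd_lt (h : IsProper (L ++ [J])) (ht : IsTop J L)
    (hf : ∀ J', IsRightmost J' L → WordFacts L J' (zigzagPerm L))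
    (hJ : J.fst ∈ lowerPart L J) : (zigzagPerm (L ++ [J]))⁻¹ J.snd < J.fst := by
  have hL := h.1.sublist (List.sublist_append_left _ _)
  obtain ⟨I, hI, hxI⟩ := exists_of_mem_lowerPart le_rfl hJ
  obtain ⟨J', hJ'⟩ := hL.exists_isRightmost (List.ne_nil_of_mem hI)
  have hJJ' := ht J' hJ'.1
  let M : NonemptyInterval α := ⟨(J.fst, J'.snd), hxI.trans (hJ'.snd_le hI)⟩
  have hM : pts J ∩ lowerPart L J = pts M := by
    ext x
    rw [Finset.mem_inter, mem_pts, mem_lowerPart, mem_pts]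
    constructor
    · rintro ⟨h1, h2⟩
      obtain ⟨K, hK, hxK⟩ := h2.resolve_left (not_lt.2 h1.1)
      exact ⟨h1.1, hxK.trans (hJ'.snd_le hK)⟩
    · rintro ⟨h1, h2⟩
      exact ⟨⟨h1, h2.trans hJJ'.2.le⟩, Or.inr ⟨J', hJ'.1, h2⟩⟩
  have h1 : reversal (pts M) J.fst = J'.snd := by
    have : M.fst = J.fst := rfl
    rw [← this, ← reversal_pts_snd M, reversal_reversal]
  rw [zigzagPerm_concat h.1 ht, mul_inv_rev, mul_inv_rev, reversal_inv, reversal_inv,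
    Equiv.Perm.mul_apply, Equiv.Perm.mul_apply, reversal_pts_snd, hM, h1]
  exact (hf J' hJ').inv_le.trans_lt hJJ'.1

theorem wordFacts_concat (h : IsProper (L ++ [J])) (ht : IsTop J L)
    (hf : ∀ J', IsRightmost J' L → WordFacts L J' (zigzagPerm L)) :
    WordFacts (L ++ [J]) J (zigzagPerm (L ++ [J])) := by
  have hp := isPeeling_of_wordFacts h.1 ht hf
  have hw := zigzagPerm_concat h.1 ht
  have hlt := zigzagPerm_concat_inv_snd_lt h ht hf
  have hav : Avoids (zigzagPerm L) ![3, 4, 1, 2] ∧ Avoids (zigzagPerm L) ![4, 2, 3, 1] := by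
    by_cases hne : L = []
    · subst hne
      exact ⟨avoids_one (i := 2) (j := 0) (by decide) (by decide),
        avoids_one (i := 3) (j := 0) (by decide) (by decide)⟩
    · obtain ⟨J', hJ'⟩ :=
        (h.1.sublist (List.sublist_append_left _ _)).exists_isRightmost hne
      exact ⟨(hf J' hJ').avoids_3412, (hf J' hJ').avoids_4231⟩
  refine ⟨fun x hx => ?_, ?_, ?_, Or.inl ?_, fun q hq _ x y hx hxy hy => ?_,
    fun q hq hL x y hx hxy hy => ?_, ?_, ?_⟩
  · rw [hw]; exact hp.extend_of_gt hx
  · rw [hw]; exact hp.extend_snd.le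
  · by_cases hJ : J.fst ∈ lowerPart L J
    · exact (hlt hJ).le
    · rw [Equiv.Perm.inv_eq_iff_eq.2]
      rw [hw, hp.extend_of_notMem hJ, ← reversal_pts_snd, reversal_reversal]
  · rw [hw]; exact hp.extend_snd
  · rw [hw]
    exact hp.extend_anti (mem_pts.2 ⟨hq.le.trans hx, hxy.le.trans hy⟩)
      (mem_pts.2 ⟨hq.le.trans (hx.trans hxy.le), hy⟩) hxy
  · -- no interval in `L` meets the part `[q, J.snd]`
    have hU : ∀ z, q ≤ z → z ∉ lowerPart L J := by
      intro z hz hzU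
      obtain ⟨I, hI, hzI⟩ := exists_of_mem_lowerPart (hq.le.trans hz) hzU
      have hne : I ≠ J := by rintro rfl; exact ht.notMem hI
      have h1 := hL I (by simp [hI]) hne (hz.trans hzI)
      exact pair_sublist_asymm h.1.nodup h1 (pair_sublist_concat.2 (Or.inr ⟨hI, rfl⟩))
    rw [hw, hp.extend_of_notMem (hU x hx), hp.extend_of_notMem (hU y (hx.trans hxy.le))]
    exact reversal_lt (mem_pts.2 ⟨hq.le.trans hx, hxy.le.trans hy⟩)
      (mem_pts.2 ⟨hq.le.trans (hx.trans hxy.le), hy⟩) hxy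
  · rw [hw, hp.avoids_3412_iff]; exact hav.1
  · rw [hw, hp.avoids_4231_iff]; exact hav.2

theorem IsProper.wordFacts (h : IsProper L) (hJ : IsRightmost J L) :
    WordFacts L J (zigzagPerm L) := by
  induction hn : L.length using Nat.strong_induction_on generalizing L J with
  | _ n ih =>
    have key : ∀ L L₁ : List (NonemptyInterval α), ∀ K, IsProper L → L.length = n → IsTop K L₁ →
        TraceEquiv L (L₁ ++ [K]) → WordFacts L K (zigzagPerm L) := by
      intro L L₁ K hL hn ht htr
      have h1 := hL.traceEquiv htr
      have h2 := wordFacts_concat h1 ht fun J' hJ' =>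
        ih L₁.length (by have := htr.perm.length_eq; simp at this; omega)
          (h1.sublist (List.sublist_append_left _ _)) hJ' rfl
      rw [htr.zigzagPerm_eq]
      exact h2.traceEquiv htr.symm ht.isRightmost_concat
    obtain ⟨K, L₁, ht, htr | htr⟩ := h.1.exists_top (List.ne_nil_of_mem hJ.1)
    · rw [hJ.eq (ht.isRightmost_concat.perm htr.perm.symm)]
      exact key L L₁ K h hn ht htr
    · rw [hJ.eq (ht.isRightmost_cons.perm htr.perm.symm)]
      have h1 := key L.reverse L₁.reverse K h.reverse (by simpa using hn)
        (fun I hI => ht I (by simpa using hI)) (by simpa using htr.reverse)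
      have h2 := h1.reverse
      rwa [zigzagPerm_reverse h.1, List.reverse_reverse, inv_inv] at h2

/-- Sequences whose rightmost interval comes last are trace equivalent if they have the same word,
given that the word determines shorter sequences. -/
theorem traceEquiv_of_concat (h : IsProper L) (h' : IsProper L') {L₁' : List (NonemptyInterval α)}
    (ht : IsTop J L₁) (ht' : IsTop J L₁') (htr : TraceEquiv L (L₁ ++ [J]))
    (htr' : TraceEquiv L' (L₁' ++ [J])) (hw : zigzagPerm L = zigzagPerm L')
    (ih : IsProper L₁ → IsProper L₁' → zigzagPerm L₁ = zigzagPerm L₁' → TraceEquiv L₁ L₁') :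
    TraceEquiv L L' := by
  have h1 := h.traceEquiv htr
  have h1' := h'.traceEquiv htr'
  have h2 := h1.sublist (List.sublist_append_left _ _)
  have h2' := h1'.sublist (List.sublist_append_left _ _)
  rw [htr.zigzagPerm_eq, htr'.zigzagPerm_eq] at hw
  have hU : pts J ∩ lowerPart L₁ J = pts J ∩ lowerPart L₁' J := by
    ext x
    rw [Finset.mem_inter, Finset.mem_inter]
    refine and_congr_right fun hx => ?_
    rw [mem_lowerPart_iff h1 ht (fun _ => h2.wordFacts) (mem_pts.1 hx).1,
      mem_lowerPart_iff h1' ht' (fun _ => h2'.wordFacts) (mem_pts.1 hx).1, hw]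
  rw [zigzagPerm_concat h1.1 ht, zigzagPerm_concat h1'.1 ht', hU] at hw
  exact htr.trans (((ih h2 h2' (mul_left_cancel hw)).append_right _).trans htr'.symm)

theorem traceEquiv_concat_cons (h : IsProper (L ++ [J])) (ht : IsTop J L)
    (hJ : (zigzagPerm (L ++ [J]))⁻¹ J.snd = J.fst) : TraceEquiv (L ++ [J]) (J :: L) := by
  have h2 := h.sublist (List.sublist_append_left _ _)
  have : ∀ K ∈ L, Disjoint (pts K) (pts J) := by
    intro K hK
    by_contra hKJ
    rw [not_disjoint_pts] at hKJ
    have := zigzagPerm_concat_inv_snd_lt h ht (fun _ => h2.wordFacts)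
      (mem_lowerPart.2 (Or.inr ⟨K, hK, hKJ.2⟩))
    exact this.ne hJ
  simpa using TraceEquiv.move_front (B := []) this

theorem IsRightmost.eq_of_zigzagPerm_eq (h : IsProper L) (h' : IsProper L')
    (hJ : IsRightmost J L) (hK : IsRightmost K L') (hw : zigzagPerm L = zigzagPerm L') : J = K := by
  have hf := h.wordFacts hJ
  have hf' := h'.wordFacts hK
  rw [← hw] at hf'
  have key : ∀ {L L'} {J K : NonemptyInterval α} {w : Equiv.Perm α}, J.fst < J.snd →
      WordFacts L J w → WordFacts L' K w → J.snd ≤ K.snd := by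
    intro L L' J K w hJ hf hf'
    by_contra hc
    have h1 := hf'.fix _ (not_le.1 hc)
    have h2 := hf.le
    rw [h1] at h2
    exact absurd hJ (not_lt.2 h2)
  have hsnd : J.snd = K.snd :=
    le_antisymm (key (h.2 J hJ.1) hf hf') (key (h'.2 K hK.1) hf' hf)
  have key' : ∀ {L L'} {J K : NonemptyInterval α} {w : Equiv.Perm α}, J.snd = K.snd →
      WordFacts L J w → WordFacts L' K w → J.fst ≤ K.fst := by
    intro L L' J K w hs hf hf'
    rcases hf.eq_or_eq with h1 | h1
    · rw [← h1, hs]; exact hf'.le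
    · rw [← h1, hs]; exact hf'.inv_le
  have hfst : J.fst = K.fst := le_antisymm (key' hsnd hf hf') (key' hsnd.symm hf' hf)
  exact NonemptyInterval.ext (Prod.ext hfst hsnd)

/-- The word of a zig-zag network determines the sequence of its intervals, up to trace
equivalence. -/
theorem traceEquiv_of_zigzagPerm_eq (h : IsProper L) (h' : IsProper L')
    (hw : zigzagPerm L = zigzagPerm L') : TraceEquiv L L' := by
  induction hn : L.length using Nat.strong_induction_on generalizing L L' with
  | _ n ih =>
    have hone : ∀ {L L' : List (NonemptyInterval α)}, IsProper L' →
        zigzagPerm L = zigzagPerm L' → L = [] → L' = [] := by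
      intro L L' h' hw hL
      by_contra hne
      obtain ⟨J, hJ⟩ := h'.1.exists_isRightmost hne
      have hle := (h'.wordFacts hJ).le
      rw [← hw, hL, zigzagPerm_nil] at hle
      exact absurd (h'.2 J hJ.1) (not_lt.2 hle)
    by_cases hne : L = []
    · rw [hne, hone h' hw hne]; exact TraceEquiv.nil
    have hne' : L' ≠ [] := fun hc => hne (hone h hw.symm hc)
    obtain ⟨J, L₁, ht, htr⟩ := h.1.exists_top hne
    obtain ⟨K, L₁', ht', htr'⟩ := h'.1.exists_top hne'
    have hJ : IsRightmost J L := by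
      rcases htr with htr | htr
      · exact ht.isRightmost_concat.perm htr.perm.symm
      · exact ht.isRightmost_cons.perm htr.perm.symm
    have hK : IsRightmost K L' := by
      rcases htr' with htr | htr
      · exact ht'.isRightmost_concat.perm htr.perm.symm
      · exact ht'.isRightmost_cons.perm htr.perm.symm
    obtain rfl := hJ.eq_of_zigzagPerm_eq h h' hK hw
    have hlen : L₁.length < n := by
      rcases htr with htr | htr <;>
      · have := htr.perm.length_eq
        simp at this
        omega
    -- the case that `J` comes first in both sequences follows by reversing them
    have hfirst : TraceEquiv L (J :: L₁) → TraceEquiv L' (J :: L₁') → TraceEquiv L L' := by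
      intro htr htr'
      have := traceEquiv_of_concat (J := J) (L₁ := L₁.reverse) (L₁' := L₁'.reverse) h.reverse
        h'.reverse (fun I hI => ht I (by simpa using hI)) (fun I hI => ht' I (by simpa using hI))
        (by simpa using htr.reverse) (by simpa using htr'.reverse)
        (by rw [zigzagPerm_reverse h.1, zigzagPerm_reverse h'.1, hw])
        (fun h1 h2 h3 => ih _ (by simpa using hlen) h1 h2 h3 rfl)
      simpa using this.reverse
    have hmixed : ∀ {L L' L₁ L₁' : List (NonemptyInterval α)}, IsProper L → IsProper L' →
        zigzagPerm L = zigzagPerm L' → IsTop J L₁ → IsTop J L₁' →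
        TraceEquiv L (L₁ ++ [J]) → TraceEquiv L' (J :: L₁') → TraceEquiv L (J :: L₁) := by
      intro L L' L₁ L₁' h h' hw ht ht' htr htr'
      refine htr.trans (traceEquiv_concat_cons (h.traceEquiv htr) ht ?_)
      have h1 := h'.reverse.traceEquiv htr'.reverse
      rw [List.reverse_cons] at h1
      have ht'' : IsTop J L₁'.reverse := fun I hI => ht' I (by simpa using hI)
      have h2 := isPeeling_of_wordFacts h1.1 ht''
        fun _ => (h1.sublist (List.sublist_append_left _ _)).wordFacts
      have h3 := h2.extend_snd
      rw [IsPeeling.extend, ← zigzagPerm_concat h1.1 ht''] at h3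
      rw [← htr.zigzagPerm_eq, hw, ← zigzagPerm_reverse h'.1, htr'.reverse.zigzagPerm_eq,
        List.reverse_cons]
      exact h3
    rcases htr with htr | htr <;> rcases htr' with htr' | htr'
    · exact traceEquiv_of_concat h h' ht ht' htr htr' hw fun h1 h2 h3 => ih _ hlen h1 h2 h3 rfl
    · exact hfirst (hmixed h h' hw ht ht' htr htr') htr'
    · exact hfirst htr (hmixed h' h hw.symm ht' ht htr' htr)
    · exact hfirst htr htr'

end Words

/-! ### Words avoiding 3412 and 4231 come from sequences -/

section Existence

variable {α : Type} [LinearOrder α] [Fintype α]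
variable {I J K : NonemptyInterval α} {L L' : List (NonemptyInterval α)} {w : Equiv.Perm α}
  {N x y : α}

/-- Suppose that `w` fixes all letters greater than `N`, that the position of `N` is at most the
letter at position `N`, and that `w` avoids 3412 and 4231. Then the letters from `w N` to `N` occur
in decreasing order: an increasing pair of them to the right of the letter `N` gives a pattern
4231, and otherwise there is a pattern 3412; in both the last letter is `w N`. -/
theorem inv_lt_inv_of_avoids (h3412 : Avoids w ![3, 4, 1, 2]) (h4231 : Avoids w ![4, 2, 3, 1])
    (hfix : ∀ x, N < x → w x = x) (hpq : w⁻¹ N ≤ w N) (hx : w N ≤ x) (hxy : x < y)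
    (hy : y ≤ N) : w⁻¹ y < w⁻¹ x := by
  obtain ⟨a, rfl⟩ := w.surjective x
  obtain ⟨b, rfl⟩ := w.surjective y
  obtain ⟨p, hp⟩ : ∃ p, w p = N := w.surjective N
  have hpN : w⁻¹ N = p := by rw [← hp, perm_inv_apply]
  rw [hpN] at hpq
  rw [perm_inv_apply, perm_inv_apply]
  by_contra hc
  have hab : a < b := lt_of_le_of_ne (not_lt.1 hc) fun h => hxy.ne (congrArg w h)
  have hle : ∀ {z}, w z ≤ N → z ≤ N := by
    intro z hz
    by_contra hc
    rw [hfix z (not_le.1 hc)] at hz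
    exact hc hz
  have hbN : b < N := lt_of_le_of_ne (hle hy) (by rintro rfl; exact absurd hx (not_le.2 hxy))
  have haN := hab.trans hbN
  have hqa : w N < w a := lt_of_le_of_ne hx fun h => haN.ne' (w.injective h)
  have hap : a ≠ p := by
    rintro rfl
    rw [hp] at hxy
    exact absurd hy (not_le.2 hxy)
  have hpN' : p < N := lt_of_le_of_ne (hle hp.le) fun h => by
    rw [h] at hp
    exact absurd (hqa.trans (hxy.trans_le hy)) (by rw [hp]; exact lt_irrefl _)
  rcases lt_or_gt_of_ne hap with hlt | hgt
  · -- some position `z` between `p` and `N` carries a letter below `w N`, by counting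
    obtain ⟨z, hpz, hzN, hz⟩ : ∃ z, p < z ∧ z < N ∧ w z < w N := by
      by_contra hno
      push Not at hno
      have hsub : (Finset.univ.filter fun t => t < w N).image (fun t => w⁻¹ t) ⊆
          (Finset.univ.filter fun t => t < p).erase a := by
        intro z hz
        simp only [Finset.mem_image, Finset.mem_filter, Finset.mem_univ, true_and] at hz
        obtain ⟨t, ht, rfl⟩ := hz
        obtain ⟨z, rfl⟩ := w.surjective t
        rw [perm_inv_apply]
        simp only [Finset.mem_erase, Finset.mem_filter, Finset.mem_univ, true_and]
        refine ⟨by rintro rfl; exact lt_asymm ht hqa, ?_⟩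
        by_contra hzp
        have hzN : z ≤ N := hle (ht.trans (hqa.trans (hxy.trans_le hy))).le
        have h1 : z ≠ N := by rintro rfl; exact lt_irrefl _ ht
        have h2 : z ≠ p := by
          rintro rfl
          rw [hp] at ht
          exact lt_asymm ht (hqa.trans (hxy.trans_le hy))
        exact absurd (hno z (lt_of_le_of_ne (not_lt.1 hzp) h2.symm) (lt_of_le_of_ne hzN h1))
          (not_le.2 ht)
      have h1 := Finset.card_le_card hsub
      rw [Finset.card_image_of_injective _ w⁻¹.injective,
        Finset.card_erase_of_mem (by simpa using hlt)] at h1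
      have h2 : (Finset.univ.filter fun t => t < p).card ≤
          (Finset.univ.filter fun t => t < w N).card :=
        Finset.card_le_card fun t ht => by
          simp only [Finset.mem_filter, Finset.mem_univ, true_and] at ht ⊢
          exact ht.trans_le hpq
      have h3 : 0 < (Finset.univ.filter fun t => t < p).card :=
        Finset.card_pos.2 ⟨a, by simpa using hlt⟩
      omega
    refine h3412 ⟨![a, p, z, N], ?_, ?_⟩
    · rw [Fin.strictMono_iff_lt_succ]
      intro i
      fin_cases i
      exacts [hlt, hpz, hzN]
    · have h1 : w z < w a := hz.trans hqa
      have h2 : w a < w p := hp.symm ▸ hxy.trans_le hy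
      have h3 : w z < w p := h1.trans h2
      have h4 : w N < w p := hqa.trans h2
      intro i j
      fin_cases i <;> fin_cases j <;>
        simp [h1, h2, h3, h4, hz, hqa, h1.le, h2.le, h3.le, h4.le, hz.le, hqa.le]
  · have hbp : w b < w p := by
      refine lt_of_le_of_ne (hy.trans hp.ge) fun h => ?_
      exact absurd (w.injective h) (hgt.trans hab).ne'
    refine h4231 ⟨![p, a, b, N], ?_, ?_⟩
    · rw [Fin.strictMono_iff_lt_succ]
      intro i
      fin_cases i
      exacts [hgt, hab, hbN]
    · have h1 : w a < w p := hxy.trans hbp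
      have h2 : w N < w b := hqa.trans hxy
      have h3 : w N < w p := h2.trans hbp
      intro i j
      fin_cases i <;> fin_cases j <;>
        simp [h1, h2, h3, hbp, hxy, hqa, h1.le, h2.le, h3.le, hbp.le, hxy.le, hqa.le]

/-- The lower set generated by the letters less than `q` and the positions that carry such letters
in `w`. If an interval with left end `q` is peeled off at the end of `w`, the remaining word fixes
all letters outside this set. -/
def peelSet (w : Equiv.Perm α) (q : α) : Finset α :=
  Finset.univ.filter fun x => x < q ∨ ∃ y, x ≤ y ∧ w y < q

theorem mem_peelSet {q : α} : x ∈ peelSet w q ↔ x < q ∨ ∃ y, x ≤ y ∧ w y < q := by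
  simp [peelSet]

/-- The last interval can be peeled off: a permutation satisfying the conclusion of
`inv_lt_inv_of_avoids` is the extension of a permutation by `J`. -/
theorem exists_isPeeling (hq : J.fst = w J.snd) (hfix : ∀ x, J.snd < x → w x = x)
    (hanti : ∀ x y, J.fst ≤ x → x < y → y ≤ J.snd → w⁻¹ y < w⁻¹ x) :
    ∃ v, IsPeeling J (peelSet w J.fst) v ∧ w = IsPeeling.extend J (peelSet w J.fst) v := by
  set U := peelSet w J.fst with hU
  have hlower : ∀ x ∈ U, ∀ y ≤ x, y ∈ U := by
    intro x hx y hy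
    rw [mem_peelSet] at hx ⊢
    exact hx.imp hy.trans_lt fun ⟨z, hz, hw⟩ => ⟨z, hy.trans hz, hw⟩
  have hN : J.snd ∉ U := by
    rw [mem_peelSet]
    rintro (h | ⟨y, hy, hwy⟩)
    · exact absurd J.fst_le_snd (not_le.2 h)
    · rcases hy.eq_or_lt with rfl | hlt
      · exact absurd hwy (by rw [hq]; exact lt_irrefl _)
      · rw [hfix y hlt] at hwy
        exact absurd (J.fst_le_snd.trans hy) (not_le.2 hwy)
  have hle : ∀ z ≤ J.snd, w z ≤ J.snd := by
    intro z hz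
    by_contra hc
    have := w.injective (hfix _ (not_le.1 hc))
    exact hc (this.symm ▸ hz)
  have hmem : ∀ z ∈ pts J, z ∉ U → w z ∈ pts J := by
    intro z hz hzU
    refine mem_pts.2 ⟨?_, hle z (mem_pts.1 hz).2⟩
    by_contra hc
    exact hzU (mem_peelSet.2 (Or.inr ⟨z, le_rfl, not_le.1 hc⟩))
  have hup : ∀ z, z ∉ U → ∀ t, z ≤ t → t ∉ U := fun z hz t hzt ht => hz (hlower t ht z hzt)
  have hgt : ∀ {a b}, w a ∈ pts J → w b ∈ pts J → w a < w b → b < a := by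
    intro a b ha hb hab
    have := hanti _ _ (mem_pts.1 ha).1 hab (mem_pts.1 hb).2
    rwa [perm_inv_apply, perm_inv_apply] at this
  -- the positions in `J` outside `U` carry the smallest letters of `J`, in decreasing order
  have hrev : ∀ z, z ∈ pts J → z ∉ U → reversal (pts J) (w z) = z := by
    intro z
    induction z using WellFoundedGT.induction with
    | _ z ih =>
      intro hz hzU
      have hwz := hmem z hz hzU
      have hf := reversal_mem hwz
      have hinj : ∀ {a b}, reversal (pts J) (w a) = reversal (pts J) (w b) → a = b :=
        fun h => w.injective ((reversal _).injective h)
      rcases lt_trichotomy (reversal (pts J) (w z)) z with hlt | heq | hlt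
      · have h1 := reversal_lt hf hz hlt
        rw [reversal_reversal] at h1
        obtain ⟨t, ht⟩ := w.surjective (reversal (pts J) z)
        have htJ : w t ∈ pts J := ht ▸ reversal_mem hz
        have hzt : z < t := hgt htJ hwz (ht ▸ h1)
        have htN : t ≤ J.snd := by
          by_contra hc
          have h2 := hfix t (not_le.1 hc)
          rw [h2] at htJ
          exact hc (mem_pts.1 htJ).2
        have h3 := ih t hzt (mem_pts.2 ⟨(mem_pts.1 hz).1.trans hzt.le, htN⟩) (hup z hzU t hzt.le)
        rw [ht, reversal_reversal] at h3
        exact absurd h3 hzt.ne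
      · exact heq
      · have h3 := ih _ hlt hf (hup z hzU _ hlt.le)
        exact (hinj h3)
  have hv : w = IsPeeling.extend J U (reversal (pts J ∩ U) * reversal (pts J) * w) := by
    ext x
    simp [IsPeeling.extend, Equiv.Perm.mul_apply]
  refine ⟨reversal (pts J ∩ U) * reversal (pts J) * w,
    ⟨hlower, fun x hx => mem_peelSet.2 (Or.inl hx), hN, fun x hx => ?_, fun x hx y hy hxy => ?_⟩, hv⟩
  · rw [Equiv.Perm.mul_apply, Equiv.Perm.mul_apply]
    have hxI : x ∉ pts J ∩ U := fun h => hx (Finset.mem_inter.1 h).2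
    by_cases hxJ : x ∈ pts J
    · rw [hrev x hxJ hx, reversal_apply_of_notMem hxI]
    · have : J.snd < x := by
        by_contra hc
        refine hxJ (mem_pts.2 ⟨?_, not_lt.1 hc⟩)
        by_contra hc'
        exact hx (mem_peelSet.2 (Or.inl (not_le.1 hc')))
      rw [hfix x this, reversal_apply_of_notMem hxJ, reversal_apply_of_notMem hxI]
  · have h1 := reversal_lt hx hy hxy
    have h2 := reversal_lt (Finset.mem_inter.1 (reversal_mem hy)).1
      (Finset.mem_inter.1 (reversal_mem hx)).1 h1
    have h3 := hanti _ _
      (mem_pts.1 (reversal_mem (Finset.mem_inter.1 (reversal_mem hx)).1)).1 h2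
      (mem_pts.1 (reversal_mem (Finset.mem_inter.1 (reversal_mem hy)).1)).2
    simpa [mul_inv_rev, reversal_inv] using h3

/-- If peeling off `J` leaves the word of `L`, then `J` can be added at the end of `L`. -/
theorem IsProper.concat_of_isPeeling (hL : IsProper L) (hJ : J.fst < J.snd)
    (hp : IsPeeling J (peelSet w J.fst) (zigzagPerm L))
    (hw : w = IsPeeling.extend J (peelSet w J.fst) (zigzagPerm L))
    (hfix : ∀ x, J.snd < x → w x = x) (hpq : w⁻¹ J.snd ≤ J.fst) :
    IsProper (L ++ [J]) ∧ zigzagPerm (L ++ [J]) = w := by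
  set U := peelSet w J.fst with hU
  set v := zigzagPerm L with hv
  have hwv : ∀ z, w z < J.fst → v z = w z := by
    intro z hz
    have h1 : w z = IsPeeling.shift J U (v z) := by conv_lhs => rw [hw, Equiv.Perm.mul_apply]
    have h2 : v z ∉ pts J := fun hm => absurd (mem_pts.1 (h1 ▸ IsPeeling.shift_mem hm)).1
      (not_le.2 hz)
    rw [h1, IsPeeling.shift_of_notMem h2]
  have hwv' : ∀ z, v z < J.fst → w z = v z := by
    intro z hz
    conv_lhs => rw [hw]
    exact hp.extend_of_lt hz
  -- the part of `U` in `J` ends where the intervals in `L` end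
  have hright : ∀ J', IsRightmost J' L → J'.snd ∈ U ∧
      ∀ x ∈ U, J.fst ≤ x → x ≤ J'.snd ∧ v J'.snd < J.fst := by
    intro J' hJ'
    have hf := hL.wordFacts hJ'
    have hm : J'.snd ∈ U := by
      by_contra hc
      have := hp.fix _ hc
      exact absurd (hL.2 J' hJ'.1) (not_lt.2 (this ▸ hf.le))
    have hmax : ∀ x ∈ U, J.fst ≤ x → ∃ y, x ≤ y ∧ y ≤ J'.snd ∧ v y < J.fst := by
      intro x hx hJx
      obtain ⟨y, hxy, hy⟩ := (mem_peelSet.1 hx).resolve_left (not_lt.2 hJx)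
      have h1 := hwv y hy
      rw [← h1] at hy
      refine ⟨y, hxy, ?_, hy⟩
      by_contra hc
      rw [hf.fix y (not_le.1 hc)] at hy
      exact absurd (hJx.trans hxy) (not_le.2 hy)
    refine ⟨hm, fun x hx hJx => ?_⟩
    obtain ⟨y, hxy, hym, -⟩ := hmax x hx hJx
    obtain ⟨z, hmz, hzm, hz⟩ := hmax _ hm (hJx.trans (hxy.trans hym))
    rw [le_antisymm hzm hmz] at hz
    exact ⟨hxy.trans hym, hz⟩
  -- the position of the last moved letter of `v`
  have hinv : ∀ J', IsRightmost J' L → J.fst ≤ J'.snd → v⁻¹ J'.snd = w⁻¹ J.snd := by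
    intro J' hJ' hle
    obtain ⟨hm, hmax⟩ := hright J' hJ'
    let M : NonemptyInterval α := ⟨(J.fst, J'.snd), hle⟩
    have hM : pts J ∩ U = pts M := by
      ext x
      rw [Finset.mem_inter, mem_pts, mem_pts]
      constructor
      · rintro ⟨h1, h2⟩
        exact ⟨h1.1, (hmax x h2 h1.1).1⟩
      · rintro ⟨h1, h2⟩
        have hxU := hp.lower _ hm x h2
        exact ⟨⟨h1, (hp.lt_of_mem hxU hp.snd_notMem).le⟩, hxU⟩
    have h1 : reversal (pts M) J.fst = J'.snd := by
      have : M.fst = J.fst := rfl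
      rw [← this, ← reversal_pts_snd M, reversal_reversal]
    rw [hw, IsPeeling.extend, mul_inv_rev, mul_inv_rev, reversal_inv, reversal_inv,
      Equiv.Perm.mul_apply, Equiv.Perm.mul_apply, reversal_pts_snd, hM, h1]
  have hanti : ∀ x ∈ pts J, ∀ y ∈ pts J, x < y → w⁻¹ y < w⁻¹ x := by
    intro x hx y hy hxy
    rw [hw]
    exact hp.extend_anti hx hy hxy
  have ht : IsTop J L := by
    intro I hI
    obtain ⟨J', hJ'⟩ := hL.1.exists_isRightmost (List.ne_nil_of_mem hI)
    have hf := hL.wordFacts hJ'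
    obtain ⟨hm, hmax⟩ := hright J' hJ'
    have hmN : J'.snd < J.snd := hp.lt_of_mem hm hp.snd_notMem
    have hfst : J'.fst < J.fst := by
      by_cases hlt : J'.snd < J.fst
      · exact (hL.2 J' hJ'.1).trans hlt
      have hle := not_lt.1 hlt
      have hvm := (hmax _ hm hle).2
      rcases hf.eq_or_eq with h1 | h1
      · rwa [← h1]
      rw [← h1, hinv J' hJ' hle]
      refine lt_of_le_of_ne hpq fun heq => ?_
      -- otherwise `w` would preserve `J`
      have hmaps : (pts J).image (fun x => w⁻¹ x) ⊆ pts J := by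
        intro z hz
        obtain ⟨x, hx, rfl⟩ := Finset.mem_image.1 hz
        refine mem_pts.2 ⟨?_, ?_⟩
        · rw [← heq]
          rcases (mem_pts.1 hx).2.eq_or_lt with h2 | h2
          · rw [h2]
          · exact (hanti x hx _ (snd_mem_pts J) h2).le
        · by_contra hc
          have := hfix _ (not_le.1 hc)
          rw [perm_apply_inv] at this
          rw [← this] at hc
          exact hc (mem_pts.1 hx).2
      have himg := Finset.eq_of_subset_of_card_le hmaps
        (Finset.card_image_of_injective _ w⁻¹.injective).ge
      have hmJ : J'.snd ∈ pts J := mem_pts.2 ⟨hle, hmN.le⟩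
      rw [← himg, Finset.mem_image] at hmJ
      obtain ⟨a, ha, ham⟩ := hmJ
      rw [← hwv' _ hvm, ← ham, perm_apply_inv] at hvm
      exact absurd (mem_pts.1 ha).1 (not_le.2 hvm)
    by_cases hne : I = J'
    · rw [hne]; exact ⟨hfst, hmN⟩
    · have := hJ'.2 I hI hne
      exact ⟨this.1.trans hfst, this.2.trans hmN⟩
  -- an interval in `L` that meets `J` comes before the rightmost one
  have hbefore : ∀ J', IsRightmost J' L → ∀ K ∈ L, K ≠ J' → J.fst ≤ K.snd →
      ¬ [J', K].Sublist L := by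
    intro J' hJ' K hK hne hle hs
    have hKJ' := hJ'.2 K hK hne
    have hd : ¬ Disjoint (pts J') (pts K) := by
      rw [not_disjoint_pts]
      exact ⟨(ht J' hJ'.1).1.le.trans hle, hKJ'.1.le.trans J'.fst_le_snd⟩
    obtain ⟨J₂, L₂, ht₂, htr | htr⟩ := hL.1.exists_top (List.ne_nil_of_mem hK)
    · obtain rfl := (ht₂.isRightmost_concat.perm htr.perm.symm).eq hJ'
      have h1 := htr.pair_sublist hd hs
      have hK' : K ∈ L₂ := by simpa [hne] using htr.perm.subset hK
      exact pair_sublist_asymm (hL.traceEquiv htr).1.nodup h1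
        (pair_sublist_concat.2 (Or.inr ⟨hK', rfl⟩))
    · obtain rfl := (ht₂.isRightmost_cons.perm htr.perm.symm).eq hJ'
      have hK' : K ∈ L₂ := by simpa [hne] using htr.perm.subset hK
      have h1 := hL.reverse.traceEquiv htr.reverse
      rw [List.reverse_cons] at h1
      have ht₂' : IsTop J₂ L₂.reverse := fun I hI => ht₂ I (by simpa using hI)
      have h2 : IsProper L₂.reverse := h1.sublist (List.sublist_append_left _ _)
      have hpe := isPeeling_of_wordFacts h1.1 ht₂' fun _ => h2.wordFacts
      have h3 : zigzagPerm (L₂.reverse ++ [J₂]) = v⁻¹ := by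
        rw [← List.reverse_cons, ← htr.reverse.zigzagPerm_eq, zigzagPerm_reverse hL.1]
      obtain ⟨y, hy, hvy⟩ := (mem_lowerPart_iff h1 ht₂' (fun _ => h2.wordFacts)
        (ht J₂ hJ'.1).1.le).1 (mem_lowerPart.2 (Or.inr ⟨K, by simpa using hK', hle⟩))
      have h4 := hpe.extend_snd
      rw [IsPeeling.extend, ← zigzagPerm_concat h1.1 ht₂', h3] at h4
      rw [h3, ← h4] at hvy
      have hm := (hright J₂ hJ').1
      have hyle : y ≤ J₂.snd := by
        by_contra hc
        rw [Equiv.Perm.inv_eq_iff_eq.2 ((hL.wordFacts hJ').fix y (not_le.1 hc)).symm, h4] at hvy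
        exact absurd (hL.2 J₂ hJ'.1) (not_lt.2 ((not_le.1 hc).trans hvy).le)
      have hyU := hp.lower _ hm y hyle
      have hJm : ∀ {z}, J.fst ≤ z → z ∈ U → z ∈ pts J ∩ U := fun h1 h2 =>
        Finset.mem_inter.2 ⟨mem_pts.2 ⟨h1, (hp.lt_of_mem h2 hp.snd_notMem).le⟩, h2⟩
      rcases hyle.eq_or_lt with h5 | h5
      · rw [h5] at hvy; exact lt_irrefl _ hvy
      · exact lt_asymm hvy (hp.anti y (hJm hy hyU) _ (hJm (hy.trans hyle) hm) h5)
  have hz : IsZigzag (L ++ [J]) := by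
    obtain ⟨h1, h2, h3⟩ := isZigzag_iff.1 hL.1
    refine isZigzag_iff.2 ⟨?_, ?_, ?_⟩
    · rw [List.nodup_append]
      refine ⟨h1, List.nodup_singleton J, fun a ha b hb => ?_⟩
      rw [List.mem_singleton.1 hb]
      rintro rfl
      exact ht.notMem ha
    · intro I hI K hK hne
      rw [List.mem_append, List.mem_singleton] at hI hK
      rcases hI with hI | rfl <;> rcases hK with hK | rfl
      · exact h2 I hI K hK hne
      · rw [pts_subset_pts]
        exact fun h => absurd (ht I hI).1 (not_lt.2 h.1)
      · rw [pts_subset_pts]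
        exact fun h => absurd (ht K hK).2 (not_lt.2 h.2)
      · exact absurd rfl hne
    · intro I K M hIK hKM hdIK hdKM
      rw [pair_sublist_concat] at hIK hKM
      replace hIK : [I, K].Sublist L := by
        refine hIK.resolve_right ?_
        rintro ⟨-, rfl⟩
        rcases hKM with hKM | hKM
        · exact ht.notMem (mem_of_pair_sublist hKM).1
        · exact ht.notMem hKM.1
      rcases hKM with hKM | ⟨hK, rfl⟩
      · exact h3 I K M hIK hKM hdIK hdKM
      obtain ⟨hI, -⟩ := mem_of_pair_sublist hIK
      have hIK' : I ≠ K := by rintro rfl; exact pair_sublist_asymm h1 hIK hIK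
      have hKM := ht K hK
      by_cases hlt : I.fst < K.fst
      · exact Or.inl ⟨hlt, hKM.1, hL.1.snd_lt hI hK hlt, hKM.2⟩
      exfalso
      have hlt : K.fst < I.fst :=
        lt_of_le_of_ne (not_lt.1 hlt) (hL.1.fst_ne hI hK hIK').symm
      have hlt' := hL.1.snd_lt hK hI hlt
      have hKq := (not_disjoint_pts.1 hdKM).2
      obtain ⟨J', hJ'⟩ := hL.1.exists_isRightmost (List.ne_nil_of_mem hI)
      have hKJ' : K ≠ J' := by
        rintro rfl
        exact absurd (hJ'.2 I hI hIK').1 (lt_asymm hlt)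
      have hno := hbefore J' hJ' K hK hKJ' hKq
      have hs := (pair_sublist_or hK hJ'.1 hKJ').resolve_right hno
      have hK1 := hJ'.2 K hK hKJ'
      -- `I`, `K`, `J'` would violate the second zig-zag condition
      rcases h3 I K J' hIK hs hdIK (by
        rw [not_disjoint_pts]
        exact ⟨hK1.1.le.trans J'.fst_le_snd, (ht J' hJ'.1).1.le.trans hKq⟩) with h5 | h5
      · exact lt_asymm hlt h5.1
      · exact lt_asymm hK1.1 h5.2.1
  have hprop : IsProper (L ++ [J]) := by
    refine ⟨hz, fun I hI => ?_⟩
    rcases List.mem_append.1 hI with hI | hI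
    · exact hL.2 I hI
    · rw [List.mem_singleton.1 hI]; exact hJ
  refine ⟨hprop, ?_⟩
  have hpart : pts J ∩ lowerPart L J = pts J ∩ U := by
    ext x
    rw [Finset.mem_inter, Finset.mem_inter]
    refine and_congr_right fun hx => ?_
    rw [mem_pts] at hx
    constructor
    · intro h
      obtain ⟨I, hI, hxI⟩ := exists_of_mem_lowerPart hx.1 h
      obtain ⟨J', hJ'⟩ := hL.1.exists_isRightmost (List.ne_nil_of_mem hI)
      exact hp.lower _ (hright J' hJ').1 x (hxI.trans (hJ'.snd_le hI))
    · intro h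
      by_cases hne : L = []
      · obtain ⟨y, hxy, hy⟩ := (mem_peelSet.1 h).resolve_left (not_lt.2 hx.1)
        have h1 := hwv y hy
        rw [hv, hne, zigzagPerm_nil, Equiv.Perm.one_apply] at h1
        rw [← h1] at hy
        exact absurd (hx.1.trans hxy) (not_le.2 hy)
      · obtain ⟨J', hJ'⟩ := hL.1.exists_isRightmost hne
        exact mem_lowerPart.2 (Or.inr ⟨J', hJ'.1, ((hright J' hJ').2 x h hx.1).1⟩)
  rw [zigzagPerm_concat hz ht, hpart, hw]

/-- Every permutation that avoids 3412 and 4231 is the word of a zig-zag sequence. -/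
theorem exists_isProper_of_avoids (h3412 : Avoids w ![3, 4, 1, 2])
    (h4231 : Avoids w ![4, 2, 3, 1]) : ∃ L, IsProper L ∧ zigzagPerm L = w := by
  have hone : ∀ {w : Equiv.Perm α}, w ≠ 1 → ∃ N, w N ≠ N ∧ ∀ x, N < x → w x = x := by
    intro w hw
    have hne : (Finset.univ.filter fun x => w x ≠ x).Nonempty := by
      by_contra hc
      rw [Finset.not_nonempty_iff_eq_empty, Finset.filter_eq_empty_iff] at hc
      exact hw (Equiv.ext fun x => by simpa using hc (Finset.mem_univ x))
    obtain ⟨N, hN, hmax⟩ := Finset.exists_max_image _ id hne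
    refine ⟨N, by simpa using hN, fun x hx => ?_⟩
    by_contra hc
    exact absurd (hmax x (by simpa using hc)) (not_le.2 hx)
  have hnil : IsProper ([] : List (NonemptyInterval α)) :=
    ⟨isZigzag_iff.2 ⟨List.nodup_nil, by simp, by simp⟩, by simp⟩
  by_cases hw1 : w = 1
  · exact ⟨[], hnil, hw1.symm⟩
  obtain ⟨N, hN, hfix⟩ := hone hw1
  clear hw1
  induction N using WellFoundedLT.induction generalizing w with
  | _ N ih =>
    have hlt : ∀ {w : Equiv.Perm α}, w N ≠ N → (∀ x, N < x → w x = x) → w N < N := by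
      intro w hN hfix
      refine lt_of_le_of_ne ?_ hN
      by_contra hc
      exact hN (w.injective (hfix _ (not_le.1 hc)))
    -- the case that the last interval ends the sequence
    have key : ∀ {w : Equiv.Perm α}, Avoids w ![3, 4, 1, 2] → Avoids w ![4, 2, 3, 1] → w N ≠ N →
        (∀ x, N < x → w x = x) → w⁻¹ N ≤ w N → ∃ L, IsProper L ∧ zigzagPerm L = w := by
      intro w h3412 h4231 hN hfix hpq
      have hqN := hlt hN hfix
      let J : NonemptyInterval α := ⟨(w N, N), hqN.le⟩
      obtain ⟨v, hp, hw⟩ := exists_isPeeling (J := J) rfl hfix fun x y hx hxy hy =>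
        inv_lt_inv_of_avoids h3412 h4231 hfix hpq hx hxy hy
      have hv3412 : Avoids v ![3, 4, 1, 2] := by rw [← hp.avoids_3412_iff, ← hw]; exact h3412
      have hv4231 : Avoids v ![4, 2, 3, 1] := by rw [← hp.avoids_4231_iff, ← hw]; exact h4231
      obtain ⟨L, hL, rfl⟩ : ∃ L, IsProper L ∧ zigzagPerm L = v := by
        by_cases hv1 : v = 1
        · exact ⟨[], hnil, hv1.symm⟩
        obtain ⟨m, hm, hmfix⟩ := hone hv1
        refine ih m (hp.lt_of_mem ?_ hp.snd_notMem) hv3412 hv4231 hm hmfix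
        by_contra hc
        exact hm (hp.fix m hc)
      have := hL.concat_of_isPeeling hqN hp hw hfix hpq
      exact ⟨_, this.1, this.2⟩
    rcases le_total (w⁻¹ N) (w N) with hpq | hpq
    · exact key h3412 h4231 hN hfix hpq
    · obtain ⟨L, hL, hLw⟩ := key (w := w⁻¹) (avoids_3412_inv h3412) (avoids_4231_inv h4231)
        (fun h => hN (Equiv.Perm.inv_eq_iff_eq.1 h).symm)
        (fun x hx => Equiv.Perm.inv_eq_iff_eq.2 (hfix x hx).symm) (by rwa [inv_inv])
      exact ⟨L.reverse, hL.reverse, by rw [zigzagPerm_reverse hL.1, hLw, inv_inv]⟩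

end Existence

/-! ### Concatenation of networks -/

section BulletAlgebra

variable {α : Type} [LinearOrder α] [Fintype α]

theorem bullet_congr_right (E : Network α) {F F' : Network α} (h : F ≈ F') :
    E.bullet F ≈ E.bullet F' := by
  obtain ⟨e, he⟩ := h
  refine ⟨(Equiv.refl E.V).sumCongr e, ?_⟩
  rintro (i | u | u) ((v | v) | j)
  · rfl
  · exact Finset.sum_congr rfl fun k _ => congrArg _ (he (.inl k) (.inl v))
  · exact Finset.sum_congr rfl fun k _ => congrArg _ (he (.inl k) (.inr j))
  · rfl
  · exact Finset.sum_congr rfl fun k _ => congrArg _ (he (.inl k) (.inl v))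
  · exact Finset.sum_congr rfl fun k _ => congrArg _ (he (.inl k) (.inr j))
  · rfl
  · exact he (.inr u) (.inl v)
  · exact he (.inr u) (.inr j)

theorem bullet_assoc (E F G : Network α) :
    (E.bullet F).bullet G ≈ E.bullet (F.bullet G) := by
  refine ⟨Equiv.sumAssoc _ _ _, ?_⟩
  have key : ∀ a : α → ℕ, ∀ b : α → α → ℕ, ∀ c : α → ℕ,
      ∑ k, a k * ∑ l, b k l * c l = ∑ l, (∑ k, a k * b k l) * c l := by
    intro a b c
    simp only [Finset.mul_sum, Finset.sum_mul, mul_assoc]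
    exact Finset.sum_comm
  rintro (i | (u | u) | u) (((v | v) | v) | j) <;> first | rfl | exact key _ _ _

theorem trivialNetwork_bullet (E : Network α) : (trivialNetwork α).bullet E ≈ E := by
  refine ⟨Equiv.emptySum Empty E.V, ?_⟩
  have key : ∀ (i : α) (f : α → ℕ), f i = ∑ k, (if i = k then 1 else 0) * f k := by simp
  rintro (i | u | u) ((v | v) | j)
  · exact v.elim
  · exact key i fun k => E.mult (.inl k) (.inl v)
  · exact key i fun k => E.mult (.inl k) (.inr j)
  · exact u.elim
  · exact u.elim
  · exact u.elim
  · exact v.elim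
  · rfl
  · rfl

/-- The concatenation `E • X`, written out, where `E` is the star network with one interior vertex
whose wires are those in `s`. -/
def consStar (s : Finset α) (X : Network α) : Network α where
  V := Unit ⊕ X.V
  mult
    | .inl i, .inl (.inl _) => if i ∈ s then 1 else 0
    | .inl i, .inl (.inr v) => if i ∈ s then 0 else X.mult (.inl i) (.inl v)
    | .inl i, .inr j => if i ∈ s then 0 else X.mult (.inl i) (.inr j)
    | .inr (.inl _), .inl (.inl _) => 0
    | .inr (.inl _), .inl (.inr v) => ∑ k ∈ s, X.mult (.inl k) (.inl v)
    | .inr (.inl _), .inr j => ∑ k ∈ s, X.mult (.inl k) (.inr j)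
    | .inr (.inr _), .inl (.inl _) => 0
    | .inr (.inr u), .inl (.inr v) => X.mult (.inr u) (.inl v)
    | .inr (.inr u), .inr j => X.mult (.inr u) (.inr j)

theorem simpleStar_bullet_of_lt {I : NonemptyInterval α} (h : I.fst < I.snd) (X : Network α) :
    (simpleStar I).bullet X ≈ consStar (pts I) X := by
  rw [simpleStar, if_pos h]
  refine ⟨Equiv.refl _, ?_⟩
  have key : ∀ (i : α) (f : α → ℕ), (if i ∈ pts I then 0 else f i) =
      ∑ k, (if i = k ∧ i ∉ pts I then 1 else 0) * f k := by
    intro i f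
    by_cases hi : i ∈ pts I <;> simp [hi]
  have key2 : ∀ f : α → ℕ, ∑ k ∈ pts I, f k = ∑ k, (if k ∈ pts I then 1 else 0) * f k := by
    simp
  rintro (i | u | u) ((v | v) | j)
  · rfl
  · exact key i fun k => X.mult (.inl k) (.inl v)
  · exact key i fun k => X.mult (.inl k) (.inr j)
  · rfl
  · exact key2 fun k => X.mult (.inl k) (.inl v)
  · exact key2 fun k => X.mult (.inl k) (.inr j)
  · rfl
  · rfl
  · rfl

theorem consStar_swap {s t : Finset α} (h : Disjoint s t) (X : Network α) :
    consStar s (consStar t X) ≈ consStar t (consStar s X) := by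
  have hst : ∀ k, k ∈ s → k ∉ t := fun k hs => Finset.disjoint_left.1 h hs
  have hts : ∀ k, k ∈ t → k ∉ s := fun k ht => Finset.disjoint_right.1 h ht
  refine ⟨⟨fun
      | .inl _ => .inr (.inl ())
      | .inr (.inl _) => .inl ()
      | .inr (.inr v) => .inr (.inr v), fun
      | .inl _ => .inr (.inl ())
      | .inr (.inl _) => .inl ()
      | .inr (.inr v) => .inr (.inr v), ?_, ?_⟩, ?_⟩
  · rintro (_ | _ | v) <;> rfl
  · rintro (_ | _ | v) <;> rfl
  have key1 : ∀ {s t : Finset α}, (∀ k, k ∈ s → k ∉ t) → ∀ i,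
      (if i ∈ t then 0 else if i ∈ s then 1 else 0) = if i ∈ s then 1 else 0 := by
    intro s t h i
    by_cases hi : i ∈ s
    · simp [h i hi]
    · simp [hi]
  have key2 : ∀ i (a : ℕ), (if i ∈ t then 0 else if i ∈ s then 0 else a) =
      if i ∈ s then 0 else if i ∈ t then 0 else a := by
    intro i a
    by_cases hs : i ∈ s <;> simp [hs]
  have key3 : ∀ {s t : Finset α}, (∀ k, k ∈ s → k ∉ t) → ∀ f : α → ℕ,
      ∑ k ∈ s, (if k ∈ t then 0 else f k) = ∑ k ∈ s, f k := by
    intro s t h f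
    exact Finset.sum_congr rfl fun k hk => if_neg (h k hk)
  have key4 : ∀ {s t : Finset α}, (∀ k, k ∈ s → k ∉ t) →
      ∑ k ∈ s, (if k ∈ t then 1 else 0) = 0 := by
    intro s t h
    exact Finset.sum_eq_zero fun k hk => if_neg (h k hk)
  rintro (i | _ | _ | u) ((_ | _ | v) | j)
  · exact key1 hst i
  · exact (key1 hts i).symm
  · exact key2 _ _
  · exact key2 _ _
  · rfl
  · exact (key4 hst).symm
  · exact (key3 hst _).symm
  · exact (key3 hst _).symm
  · exact key4 hts
  · rfl
  · exact key3 hts _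
  · exact key3 hts _
  all_goals rfl

variable {I J : NonemptyInterval α} {L L' : List (NonemptyInterval α)}

theorem consStar_congr (s : Finset α) {X Y : Network α} (h : X ≈ Y) :
    consStar s X ≈ consStar s Y := by
  obtain ⟨e, he⟩ := h
  refine ⟨(Equiv.refl Unit).sumCongr e, ?_⟩
  rintro (i | u | u) ((v | v) | j)
  · rfl
  · exact congrArg (fun a => if i ∈ s then 0 else a) (he (.inl i) (.inl v))
  · exact congrArg (fun a => if i ∈ s then 0 else a) (he (.inl i) (.inr j))
  · rfl
  · exact Finset.sum_congr rfl fun k _ => he (.inl k) (.inl v)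
  · exact Finset.sum_congr rfl fun k _ => he (.inl k) (.inr j)
  · rfl
  · exact he (.inr u) (.inl v)
  · exact he (.inr u) (.inr j)

theorem starNetwork_cons_of_lt (h : I.fst < I.snd) :
    starNetwork (I :: L) ≈ consStar (pts I) (starNetwork L) :=
  simpleStar_bullet_of_lt h _

theorem starNetwork_cons_of_not_lt (h : ¬ I.fst < I.snd) :
    starNetwork (I :: L) ≈ starNetwork L := by
  rw [starNetwork, simpleStar, if_neg h]
  exact trivialNetwork_bullet _

theorem TraceEquiv.starNetwork_equiv (h : TraceEquiv L L') : starNetwork L ≈ starNetwork L' := by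
  induction h with
  | nil => exact Setoid.refl _
  | cons I _ ih => exact bullet_congr_right _ ih
  | @swap I J L h =>
    by_cases hI : I.fst < I.snd <;> by_cases hJ : J.fst < J.snd
    · exact Setoid.trans (Setoid.trans (starNetwork_cons_of_lt hI)
        (consStar_congr _ (starNetwork_cons_of_lt hJ))) (Setoid.trans (consStar_swap h _)
        (Setoid.symm (Setoid.trans (starNetwork_cons_of_lt hJ)
        (consStar_congr _ (starNetwork_cons_of_lt hI)))))
    · exact Setoid.trans (bullet_congr_right _ (starNetwork_cons_of_not_lt hJ))
        (Setoid.symm (starNetwork_cons_of_not_lt hJ))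
    · exact Setoid.trans (starNetwork_cons_of_not_lt hI)
        (Setoid.symm (bullet_congr_right _ (starNetwork_cons_of_not_lt hI)))
    · exact Setoid.trans (starNetwork_cons_of_not_lt hI) (Setoid.trans
        (starNetwork_cons_of_not_lt hJ) (Setoid.symm (Setoid.trans (starNetwork_cons_of_not_lt hJ)
        (starNetwork_cons_of_not_lt hI))))
  | trans _ _ ih ih' => exact Setoid.trans ih ih'

/-- The members of `L` with at least two elements. -/
def nontrivialPart (L : List (NonemptyInterval α)) : List (NonemptyInterval α) :=
  L.filter fun I => I.fst < I.snd

theorem starNetwork_nontrivialPart (L : List (NonemptyInterval α)) :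
    starNetwork (nontrivialPart L) ≈ starNetwork L := by
  induction L with
  | nil => exact Setoid.refl _
  | cons I L ih =>
    by_cases h : I.fst < I.snd
    · rw [nontrivialPart, List.filter_cons_of_pos (by simpa using h)]
      exact bullet_congr_right _ ih
    · rw [nontrivialPart, List.filter_cons_of_neg (by simpa using h)]
      exact Setoid.trans ih (Setoid.symm (starNetwork_cons_of_not_lt h))

theorem IsZigzag.isProper_nontrivialPart (h : IsZigzag L) : IsProper (nontrivialPart L) :=
  ⟨h.sublist List.filter_sublist, fun I hI => by simpa using List.of_mem_filter hI⟩

theorem zigzagPerm_nontrivialPart (h : IsZigzag L) :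
    zigzagPerm (nontrivialPart L) = zigzagPerm L := by
  induction L with
  | nil => rfl
  | cons I L ih =>
    have hL : IsZigzag L := h.sublist (List.sublist_cons_self _ _)
    have hz := isZigzag_iff.1 h
    -- a one-element interval is disjoint from all others, as none of them contains it
    have hd : ∀ J K : NonemptyInterval α, J ∈ I :: L → K ∈ I :: L → J ≠ K → ¬ J.fst < J.snd →
        Disjoint (pts J) (pts K) := by
      intro J K hJ hK hne hlt
      by_contra hJK
      rw [not_disjoint_pts] at hJK
      have he : J.fst = J.snd := le_antisymm J.fst_le_snd (not_lt.1 hlt)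
      exact hz.2.1 J hJ K hK hne (pts_subset_pts.2 ⟨he ▸ hJK.2, he ▸ hJK.1⟩)
    have hI : I ∉ L := (List.nodup_cons.1 hz.1).1
    by_cases hlt : I.fst < I.snd
    · rw [nontrivialPart, List.filter_cons_of_pos (by simpa using hlt), zigzagPerm_cons,
        zigzagPerm_cons]
      have key : ∀ (M : List (NonemptyInterval α)) u, (∀ J ∈ M, J ∈ L) → u ⊆ pts I →
          insertions (pts I) u (M.filter fun I => I.fst < I.snd) = insertions (pts I) u M := by
        intro M
        induction M with
        | nil => intros; rfl
        | cons J M ihM =>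
          intro u hM hu
          have hJL := hM J (by simp)
          by_cases hJ : J.fst < J.snd
          · rw [List.filter_cons_of_pos (by simpa using hJ), insertions, insertions,
              ihM _ (fun K hK => hM K (by simp [hK])) (Finset.sdiff_subset.trans hu)]
          · have hne : J ≠ I := by rintro rfl; exact hI hJL
            have := hd J I (by simp [hJL]) (by simp) hne hJ
            rw [List.filter_cons_of_neg (by simpa using hJ),
              insertions_cons_of_disjoint (this.symm.mono_left hu),
              ihM _ (fun K hK => hM K (by simp [hK])) hu]
      rw [key L _ (fun _ h => h) subset_rfl]
      have := ih hL
      rw [nontrivialPart] at this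
      rw [this]
    · have he : I.fst = I.snd := le_antisymm I.fst_le_snd (not_lt.1 hlt)
      rw [nontrivialPart, List.filter_cons_of_neg (by simpa using hlt), zigzagPerm_cons,
        insertions_eq_nil, reversal_eq_one]
      · simpa [nontrivialPart] using ih hL
      · refine Finset.card_le_one.2 fun a ha b hb => ?_
        rw [mem_pts] at ha hb
        rw [← he] at ha hb
        exact (le_antisymm ha.2 ha.1).trans (le_antisymm hb.2 hb.1).symm
      · intro J hJ
        exact hd I J (by simp) (by simp [hJ]) (by rintro rfl; exact hI hJ) hlt

end BulletAlgebra

/-! ### The network determines the sequence -/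

section Wires

variable {α : Type} [LinearOrder α] [Fintype α]
variable {I J : NonemptyInterval α} {L L' : List (NonemptyInterval α)}

/-- The star network of `L`, described wire by wire: the wire `x` leads from source `x` through the
vertices of the intervals containing `x`, in the order of `L`, to sink `x`, and the multiplicity of
an edge is the number of wires which run along it. -/
def wireNetwork (L : List (NonemptyInterval α)) : Network α where
  V := Fin L.length
  mult
    | .inl i, .inl k => if i ∈ pts L[k] ∧ ∀ l < k, i ∉ pts L[l] then 1 else 0
    | .inl i, .inr j => if i = j ∧ ∀ l : Fin L.length, i ∉ pts L[l] then 1 else 0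
    | .inr k, .inl l => if k < l then
        (Finset.univ.filter fun x => x ∈ pts L[k] ∧ x ∈ pts L[l] ∧
          ∀ m, k < m → m < l → x ∉ pts L[m]).card else 0
    | .inr k, .inr j => if j ∈ pts L[k] ∧ ∀ l, k < l → j ∉ pts L[l] then 1 else 0

theorem starNetwork_equiv_wireNetwork (h : ∀ I ∈ L, I.fst < I.snd) :
    starNetwork L ≈ wireNetwork L := by
  induction L with
  | nil =>
    refine ⟨⟨fun v => v.elim, fun v => v.elim0, fun v => v.elim, fun v => v.elim0⟩, ?_⟩
    rintro (i | u) (v | j)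
    · exact v.elim
    · exact if_congr (by simp) rfl rfl
    · exact u.elim
    · exact u.elim
  | cons I L ih =>
    refine Setoid.trans (starNetwork_cons_of_lt (h I (by simp))) (Setoid.trans
      (consStar_congr _ (ih fun J hJ => h J (by simp [hJ]))) ?_)
    have hpos : ∀ {p q : Prop} [Decidable p] [Decidable q] {r : Prop} [Decidable r],
        (p ↔ ¬ q ∧ r) → (if p then 1 else 0) = if q then 0 else if r then 1 else 0 := by
      intro p q _ _ r _ hp
      by_cases hq : q <;> by_cases hr : r <;> simp [hp, hq, hr]
    have hsource : ∀ i (v : Fin L.length),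
        (i ∈ pts (I :: L)[v.succ] ∧ ∀ l < v.succ, i ∉ pts (I :: L)[l]) ↔
          i ∉ pts I ∧ i ∈ pts L[v] ∧ ∀ l < v, i ∉ pts L[l] := by
      intro i v
      simp [Fin.forall_fin_succ]
      tauto
    have hdirect : ∀ i j, (i = j ∧ ∀ l : Fin (L.length + 1), i ∉ pts (I :: L)[l]) ↔
        i ∉ pts I ∧ i = j ∧ ∀ l : Fin L.length, i ∉ pts L[l] := by
      intro i j
      simp [Fin.forall_fin_succ]
      tauto
    have hsink₀ : ∀ j, (j ∈ pts (I :: L)[(0 : Fin (L.length + 1))] ∧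
        ∀ l : Fin (L.length + 1), 0 < l → j ∉ pts (I :: L)[l]) ↔
        j ∈ pts I ∧ ∀ l : Fin L.length, j ∉ pts L[l] := by
      intro j
      simp [Fin.forall_fin_succ]
    have hsink : ∀ (u : Fin L.length) j, (j ∈ pts (I :: L)[u.succ] ∧
        ∀ l : Fin (L.length + 1), u.succ < l → j ∉ pts (I :: L)[l]) ↔
        j ∈ pts L[u] ∧ ∀ l : Fin L.length, u < l → j ∉ pts L[l] := by
      intro u j
      simp [Fin.forall_fin_succ]
    have hedge₀ : ∀ (v : Fin L.length),
        (if (0 : Fin (L.length + 1)) < v.succ then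
          (Finset.univ.filter fun x => x ∈ pts (I :: L)[(0 : Fin (L.length + 1))] ∧
            x ∈ pts (I :: L)[v.succ] ∧
            ∀ m : Fin (L.length + 1), 0 < m → m < v.succ → x ∉ pts (I :: L)[m]).card else 0) =
        ∑ x ∈ pts I, if x ∈ pts L[v] ∧ ∀ l < v, x ∉ pts L[l] then 1 else 0 := by
      intro v
      rw [if_pos (Fin.succ_pos v), ← Finset.card_filter]
      congr 1
      ext x
      simp [Fin.forall_fin_succ]
    have hedge : ∀ (u v : Fin L.length),
        (Finset.univ.filter fun x => x ∈ pts (I :: L)[u.succ] ∧ x ∈ pts (I :: L)[v.succ] ∧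
          ∀ m : Fin (L.length + 1), u.succ < m → m < v.succ → x ∉ pts (I :: L)[m]) =
        Finset.univ.filter fun x => x ∈ pts L[u] ∧ x ∈ pts L[v] ∧
          ∀ m : Fin L.length, u < m → m < v → x ∉ pts L[m] := by
      intro u v
      ext x
      simp [Fin.forall_fin_succ]
    refine ⟨⟨Sum.elim (fun _ => (0 : Fin (L.length + 1))) Fin.succ,
      Fin.cases (Sum.inl ()) Sum.inr, ?_, ?_⟩, ?_⟩
    · rintro (_ | v) <;> rfl
    · intro v
      induction v using Fin.cases <;> rfl
    rintro (i | _ | u) ((_ | v) | j)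
    · refine if_congr ⟨fun h => h.1, fun h => ⟨h, fun l hl => absurd hl (Fin.not_lt_zero l)⟩⟩ rfl rfl
    · exact hpos (hsource i v)
    · exact hpos (hdirect i j)
    · rfl
    · exact hedge₀ v
    · have h1 : ∀ k ∈ pts I, (if k = j ∧ ∀ l : Fin L.length, k ∉ pts L[l] then 1 else 0) =
          if k = j then (if ∀ l : Fin L.length, j ∉ pts L[l] then 1 else 0) else 0 := by
        intro k _
        by_cases hk : k = j
        · subst hk; simp
        · simp [hk]
      refine Eq.trans ?_ ((Finset.sum_congr rfl h1).trans (Finset.sum_ite_eq' _ _ _)).symm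
      exact Eq.trans (if_congr (hsink₀ j) rfl rfl) (ite_and _ _ _ _)
    · rfl
    · exact if_congr Fin.succ_lt_succ_iff (congrArg Finset.card (hedge u v)) rfl
    · exact if_congr (hsink u j) rfl rfl

theorem mem_pts_of_wireNetwork_ne_zero {k : Fin L.length} {x : α}
    (h : (wireNetwork L).mult (.inl x) (.inl k) ≠ 0 ∨
      (wireNetwork L).mult (.inr k) (.inr x) ≠ 0) : x ∈ pts L[k] := by
  rcases h with h | h
  · by_contra hx
    exact h (if_neg fun h' => hx h'.1)
  · by_contra hx
    exact h (if_neg fun h' => hx h'.1)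

/-- The wire of an endpoint of an interval starts or ends at the vertex of this interval: it
cannot pass through both an earlier and a later one, as the three intervals would violate the second
zig-zag condition. -/
theorem IsZigzag.wireNetwork_ne_zero (h : IsZigzag L) {k : Fin L.length} {x : α}
    (hx : x = L[k].fst ∨ x = L[k].snd) : (wireNetwork L).mult (.inl x) (.inl k) ≠ 0 ∨
      (wireNetwork L).mult (.inr k) (.inr x) ≠ 0 := by
  have hxk : x ∈ pts L[k] := by
    rcases hx with rfl | rfl
    exacts [fst_mem_pts _, snd_mem_pts _]
  by_contra hc
  push Not at hc
  have h1 : ∃ l < k, x ∈ pts L[l] := by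
    by_contra hno
    push Not at hno
    have := hc.1
    rw [show (wireNetwork L).mult (.inl x) (.inl k) = 1 from if_pos ⟨hxk, hno⟩] at this
    exact one_ne_zero this
  have h2 : ∃ m, k < m ∧ x ∈ pts L[m] := by
    by_contra hno
    push Not at hno
    have := hc.2
    rw [show (wireNetwork L).mult (.inr k) (.inr x) = 1 from if_pos ⟨hxk, hno⟩] at this
    exact one_ne_zero this
  obtain ⟨l, hl, hxl⟩ := h1
  obtain ⟨m, hm, hxm⟩ := h2
  have h3 := h.2 l k m hl hm ⟨x, Finset.mem_inter.2 ⟨hxl, hxk⟩⟩ ⟨x, Finset.mem_inter.2 ⟨hxk, hxm⟩⟩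
  rw [mem_pts] at hxl hxm
  rcases hx with rfl | rfl <;> rcases h3 with h3 | h3
  · exact absurd hxm.1 (not_le.2 h3.2.1)
  · exact absurd hxl.1 (not_le.2 h3.1)
  · exact absurd hxl.2 (not_le.2 h3.2.2.1)
  · exact absurd hxm.2 (not_le.2 h3.2.2.2)

/-- A zig-zag network determines the sequence of its intervals, up to trace equivalence. -/
theorem traceEquiv_of_starNetwork_equiv (h : IsProper L) (h' : IsProper L')
    (hE : starNetwork L ≈ starNetwork L') : TraceEquiv L L' := by
  have hW : wireNetwork L ≈ wireNetwork L' :=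
    Setoid.trans (Setoid.symm (starNetwork_equiv_wireNetwork h.2))
      (Setoid.trans hE (starNetwork_equiv_wireNetwork h'.2))
  have hsub : ∀ {L L' : List (NonemptyInterval α)} (e : Fin L.length → Fin L'.length),
      IsZigzag L → (∀ i k, (wireNetwork L').mult (.inl i) (.inl (e k)) =
        (wireNetwork L).mult (.inl i) (.inl k)) → (∀ k j,
        (wireNetwork L').mult (.inr (e k)) (.inr j) = (wireNetwork L).mult (.inr k) (.inr j)) →
      ∀ k, pts L[k] ⊆ pts L'[e k] := by
    intro L L' e hL h1 h2 k
    have h3 : ∀ x, x = L[k].fst ∨ x = L[k].snd → x ∈ pts L'[e k] := by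
      intro x hx
      refine mem_pts_of_wireNetwork_ne_zero ?_
      rw [h1, h2]
      exact hL.wireNetwork_ne_zero hx
    rw [pts_subset_pts]
    exact ⟨(mem_pts.1 (h3 _ (Or.inl rfl))).1, (mem_pts.1 (h3 _ (Or.inr rfl))).2⟩
  obtain ⟨e, he⟩ := hW
  change Fin L.length ≃ Fin L'.length at e
  have hsource : ∀ i k, (wireNetwork L').mult (.inl i) (.inl (e k)) =
      (wireNetwork L).mult (.inl i) (.inl k) := fun i k => he (.inl i) (.inl k)
  have hsink : ∀ k j, (wireNetwork L').mult (.inr (e k)) (.inr j) =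
      (wireNetwork L).mult (.inr k) (.inr j) := fun k j => he (.inr k) (.inr j)
  have hedge : ∀ k l, (wireNetwork L').mult (.inr (e k)) (.inl (e l)) =
      (wireNetwork L).mult (.inr k) (.inl l) := fun k l => he (.inr k) (.inl l)
  have heq : ∀ k, L[k] = L'[e k] := by
    intro k
    have h1 := pts_subset_pts.1 (hsub e h.1 hsource hsink k)
    have h2 := pts_subset_pts.1 (hsub e.symm h'.1 (fun i k => by rw [← hsource]; simp)
      (fun k j => by rw [← hsink]; simp) (e k))
    simp only [Equiv.symm_apply_apply] at h2
    exact NonemptyInterval.ext (Prod.ext (le_antisymm h2.1 h1.1) (le_antisymm h1.2 h2.2))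
  -- an edge of the wire network respects the order of the sequence
  have horder : ∀ d : ℕ, ∀ k l : Fin L.length, l.1 - k.1 = d → k < l → ∀ x, x ∈ pts L[k] →
      x ∈ pts L[l] → e k < e l := by
    intro d
    induction d using Nat.strong_induction_on with
    | _ d ih =>
      intro k l hd hkl x hxk hxl
      by_cases hm : ∃ m, k < m ∧ m < l ∧ x ∈ pts L[m]
      · obtain ⟨m, hkm, hml, hxm⟩ := hm
        have h1 : k.1 < m.1 := hkm
        have h2 : m.1 < l.1 := hml
        exact (ih (m.1 - k.1) (by omega) k m rfl hkm x hxk hxm).trans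
          (ih (l.1 - m.1) (by omega) m l rfl hml x hxm hxl)
      · push Not at hm
        by_contra hlt
        have h1 := hedge k l
        rw [show (wireNetwork L').mult (.inr (e k)) (.inl (e l)) = 0 from if_neg hlt] at h1
        have h2 := h1.symm.trans rfl
        refine absurd ((if_pos hkl).symm.trans h2) (Finset.card_ne_zero_of_mem (a := x) ?_)
        simp only [Finset.mem_filter, Finset.mem_univ, true_and]
        exact ⟨hxk, hxl, hm⟩
  refine TraceEquiv.of_pair_sublist h.1.nodup ?_ ?_
  · rw [List.perm_ext_iff_of_nodup h.1.nodup h'.1.nodup]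
    intro I
    constructor
    · intro hI
      obtain ⟨k, hk, rfl⟩ := List.getElem_of_mem hI
      have := heq ⟨k, hk⟩
      simp only [Fin.getElem_fin] at this
      rw [this]
      exact List.getElem_mem _
    · intro hI
      obtain ⟨k, hk, rfl⟩ := List.getElem_of_mem hI
      have := heq (e.symm ⟨k, hk⟩)
      simp only [Fin.getElem_fin, Equiv.apply_symm_apply] at this
      rw [← this]
      exact List.getElem_mem _
  · intro I J hIJ hs
    obtain ⟨k, l, hkl, rfl, rfl⟩ := pair_sublist_iff.1 hs
    obtain ⟨x, hxk, hxl⟩ := Finset.not_disjoint_iff.1 hIJ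
    exact pair_sublist_iff.2 ⟨e k, e l, horder _ k l rfl hkl x hxk hxl, (heq k).symm,
      (heq l).symm⟩

/-- The word of a zig-zag network is well defined. -/
theorem zigzagPerm_eq_of_starNetwork_equiv (h : IsZigzag L) (h' : IsZigzag L')
    (hE : starNetwork L ≈ starNetwork L') : zigzagPerm L = zigzagPerm L' := by
  rw [← zigzagPerm_nontrivialPart h, ← zigzagPerm_nontrivialPart h']
  refine (traceEquiv_of_starNetwork_equiv h.isProper_nontrivialPart h'.isProper_nontrivialPart
    ?_).zigzagPerm_eq
  exact Setoid.trans (starNetwork_nontrivialPart L)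
    (Setoid.trans hE (Setoid.symm (starNetwork_nontrivialPart L')))

/-- Zig-zag networks with the same word are equal. -/
theorem starNetwork_equiv_of_zigzagPerm_eq (h : IsZigzag L) (h' : IsZigzag L')
    (hw : zigzagPerm L = zigzagPerm L') : starNetwork L ≈ starNetwork L' := by
  rw [← zigzagPerm_nontrivialPart h, ← zigzagPerm_nontrivialPart h'] at hw
  have := traceEquiv_of_zigzagPerm_eq h.isProper_nontrivialPart h'.isProper_nontrivialPart hw
  exact Setoid.trans (Setoid.symm (starNetwork_nontrivialPart L))
    (Setoid.trans this.starNetwork_equiv (starNetwork_nontrivialPart L'))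

/-- The word of a zig-zag network avoids 3412 and 4231. -/
theorem IsZigzag.avoids (h : IsZigzag L) :
    Avoids (zigzagPerm L) ![3, 4, 1, 2] ∧ Avoids (zigzagPerm L) ![4, 2, 3, 1] := by
  rw [← zigzagPerm_nontrivialPart h]
  by_cases hne : nontrivialPart L = []
  · rw [hne]
    exact ⟨avoids_one (i := 2) (j := 0) (by decide) (by decide),
      avoids_one (i := 3) (j := 0) (by decide) (by decide)⟩
  · obtain ⟨J, hJ⟩ := h.isProper_nontrivialPart.1.exists_isRightmost hne
    have := h.isProper_nontrivialPart.wordFacts hJ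
    exact ⟨this.avoids_3412, this.avoids_4231⟩

end Wires

/-! ### Negation of letters -/

section Image

variable {α : Type} [LinearOrder α] [Fintype α]

theorem insertions_map {f : α → α} (hf : Function.Injective f)
    {g : NonemptyInterval α → NonemptyInterval α} (hg : ∀ I, pts (g I) = (pts I).image f)
    (s u : Finset α) (L : List (NonemptyInterval α)) :
    insertions (s.image f) (u.image f) (L.map g) = (insertions s u L).map (Finset.image f) := by
  induction L generalizing u with
  | nil => rfl
  | cons J L ih =>
    rw [List.map_cons, insertions, insertions, List.map_append, hg,
      ← Finset.image_inter _ _ hf, ← Finset.image_inter _ _ hf,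
      ← Finset.image_sdiff _ _ hf, ih, Finset.card_image_of_injective _ hf]
    simp only [Finset.image_nonempty]
    split_ifs <;> rfl

end Image

section Bar

variable {n : ℕ} {I J K A B : NonemptyInterval (Letter n)} {L M : List (NonemptyInterval (Letter n))}
  {x y : Letter n}

@[simp] theorem bar_bar (x : Letter n) : bar (bar x) = x := Subtype.ext (neg_neg x.1)

theorem bar_injective : Function.Injective (bar (n := n)) :=
  Function.LeftInverse.injective bar_bar

theorem bar_le_bar : bar x ≤ bar y ↔ y ≤ x := neg_le_neg_iff (a := x.1) (b := y.1)

theorem bar_lt_bar : bar x < bar y ↔ y < x := neg_lt_neg_iff (a := x.1) (b := y.1)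

@[simp] theorem barInterval_barInterval (I : NonemptyInterval (Letter n)) :
    barInterval (barInterval I) = I :=
  NonemptyInterval.ext (Prod.ext (bar_bar _) (bar_bar _))

theorem pts_barInterval (I : NonemptyInterval (Letter n)) :
    pts (barInterval I) = (pts I).image bar := by
  ext x
  rw [mem_pts, Finset.mem_image]
  constructor
  · rintro ⟨h1, h2⟩
    refine ⟨bar x, mem_pts.2 ⟨?_, ?_⟩, bar_bar x⟩
    · rw [← bar_le_bar, bar_bar]; exact h2
    · rw [← bar_le_bar, bar_bar]; exact h1
  · rintro ⟨y, hy, rfl⟩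
    rw [mem_pts] at hy
    exact ⟨bar_le_bar.2 hy.2, bar_le_bar.2 hy.1⟩

/-- The involution `a ↦ -a` as a permutation. -/
def barEquiv (n : ℕ) : Equiv.Perm (Letter n) := ⟨bar, bar, bar_bar, bar_bar⟩

theorem reversal_image_bar (s : Finset (Letter n)) (x : Letter n) :
    reversal (s.image bar) (bar x) = bar (reversal s x) := by
  have h : (barEquiv n).permCongr (reversal s) = reversal (s.image bar) := by
    have hf : ∀ x, (barEquiv n).permCongr (reversal s) x = bar (reversal s (bar x)) := fun _ => rfl
    refine eq_reversal (fun x hx => ?_) (fun x hx => ?_) fun x hx y hy hxy => ?_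
    · have : bar x ∉ s := fun h => hx (Finset.mem_image.2 ⟨_, h, bar_bar x⟩)
      rw [hf, reversal_apply_of_notMem this, bar_bar]
    · obtain ⟨y, hy, rfl⟩ := Finset.mem_image.1 hx
      rw [hf, bar_bar]
      exact Finset.mem_image_of_mem _ (reversal_mem hy)
    · obtain ⟨a, ha, rfl⟩ := Finset.mem_image.1 hx
      obtain ⟨b, hb, rfl⟩ := Finset.mem_image.1 hy
      rw [hf, hf, bar_bar, bar_bar, bar_lt_bar]
      exact reversal_lt hb ha (bar_lt_bar.1 hxy)
  rw [← h]
  exact congrArg (fun z => bar (reversal s z)) (bar_bar x)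

theorem revProd_map_image_bar (l : List (Finset (Letter n))) (x : Letter n) :
    revProd (l.map (Finset.image bar)) (bar x) = bar (revProd l x) := by
  induction l generalizing x with
  | nil => rfl
  | cons s l ih =>
    rw [List.map_cons, revProd_cons, revProd_cons, Equiv.Perm.mul_apply, Equiv.Perm.mul_apply,
      reversal_image_bar, ih]

theorem insertions_map_barInterval (s u : Finset (Letter n)) :
    insertions (s.image bar) (u.image bar) (L.map barInterval) =
      (insertions s u L).map (Finset.image bar) := by
  convert insertions_map bar_injective pts_barInterval s u L

theorem zigzagFactorization_map_barInterval :
    zigzagFactorization (L.map barInterval) =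
      (zigzagFactorization L).map (Finset.image bar) := by
  induction L with
  | nil => rfl
  | cons I L ih =>
    rw [List.map_cons, zigzagFactorization_cons, zigzagFactorization_cons, ih, pts_barInterval,
      insertions_map_barInterval, List.map_cons, List.map_append]

/-- Negating the letters of all intervals conjugates the word with the negation. -/
theorem zigzagPerm_map_barInterval (x : Letter n) :
    zigzagPerm (L.map barInterval) (bar x) = bar (zigzagPerm L x) := by
  change revProd _ _ = bar (revProd _ _)
  rw [zigzagFactorization_map_barInterval, revProd_map_image_bar]

theorem zigzagPerm_mem_hyperoctahedral_iff :
    zigzagPerm L ∈ hyperoctahedral n ↔ zigzagPerm (L.map barInterval) = zigzagPerm L := by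
  constructor
  · intro h
    ext x : 1
    have hx := zigzagPerm_map_barInterval (L := L) (bar x)
    rw [bar_bar, h, bar_bar] at hx
    rw [hx]
  · intro h x
    rw [← zigzagPerm_map_barInterval, h]

theorem pair_sublist_map_barInterval :
    [A, B].Sublist (L.map barInterval) ↔ [barInterval A, barInterval B].Sublist L := by
  have key : ∀ {L : List (NonemptyInterval (Letter n))} {A B}, [A, B].Sublist L →
      [barInterval A, barInterval B].Sublist (L.map barInterval) := fun h => h.map barInterval
  refine ⟨fun h => ?_, fun h => ?_⟩
  · simpa [Function.comp_def] using key h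
  · simpa using key h

theorem disjoint_barInterval :
    Disjoint (pts (barInterval A)) (pts (barInterval B)) ↔ Disjoint (pts A) (pts B) := by
  rw [pts_barInterval, pts_barInterval, Finset.disjoint_image bar_injective]

theorem barInterval_injective : Function.Injective (barInterval (n := n)) :=
  Function.LeftInverse.injective barInterval_barInterval

theorem IsZigzag.map_barInterval (h : IsZigzag L) : IsZigzag (L.map barInterval) := by
  obtain ⟨h1, h2, h3⟩ := isZigzag_iff.1 h
  refine isZigzag_iff.2 ⟨h1.map barInterval_injective, ?_, ?_⟩
  · simp only [List.mem_map]
    rintro _ ⟨I, hI, rfl⟩ _ ⟨J, hJ, rfl⟩ hne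
    rw [pts_barInterval, pts_barInterval, Finset.image_subset_image_iff bar_injective]
    exact h2 I hI J hJ fun h => hne (h ▸ rfl)
  · intro I J K hIJ hJK h h'
    rw [pair_sublist_map_barInterval] at hIJ hJK
    have := h3 _ _ _ hIJ hJK (by rwa [disjoint_barInterval]) (by rwa [disjoint_barInterval])
    simp only [barInterval, bar_lt_bar, gt_iff_lt] at this
    tauto

theorem IsProper.map_barInterval (h : IsProper L) : IsProper (L.map barInterval) := by
  refine ⟨h.1.map_barInterval, ?_⟩
  simp only [List.mem_map]
  rintro _ ⟨I, hI, rfl⟩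
  exact bar_lt_bar.2 (h.2 I hI)

end Bar

/-! ### Sequences of type BC -/

section Symmetrization

variable {n : ℕ} {I J K A B : NonemptyInterval (Letter n)} {L M : List (NonemptyInterval (Letter n))}

/-- The intervals of the type-A star networks that make up the type-BC star network `F'_I`. -/
def mirrored (I : NonemptyInterval (Letter n)) : List (NonemptyInterval (Letter n)) :=
  if 0 < I.fst.1 then [I, barInterval I] else [I]

/-- The sequence of intervals of the type-A star network that is equal to the type-BC star network
of `M`. -/
def symmetrize (M : List (NonemptyInterval (Letter n))) : List (NonemptyInterval (Letter n)) :=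
  M.flatMap mirrored

theorem symmetrize_cons : symmetrize (I :: M) = mirrored I ++ symmetrize M := List.flatMap_cons

theorem mem_mirrored : A ∈ mirrored I ↔ A = I ∨ 0 < I.fst.1 ∧ A = barInterval I := by
  rw [mirrored]
  split_ifs with h <;> simp [h]

theorem pair_sublist_mirrored :
    [A, B].Sublist (mirrored I) ↔ 0 < I.fst.1 ∧ A = I ∧ B = barInterval I := by
  rw [mirrored]
  split_ifs with h
  · simp only [pair_sublist_cons, List.mem_cons, List.not_mem_nil, h]
    simp
  · simp [h]

theorem mem_symmetrize : A ∈ symmetrize M ↔ ∃ I ∈ M, A ∈ mirrored I := List.mem_flatMap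

theorem pair_sublist_symmetrize : [A, B].Sublist (symmetrize M) ↔
    (∃ I ∈ M, 0 < I.fst.1 ∧ A = I ∧ B = barInterval I) ∨
    ∃ I J, [I, J].Sublist M ∧ A ∈ mirrored I ∧ B ∈ mirrored J := by
  induction M with
  | nil => simp [symmetrize]
  | cons K M ih =>
    rw [symmetrize_cons, pair_sublist_append, ih, pair_sublist_mirrored, mem_symmetrize]
    simp only [pair_sublist_cons, List.mem_cons]
    constructor
    · rintro (h | ⟨hA, J, hJ, hB⟩ | ⟨I, hI, h⟩ | ⟨I, J, hs, h⟩)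
      · exact Or.inl ⟨K, Or.inl rfl, h⟩
      · exact Or.inr ⟨K, J, Or.inl ⟨rfl, hJ⟩, hA, hB⟩
      · exact Or.inl ⟨I, Or.inr hI, h⟩
      · exact Or.inr ⟨I, J, Or.inr hs, h⟩
    · rintro (⟨I, rfl | hI, h⟩ | ⟨I, J, ⟨rfl, hJ⟩ | hs, hA, hB⟩)
      · exact Or.inl h
      · exact Or.inr (Or.inr (Or.inl ⟨I, hI, h⟩))
      · exact Or.inr (Or.inl ⟨hA, J, hJ, hB⟩)
      · exact Or.inr (Or.inr (Or.inr ⟨I, J, hs, hA, hB⟩))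

theorem starNetworkBC_equiv (M : List (NonemptyInterval (Letter n))) :
    starNetworkBC M ≈ starNetwork (symmetrize M) := by
  induction M with
  | nil => exact Setoid.refl _
  | cons I M ih =>
    rw [symmetrize_cons, mirrored, starNetworkBC, simpleStarBC]
    split_ifs with h
    · exact Setoid.trans (bullet_assoc _ _ _) (bullet_congr_right _ (bullet_congr_right _ ih))
    · exact bullet_congr_right _ ih

/-- The numerical constraints on the endpoints of an interval indexing a type-BC star network. -/
theorem IsIntervalBC.endpoints (h : IsIntervalBC I) :
    (0 < I.fst.1 ∨ I.fst.1 = -I.snd.1) ∧ I.fst.1 ≤ I.snd.1 ∧ I.fst.1 ≠ 0 ∧ I.snd.1 ≠ 0 := by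
  refine ⟨h.imp_right fun h => ?_, I.fst_le_snd, ?_, ?_⟩
  · rw [h]; rfl
  · exact (Finset.mem_erase.1 I.fst.2).1
  · exact (Finset.mem_erase.1 I.snd.2).1

theorem interval_eq_iff : I = J ↔ I.fst.1 = J.fst.1 ∧ I.snd.1 = J.snd.1 :=
  ⟨by rintro rfl; exact ⟨rfl, rfl⟩,
    fun h => NonemptyInterval.ext (Prod.ext (Subtype.ext h.1) (Subtype.ext h.2))⟩

theorem barInterval_fst : (barInterval I).fst.1 = -I.snd.1 := rfl

theorem barInterval_snd : (barInterval I).snd.1 = -I.fst.1 := rfl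

theorem not_disjoint_pts_int :
    ¬ Disjoint (pts I) (pts J) ↔ I.fst.1 ≤ J.snd.1 ∧ J.fst.1 ≤ I.snd.1 := not_disjoint_pts

theorem pts_subset_pts_int :
    pts I ⊆ pts J ↔ J.fst.1 ≤ I.fst.1 ∧ I.snd.1 ≤ J.snd.1 := pts_subset_pts

theorem eq_of_mem_mirrored (hI : IsIntervalBC I) (hJ : IsIntervalBC J) (hA : A ∈ mirrored I)
    (hA' : A ∈ mirrored J) : I = J := by
  rw [mem_mirrored] at hA hA'
  have h1 := hI.endpoints
  have h2 := hJ.endpoints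
  rcases hA with rfl | ⟨hI', rfl⟩ <;> rcases hA' with h | ⟨hJ', h⟩
  · exact h
  · rw [interval_eq_iff, barInterval_fst, barInterval_snd] at h
    omega
  · rw [interval_eq_iff, barInterval_fst, barInterval_snd] at h
    omega
  · exact barInterval_injective h

theorem not_disjoint_of_mem_mirrored (hI : IsIntervalBC I) (hJ : IsIntervalBC J)
    (hA : A ∈ mirrored I) (hB : B ∈ mirrored J) (h : ¬ Disjoint (pts A) (pts B)) :
    ¬ Disjoint (pts I) (pts J) := by
  rw [mem_mirrored] at hA hB
  have h1 := hI.endpoints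
  have h2 := hJ.endpoints
  rw [not_disjoint_pts_int] at h ⊢
  rcases hA with rfl | ⟨hI', rfl⟩ <;> rcases hB with rfl | ⟨hJ', rfl⟩ <;>
    (try simp only [barInterval_fst, barInterval_snd] at h ⊢) <;> omega

theorem disjoint_barInterval_self (h : 0 < I.fst.1) :
    Disjoint (pts I) (pts (barInterval I)) := by
  have h1 : I.fst.1 ≤ I.snd.1 := I.fst_le_snd
  by_contra hc
  rw [not_disjoint_pts_int, barInterval_fst, barInterval_snd] at hc
  omega

/-- Every type-BC zig-zag network is a type-A zig-zag network. -/
theorem IsZigzag.symmetrize (h : IsZigzag M) (hM : ∀ I ∈ M, IsIntervalBC I) :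
    IsZigzag (symmetrize M) := by
  obtain ⟨h1, h2, h3⟩ := isZigzag_iff.1 h
  refine isZigzag_iff.2 ⟨?_, ?_, ?_⟩
  · rw [ZigZag.symmetrize, List.nodup_flatMap]
    refine ⟨fun I _ => ?_, ?_⟩
    · rw [mirrored]
      split_ifs with hI
      · have h4 : I.fst.1 ≤ I.snd.1 := I.fst_le_snd
        have : I ≠ barInterval I := by
          rw [Ne, interval_eq_iff, barInterval_fst, barInterval_snd]
          omega
        simpa using this
      · simp
    · refine h1.pairwise_of_forall_ne fun I hI J hJ hne => ?_
      rw [Function.onFun, List.disjoint_left]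
      intro A hA hA'
      exact hne (eq_of_mem_mirrored (hM I hI) (hM J hJ) hA hA')
  · intro A hA B hB hne
    obtain ⟨I, hI, hA⟩ := mem_symmetrize.1 hA
    obtain ⟨J, hJ, hB⟩ := mem_symmetrize.1 hB
    have hI' := (hM I hI).endpoints
    have hJ' := (hM J hJ).endpoints
    have h4 := h2 I hI J hJ
    rw [mem_mirrored] at hA hB
    rw [Ne, interval_eq_iff] at h4 hne
    rw [pts_subset_pts_int] at h4 ⊢
    rcases hA with rfl | ⟨_, rfl⟩ <;> rcases hB with rfl | ⟨_, rfl⟩ <;>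
      (try simp only [barInterval_fst, barInterval_snd] at hne ⊢) <;> omega
  · intro A B C hAB hBC hd hd'
    have hpair : ∀ {A B}, [A, B].Sublist (ZigZag.symmetrize M) → ¬ Disjoint (pts A) (pts B) →
        ∃ I J, [I, J].Sublist M ∧ A ∈ mirrored I ∧ B ∈ mirrored J := by
      intro A B hs hd
      refine (pair_sublist_symmetrize.1 hs).resolve_left ?_
      rintro ⟨I, -, hI, rfl, rfl⟩
      exact hd (disjoint_barInterval_self hI)
    obtain ⟨I, J, hIJ, hA, hB⟩ := hpair hAB hd
    obtain ⟨J', K, hJK, hB', hC⟩ := hpair hBC hd'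
    have hIM := hM I (mem_of_pair_sublist hIJ).1
    have hJM := hM J (mem_of_pair_sublist hIJ).2
    have hKM := hM K (mem_of_pair_sublist hJK).2
    obtain rfl := eq_of_mem_mirrored hJM (hM J' (mem_of_pair_sublist hJK).1) hB hB'
    have h4 := h3 I J K hIJ hJK (not_disjoint_of_mem_mirrored hIM hJM hA hB hd)
      (not_disjoint_of_mem_mirrored hJM hKM hB hC hd')
    have hI' := hIM.endpoints
    have hJ' := hJM.endpoints
    have hK' := hKM.endpoints
    rw [not_disjoint_pts_int] at hd hd'
    rw [mem_mirrored] at hA hB hC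
    simp only [← Subtype.coe_lt_coe, gt_iff_lt] at h4 ⊢
    rcases hA with rfl | ⟨_, rfl⟩ <;> rcases hB with rfl | ⟨_, rfl⟩ <;>
      rcases hC with rfl | ⟨_, rfl⟩ <;>
      (try simp only [barInterval_fst, barInterval_snd] at hd hd' ⊢) <;> omega

theorem barInterval_eq_self (h : I.fst = bar I.snd) : barInterval I = I := by
  refine NonemptyInterval.ext (Prod.ext h.symm ?_)
  change bar I.fst = I.snd
  rw [h, bar_bar]

theorem traceEquiv_map_barInterval_symmetrize (hM : ∀ I ∈ M, IsIntervalBC I) :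
    TraceEquiv ((symmetrize M).map barInterval) (symmetrize M) := by
  induction M with
  | nil => exact TraceEquiv.nil
  | cons I M ih =>
    have ih := ih fun J hJ => hM J (by simp [hJ])
    rw [symmetrize_cons, List.map_append]
    refine TraceEquiv.trans (TraceEquiv.append_left _ ih) (TraceEquiv.append_right ?_ _)
    rw [mirrored]
    split_ifs with h
    · simpa using TraceEquiv.swap [] (disjoint_barInterval_self h).symm
    · rw [List.map_singleton, barInterval_eq_self ((hM I (by simp)).resolve_left h)]
      exact TraceEquiv.refl _

theorem zigzagPerm_symmetrize_mem (hM : ∀ I ∈ M, IsIntervalBC I) :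
    zigzagPerm (symmetrize M) ∈ hyperoctahedral n :=
  zigzagPerm_mem_hyperoctahedral_iff.2 (traceEquiv_map_barInterval_symmetrize hM).zigzagPerm_eq

/-- A zig-zag sequence whose word lies in the hyperoctahedral group comes from a sequence of
intervals of type BC: it is trace equivalent to its mirror image, hence an interval different from
its mirror image does not meet it, as otherwise one of them would come before the other in both
sequences. -/
theorem IsProper.exists_symmetrize (h : IsProper L) (hw : zigzagPerm L ∈ hyperoctahedral n) :
    ∃ M, (∀ I ∈ M, IsIntervalBC I) ∧ IsZigzag M ∧ TraceEquiv L (symmetrize M) := by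
  classical
  have htr : TraceEquiv L (L.map barInterval) :=
    traceEquiv_of_zigzagPerm_eq h h.map_barInterval (zigzagPerm_mem_hyperoctahedral_iff.1 hw).symm
  have hbar : ∀ {I}, I ∈ L → barInterval I ∈ L := by
    intro I hI
    obtain ⟨J, hJ, rfl⟩ := List.mem_map.1 (htr.perm.subset hI)
    simpa using hJ
  have hpair : ∀ {I J}, ¬ Disjoint (pts I) (pts J) → [I, J].Sublist L →
      [barInterval I, barInterval J].Sublist L := fun hd hs =>
    pair_sublist_map_barInterval.1 (htr.pair_sublist hd hs)
  have hcases : ∀ I ∈ L, IsIntervalBC I ∨ I.snd.1 < 0 := by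
    intro I hI
    by_contra hc
    have h1 : ¬ Disjoint (pts I) (pts (barInterval I)) := by
      rw [not_disjoint_pts_int, barInterval_fst, barInterval_snd]
      rw [IsIntervalBC] at hc
      omega
    have h2 : I ≠ barInterval I := fun he => hc (Or.inl (Or.inr (congrArg (·.fst) he)))
    rcases pair_sublist_or hI (hbar hI) h2 with h3 | h3
    · have h4 := hpair h1 h3
      rw [barInterval_barInterval] at h4
      exact pair_sublist_asymm h.1.nodup h3 h4
    · have h4 := hpair (not_disjoint_pts_comm.1 h1) h3
      rw [barInterval_barInterval] at h4
      exact pair_sublist_asymm h.1.nodup h3 h4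
  have hneg : ∀ {I : NonemptyInterval (Letter n)}, I.snd.1 < 0 → 0 < (barInterval I).fst.1 := by
    intro I hI
    rw [barInterval_fst]
    omega
  let M := L.filter fun I => IsIntervalBC I
  have hM : ∀ I ∈ M, IsIntervalBC I := fun I hI => by simpa using List.of_mem_filter hI
  have hMz : IsZigzag M := h.1.sublist List.filter_sublist
  have hmem : ∀ {I}, I ∈ L → IsIntervalBC I → I ∈ M := fun hI hI' =>
    List.mem_filter.2 ⟨hI, by simpa using hI'⟩
  have hMpair : ∀ {I J}, [I, J].Sublist L → IsIntervalBC I → IsIntervalBC J →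
      [I, J].Sublist M := by
    intro I J hs hI hJ
    have := hs.filter fun I => decide (IsIntervalBC I)
    simpa [hI, hJ] using this
  refine ⟨M, hM, hMz, TraceEquiv.of_pair_sublist h.1.nodup ?_ ?_⟩
  · rw [List.perm_ext_iff_of_nodup h.1.nodup (hMz.symmetrize hM).nodup]
    intro A
    rw [mem_symmetrize]
    constructor
    · intro hA
      rcases hcases A hA with h1 | h1
      · exact ⟨A, hmem hA h1, mem_mirrored.2 (Or.inl rfl)⟩
      · refine ⟨barInterval A, hmem (hbar hA) (Or.inl (hneg h1)), mem_mirrored.2 (Or.inr ?_)⟩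
        exact ⟨hneg h1, (barInterval_barInterval A).symm⟩
    · rintro ⟨I, hI, hA⟩
      have hIL : I ∈ L := List.mem_of_mem_filter hI
      rcases mem_mirrored.1 hA with rfl | ⟨-, rfl⟩
      exacts [hIL, hbar hIL]
  · intro A B hd hs
    obtain ⟨hA, hB⟩ := mem_of_pair_sublist hs
    rw [pair_sublist_symmetrize]
    right
    by_cases hBC : IsIntervalBC A ∧ IsIntervalBC B
    · exact ⟨A, B, hMpair hs hBC.1 hBC.2, mem_mirrored.2 (Or.inl rfl), mem_mirrored.2 (Or.inl rfl)⟩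
    · -- both intervals are negative or symmetric
      have hA' := hcases A hA
      have hB' := hcases B hB
      have hd' := not_disjoint_pts_int.1 hd
      have hno : ¬ 0 < A.fst.1 ∧ ¬ 0 < B.fst.1 := by
        have h1 : A.fst.1 ≤ A.snd.1 := A.fst_le_snd
        have h2 : B.fst.1 ≤ B.snd.1 := B.fst_le_snd
        rcases hA' with hA' | hA'
        · have hB'' := hB'.resolve_left fun h => hBC ⟨hA', h⟩
          omega
        · omega
      have key : ∀ {I : NonemptyInterval (Letter n)}, IsIntervalBC I ∨ I.snd.1 < 0 → ¬ 0 < I.fst.1 →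
          IsIntervalBC (barInterval I) ∧ I ∈ mirrored (barInterval I) := by
        rintro I ((hI | hI) | hI) hI'
        · exact absurd hI hI'
        · rw [barInterval_eq_self hI]
          exact ⟨Or.inr hI, mem_mirrored.2 (Or.inl rfl)⟩
        · exact ⟨Or.inl (hneg hI), mem_mirrored.2
            (Or.inr ⟨hneg hI, (barInterval_barInterval I).symm⟩)⟩
      have h1 := key hA' hno.1
      have h2 := key hB' hno.2
      exact ⟨barInterval A, barInterval B, hMpair (hpair hd hs) h1.1 h2.1, h1.2, h2.2⟩

/-- A zig-zag network whose word lies in the hyperoctahedral group is of type BC. -/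
theorem IsZigzag.mem_znetBC (h : IsZigzag L) (hw : zigzagPerm L ∈ hyperoctahedral n) :
    (⟦starNetwork L⟧ : NetworkClass (Letter n)) ∈ znetBC n := by
  rw [← zigzagPerm_nontrivialPart h] at hw
  obtain ⟨M, hM, hMz, htr⟩ := h.isProper_nontrivialPart.exists_symmetrize hw
  exact ⟨M, hM, hMz, Quotient.sound (Setoid.trans (Setoid.symm (starNetwork_nontrivialPart L))
    (Setoid.trans htr.starNetwork_equiv (Setoid.symm (starNetworkBC_equiv M))))⟩

theorem exists_isZigzag_of_mem_znetBC {F : NetworkClass (Letter n)} (hF : F ∈ znetBC n) :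
    ∃ L, IsZigzag L ∧ F = ⟦starNetwork L⟧ ∧ zigzagPerm L ∈ hyperoctahedral n := by
  obtain ⟨M, hM, hMz, rfl⟩ := hF
  exact ⟨symmetrize M, hMz.symmetrize hM, Quotient.sound (starNetworkBC_equiv M),
    zigzagPerm_symmetrize_mem hM⟩

end Symmetrization

/-! ### Networks and words -/

section Correspondence

variable {α : Type} [LinearOrder α] [Fintype α]

theorem IsZigzagNetworkOf.word_unique {F : NetworkClass α} {w w' : Equiv.Perm α}
    (h : IsZigzagNetworkOf F w) (h' : IsZigzagNetworkOf F w') : w = w' := by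
  obtain ⟨L, hL, rfl, rfl⟩ := h
  obtain ⟨L', hL', hF, rfl⟩ := h'
  exact zigzagPerm_eq_of_starNetwork_equiv hL hL' (Quotient.exact hF)

theorem IsZigzagNetworkOf.network_unique {F F' : NetworkClass α} {w : Equiv.Perm α}
    (h : IsZigzagNetworkOf F w) (h' : IsZigzagNetworkOf F' w) : F = F' := by
  obtain ⟨L, hL, rfl, rfl⟩ := h
  obtain ⟨L', hL', rfl, hw⟩ := h'
  exact Quotient.sound (starNetwork_equiv_of_zigzagPerm_eq hL hL' hw)

end Correspondence

end ZigZag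

/-- The type-BC zig-zag networks are exactly the type-A zig-zag networks `F_w` with `w` in the
hyperoctahedral group, and `F ↦ w(F)`, with inverse `w ↦ F_w`, is a (well-defined) bijection from
them to the elements of the hyperoctahedral group that avoid 3412 and 4231. -/
theorem theorem5p9 (n : ℕ) :
    ZigZag.znetBC n =
      {F | F ∈ ZigZag.znetA (ZigZag.Letter n) ∧
        ∃ w ∈ ZigZag.hyperoctahedral n, ZigZag.IsZigzagNetworkOf F w} ∧
    ∃ Φ : ZigZag.znetBC n ≃ ZigZag.avoidingBC n,
      (∀ (F : ZigZag.znetBC n) (w : Equiv.Perm (ZigZag.Letter n)),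
        ZigZag.IsZigzagNetworkOf F.1 w ↔ w = (Φ F).1) ∧
      (∀ (w : ZigZag.avoidingBC n) (F : ZigZag.NetworkClass (ZigZag.Letter n)),
        ZigZag.IsZigzagNetworkOf F w.1 ↔ F = (Φ.symm w).1) := by
  have hword : ∀ F : ZigZag.znetBC n, ∃ w : ZigZag.avoidingBC n,
      ZigZag.IsZigzagNetworkOf F.1 w.1 := by
    rintro ⟨F, hF⟩
    obtain ⟨L, hL, rfl, hw⟩ := ZigZag.exists_isZigzag_of_mem_znetBC hF
    exact ⟨⟨_, hw, hL.avoids⟩, L, hL, rfl, rfl⟩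
  have hnet : ∀ w : ZigZag.avoidingBC n, ∃ F : ZigZag.znetBC n,
      ZigZag.IsZigzagNetworkOf F.1 w.1 := by
    rintro ⟨w, hw, h1, h2⟩
    obtain ⟨L, hL, rfl⟩ := ZigZag.exists_isProper_of_avoids h1 h2
    exact ⟨⟨_, hL.1.mem_znetBC hw⟩, L, hL.1, rfl, rfl⟩
  choose f hf using hword
  choose g hg using hnet
  refine ⟨?_, ⟨f, g, fun F => ?_, fun w => ?_⟩, fun F w => ?_, fun w F => ?_⟩
  · ext F
    constructor
    · intro hF
      obtain ⟨L, hL, rfl, hw⟩ := ZigZag.exists_isZigzag_of_mem_znetBC hF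
      exact ⟨⟨L, hL, rfl⟩, _, hw, L, hL, rfl, rfl⟩
    · rintro ⟨-, _, hw, L, hL, rfl, rfl⟩
      exact hL.mem_znetBC hw
  · exact Subtype.ext ((hg _).network_unique (hf F))
  · exact Subtype.ext ((hf _).word_unique (hg w))
  · exact ⟨fun h => h.word_unique (hf F), fun h => by rw [h]; exact hf F⟩
  · exact ⟨fun h => h.network_unique (hg w), fun h => by rw [h]; exact hg w⟩
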